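/- \textsc{$p$-Weighted $\lambda$-ECS} is the following problem. The input is a graph or a digraph $G$ with $n\ge 1$ vertices and edge set $E(G)$ (a set of unordered, respectively ordered, pairs of vertices) that is $\lambda$-edge-connected for a positive integer $\lambda$, a weight function $w:E(G)\to\mathbb{R}_{\ge 0}$, a target weight $\alpha\in\mathbb{R}$ and an integer $k\ge 0$, the parameter. The task is to decide whether there is a set $F\subseteq E(G)$ with $|F|\le k$ and $w(F)\ge\alpha$ such that $G-F$ is also $\lambda$-edge-connected, and to output such a set $F$ if there is one. Here a graph (digraph) is $\lambda$-edge-connected if it is connected (strongly connected) and deleting any set of at most $\lambda-1$ edges leaves it connected (strongly connected). \textbf{Theorem.} \textsc{$p$-Weighted $\lambda$-ECS} can be solved in time $2^{O(k\log k)}\,n^{O(1)}$, where the exponent of $n$ is an absolute constant, in particular independent of $\lambda$, and the constants hidden in $2^{O(k\log k)}$ may depend on $\lambda$. More precisely, both for digraphs and for undirected graphs there is a single algorithm, to which $\lambda$ is given as part of the input, that solves the problem in time $2^{O(k(\log k+\log\lambda))}\,n^{O(1)}$ with absolute constants. In other words, there is an absolute constant $c$ such that on every input the algorithm makes at most $c\cdot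 2^{c\,k(\log_2 k+\log_2\lambda)}\,n^{c}$ steps, and for every $\lambda$ there is a constant $d_\lambda$ such that it makes at most $d_\lambda\cdot 2^{d_\lambda k\log_2 k}\,n^{c}$ steps (with $0\log_2 0=0$). The model of computation is a random access machine with natural-number and real registers whose unit-cost operations are reading and writing of (indirectly addressed) registers, addition, subtraction and comparison, and which has no real constants other than $0$ and no conversion of reals to integers. -/

import Mathlib

open scoped NNReal

namespace WeightedECS

/-! ## Graphs, digraphs and edge-connectivity -/

/-- The two kinds of graphs under consideration. -/
inductive Kind where
  | directed
  | undirected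

/-- Edges on a vertex set `V`: ordered pairs for digraphs, unordered pairs for graphs. -/
abbrev Kind.Edge : Kind → Type → Type
  | .directed, V => V × V
  | .undirected, V => Sym2 V

/-- `K.Joins e u v`: the edge `e` can be traversed from `u` to `v`. -/
abbrev Kind.Joins {V : Type} : (K : Kind) → K.Edge V → V → V → Prop
  | .directed, e, u, v => e = (u, v)
  | .undirected, e, u, v => e = s(u, v)

/-- The (di)graph with vertex set `V` and edge set `E` is connected (strongly connected, if
directed): every vertex is reachable from every vertex. -/
def Connected (K : Kind) {V : Type} (E : Set (K.Edge V)) : Prop :=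
  ∀ u v : V, Relation.ReflTransGen (fun a b => ∃ e ∈ E, K.Joins e a b) u v

/-- A (strongly) connected (di)graph is `lam`-edge-connected if deleting any set of at most
`lam - 1` edges leaves it (strongly) connected. -/
def EdgeConnected (K : Kind) (lam : ℕ) {V : Type} (E : Set (K.Edge V)) : Prop :=
  Connected K E ∧
    ∀ S : Finset (K.Edge V), (S : Set (K.Edge V)) ⊆ E → S.card < lam →
      Connected K (E \ (S : Set (K.Edge V)))

/-! ## The computational problem -/

/-- An instance: a `lam`-edge-connected (di)graph on `n` vertices with edge set `E`, a nonnegative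
real edge weight `w` (only its values on `E` matter), a target weight `α` and a budget `k`. -/
structure Instance (K : Kind) where
  n : ℕ
  n_pos : 0 < n
  E : Finset (K.Edge (Fin n))
  lam : ℕ
  lam_pos : 0 < lam
  edgeConnected : EdgeConnected K lam (E : Set (K.Edge (Fin n)))
  w : K.Edge (Fin n) → ℝ≥0
  α : ℝ
  k : ℕ

/-- `F` is a set of at most `k` edges of total weight at least `α` whose deletion leaves the
(di)graph `lam`-edge-connected. -/
def Instance.IsSolution {K : Kind} (I : Instance K) (F : Finset (K.Edge (Fin I.n))) : Prop :=
  F ⊆ I.E ∧ F.card ≤ I.k ∧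
    EdgeConnected K I.lam ((I.E : Set (K.Edge (Fin I.n))) \ (F : Set (K.Edge (Fin I.n)))) ∧
    I.α ≤ ∑ e ∈ F, (I.w e : ℝ)

/-! ## The machine model: structured programs on an additive real RAM

A memory consists of arrays of natural numbers and arrays of real numbers; a program mentions
finitely many of them, with computed indices. The only arithmetic operations are addition and
subtraction, the only tests are comparisons, there are no real constants besides `0`, and
reals cannot be converted to natural numbers. Every operation costs one step. -/

/-- A memory: `nat a i` and `real a i` are the contents of cell `i` of array `a`. -/
structure Memory where
  nat : ℕ → ℕ → ℕ
  real : ℕ → ℕ → ℝ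

/-- Expressions with values in the natural numbers. -/
inductive NatExpr where
  | lit (c : ℕ)
  | read (a : ℕ) (i : NatExpr)
  | add (x y : NatExpr)
  | sub (x y : NatExpr)

/-- The value of an expression (the subtraction is truncated at `0`). -/
def NatExpr.eval (σ : Memory) : NatExpr → ℕ
  | .lit c => c
  | .read a i => σ.nat a (i.eval σ)
  | .add x y => x.eval σ + y.eval σ
  | .sub x y => x.eval σ - y.eval σ

/-- The number of steps that the evaluation takes. -/
def NatExpr.cost : NatExpr → ℕ
  | .lit _ => 1
  | .read _ i => i.cost + 1
  | .add x y => x.cost + y.cost + 1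
  | .sub x y => x.cost + y.cost + 1

/-- Expressions with real values. -/
inductive RealExpr where
  | zero
  | read (a : ℕ) (i : NatExpr)
  | add (x y : RealExpr)
  | sub (x y : RealExpr)

/-- The value of an expression. -/
noncomputable def RealExpr.eval (σ : Memory) : RealExpr → ℝ
  | .zero => 0
  | .read a i => σ.real a (i.eval σ)
  | .add x y => x.eval σ + y.eval σ
  | .sub x y => x.eval σ - y.eval σ

/-- The number of steps that the evaluation takes. -/
def RealExpr.cost : RealExpr → ℕ
  | .zero => 1
  | .read _ i => i.cost + 1
  | .add x y => x.cost + y.cost + 1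
  | .sub x y => x.cost + y.cost + 1

/-- Tests. -/
inductive Test where
  | natLe (x y : NatExpr)
  | realLe (x y : RealExpr)
  | not (b : Test)
  | and (b c : Test)

/-- The truth value of a test. -/
def Test.Holds (σ : Memory) : Test → Prop
  | .natLe x y => x.eval σ ≤ y.eval σ
  | .realLe x y => x.eval σ ≤ y.eval σ
  | .not b => ¬ b.Holds σ
  | .and b c => b.Holds σ ∧ c.Holds σ

/-- The number of steps that a test takes. -/
def Test.cost : Test → ℕ
  | .natLe x y => x.cost + y.cost + 1
  | .realLe x y => x.cost + y.cost + 1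
  | .not b => b.cost + 1
  | .and b c => b.cost + c.cost + 1

/-- Programs. `setNat a i x` stores the value of `x` in cell `i` of the array `a` of natural
numbers, and `setReal a i x` does the same for an array of reals. -/
inductive Program where
  | skip
  | setNat (a : ℕ) (i x : NatExpr)
  | setReal (a : ℕ) (i : NatExpr) (x : RealExpr)
  | seq (P Q : Program)
  | ite (b : Test) (P Q : Program)
  | loop (b : Test) (P : Program)

/-- The memory after a natural number has been stored. -/
def Memory.storeNat (σ : Memory) (a i x : ℕ) : Memory :=
  { σ with nat := Function.update σ.nat a (Function.update (σ.nat a) i x) }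

/-- The memory after a real number has been stored. -/
noncomputable def Memory.storeReal (σ : Memory) (a i : ℕ) (x : ℝ) : Memory :=
  { σ with real := Function.update σ.real a (Function.update (σ.real a) i x) }

/-- `Runs P σ t σ'`: started with memory `σ`, the program `P` halts after exactly `t` steps with
memory `σ'`. -/
inductive Runs : Program → Memory → ℕ → Memory → Prop where
  | skip (σ : Memory) : Runs .skip σ 1 σ
  | setNat (σ : Memory) (a : ℕ) (i x : NatExpr) :
      Runs (.setNat a i x) σ (i.cost + x.cost + 1) (σ.storeNat a (i.eval σ) (x.eval σ))
  | setReal (σ : Memory) (a : ℕ) (i : NatExpr) (x : RealExpr) :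
      Runs (.setReal a i x) σ (i.cost + x.cost + 1) (σ.storeReal a (i.eval σ) (x.eval σ))
  | seq {P Q : Program} {σ σ₁ σ₂ : Memory} {s t : ℕ} :
      Runs P σ s σ₁ → Runs Q σ₁ t σ₂ → Runs (.seq P Q) σ (s + t) σ₂
  | iteTrue {b : Test} {P Q : Program} {σ σ₁ : Memory} {t : ℕ} :
      b.Holds σ → Runs P σ t σ₁ → Runs (.ite b P Q) σ (b.cost + t) σ₁
  | iteFalse {b : Test} {P Q : Program} {σ σ₁ : Memory} {t : ℕ} :
      ¬ b.Holds σ → Runs Q σ t σ₁ → Runs (.ite b P Q) σ (b.cost + t) σ₁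
  | loopTrue {b : Test} {P : Program} {σ σ₁ σ₂ : Memory} {s t : ℕ} :
      b.Holds σ → Runs P σ s σ₁ → Runs (.loop b P) σ₁ t σ₂ →
        Runs (.loop b P) σ (b.cost + s + t) σ₂
  | loopFalse {b : Test} {P : Program} {σ : Memory} :
      ¬ b.Holds σ → Runs (.loop b P) σ b.cost σ

/-! ## Input, output, running time -/

/-- The memory `σ` holds the instance `I` as an edge list in the order `en`, and nothing else.
Array `0` of naturals: the numbers `n`, `|E|`, `lam`, `k`. Arrays `1` and `2`: the first and second
endpoint of each edge (tail and head in a digraph, in either order in a graph).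
Array `0` of reals: the target `α`. Array `1` of reals: the weight of each edge. -/
structure IsInput {K : Kind} (I : Instance K) (en : Fin I.E.card ≃ I.E) (σ : Memory) : Prop where
  num_vertices : σ.nat 0 0 = I.n
  num_edges : σ.nat 0 1 = I.E.card
  connectivity : σ.nat 0 2 = I.lam
  budget : σ.nat 0 3 = I.k
  ends : ∀ i : Fin I.E.card, ∃ u v : Fin I.n,
    K.Joins (en i : K.Edge (Fin I.n)) u v ∧ σ.nat 1 i = u ∧ σ.nat 2 i = v
  target : σ.real 0 0 = I.α
  weight : ∀ i : Fin I.E.card, σ.real 1 i = I.w (en i)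
  blank_nat_zero : ∀ j, 4 ≤ j → σ.nat 0 j = 0
  blank_nat_ends : ∀ j, I.E.card ≤ j → σ.nat 1 j = 0 ∧ σ.nat 2 j = 0
  blank_nat : ∀ a j, 3 ≤ a → σ.nat a j = 0
  blank_real_zero : ∀ j, 1 ≤ j → σ.real 0 j = 0
  blank_real_weight : ∀ j, I.E.card ≤ j → σ.real 1 j = 0
  blank_real : ∀ a j, 2 ≤ a → σ.real a j = 0

/-- The memory `σ` holds a correct answer: either cell `0` of array `3` is `1` and the edges marked
by `1` in array `4` form a solution, or that cell is `0` and there is no solution. -/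
def IsOutput {K : Kind} (I : Instance K) (en : Fin I.E.card ≃ I.E) (σ : Memory) : Prop :=
  (σ.nat 3 0 = 1 ∧ ∃ F : Finset (K.Edge (Fin I.n)), I.IsSolution F ∧
      ∀ i : Fin I.E.card, σ.nat 4 i = 1 ↔ (en i : K.Edge (Fin I.n)) ∈ F) ∨
  (σ.nat 3 0 = 0 ∧ ¬ ∃ F : Finset (K.Edge (Fin I.n)), I.IsSolution F)

/-- On every instance `I`, presented in any order of the edges, the program `P` halts after at most
`T I` steps with a correct answer. -/
def SolvesWithin (K : Kind) (P : Program) (T : Instance K → ℝ) : Prop :=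
  ∀ (I : Instance K) (en : Fin I.E.card ≃ I.E) (σ : Memory), IsInput I en σ →
    ∃ (t : ℕ) (σ' : Memory), Runs P σ t σ' ∧ (t : ℝ) ≤ T I ∧ IsOutput I en σ'

end WeightedECS

/-! The algorithm is a bounded search. It deletes edges one at a time, k times, each time choosing
among the N = 4·lam·k² heaviest edges whose single deletion keeps the current graph
lam-edge-connected, and it tries all N^k sequences of choices. Every sequence yields an admissible
deletion set, so only completeness needs an argument. `exists_small_rank` provides it: a nonempty
admissible set F of at most k edges can be replaced by one of at least the same weight that contains
one of the N heaviest deletable edges. `exists_run_weight` iterates this.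

Suppose that F avoids these N edges, and call their set L; each edge of L weighs at least as much as
every edge of F. By `exists_exchange`, some edge of L can be added to F, or exchanged for an edge of
F, or |F| edges of L are jointly deletable; each outcome gives a replacement for F without loss of
weight. For the proof let no edge of L be addable. If F is deleted edge by edge, every f in L
becomes undeletable at some moment, so a single edge e = uv of F is responsible for more than
lam·(4|F| - 1) of them (`exists_critical_edge`). Let E be the edge set just before e is deleted and
D what remains without F. Each such f lies together with e in a cut X_f that has lam + 1 edges in E
and lam in D, hence is a minimum cut between u and v in D. Menger's theorem gives lam arc-disjoint
paths that cover all these cuts. So one path contains at least 4|F| of the edges f, and it crosses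
each X_f exactly once, at f (`exists_common_path`).

In a digraph, any |F| of these edges can be deleted together: submodularity, applied to an arbitrary
set and the X_f of the first or last relevant edge on the path, shows that every cut stays large
enough (`cutConnected_sdiff_path`). In a graph, some f can be exchanged for e. Otherwise each f lies
in a cut Y_f with lam edges in D that does not separate u from v. After the edges are split into two
classes by the end of f that lies in Y_f, sub- and posimodularity make the sets of each class
disjoint (`exists_disjoint_cuts`). Each Y_f is left by an edge of F that is deleted after e. There
are at most |F| - 1 of these, with two ends each, so the two classes have at most 4(|F| - 1) edges,
a contradiction.

For the implementation, lam-edge-connectivity means that every cut has at least lam edges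
(`edgeConnected_iff`), which is tested by augmenting flows for all pairs of vertices; the sequences
of choices are run through as a k-digit counter in base N. The running time is dominated by N^k =
4^k·k^(2k)·lam^k, which is at most a constant times a power of k^k·lam^k = 2^(k(log k + log lam)).
For fixed lam, the factor lam^k is at most lam·(k^k)^lam. -/

namespace WeightedECS

open scoped Classical

/-! ## Unit flows in finite directed multigraphs -/

section Flow

variable {A V : Type} (T H : A → V)

/-- The arcs of `D` that leave `X`. -/
noncomputable def outArcs (D : Finset A) (X : Set V) : Finset A :=
  D.filter fun a => T a ∈ X ∧ H a ∉ X

/-- Indicator with integer values. -/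
noncomputable def ind (X : Set V) (v : V) : ℤ := if v ∈ X then 1 else 0

/-- The net amount of flow that leaves `X`, if each arc of `φ` carries one unit. -/
noncomputable def netFlow (φ : Finset A) (X : Set V) : ℤ :=
  ∑ a ∈ φ, (ind X (T a) - ind X (H a))

/-- The set `φ` is a flow of value `x` from `s` to `t`. -/
def IsFlow (φ : Finset A) (s t : V) (x : ℕ) : Prop :=
  ∀ X : Set V, s ∈ X → t ∉ X → netFlow T H φ X = x

/-- The arc `a` can be traversed from `x` to `y` in the residual graph. -/
def Residual (D φ : Finset A) (a : A) (x y : V) : Prop :=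
  (a ∈ D ∧ a ∉ φ ∧ T a = x ∧ H a = y) ∨ (a ∈ φ ∧ H a = x ∧ T a = y)

/-- Switch the membership of `a` in `φ`. -/
noncomputable def flip (φ : Finset A) (a : A) : Finset A :=
  if a ∈ φ then φ.erase a else insert a φ

variable {T H}

theorem mem_flip {φ : Finset A} {a b : A} :
    b ∈ flip φ a ↔ (b = a ∧ a ∉ φ) ∨ (b ≠ a ∧ b ∈ φ) := by
  unfold flip
  split_ifs with h
  · simp [h]
  · simp only [Finset.mem_insert]
    by_cases hb : b = a <;> simp [hb, h]

/-- Using an arc forwards adds its contribution, cancelling it subtracts the contribution with the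
ends swapped; either way one more unit goes from x to y. Describing flows by their net value on all
sets makes conservation at single vertices unnecessary. -/
theorem netFlow_flip {D φ : Finset A} {a : A} {x y : V} (h : Residual T H D φ a x y) (X : Set V) :
    netFlow T H (flip φ a) X = netFlow T H φ X + ind X x - ind X y := by
  rcases h with ⟨-, h, rfl, rfl⟩ | ⟨h, rfl, rfl⟩
  · rw [flip, if_neg h, netFlow, Finset.sum_insert h, netFlow]; ring
  · rw [flip, if_pos h, netFlow, netFlow, ← Finset.sum_erase_add _ _ h]; ring

theorem flip_subset {D φ : Finset A} {a : A} {x y : V} (h : Residual T H D φ a x y)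
    (hφ : φ ⊆ D) : flip φ a ⊆ D := by
  intro b hb
  rw [mem_flip] at hb
  rcases hb with ⟨rfl, hb⟩ | ⟨-, hb⟩
  · rcases h with h | h
    · exact h.1
    · exact hφ h.1
  · exact hφ hb

theorem netFlow_le_card_outArcs (φ : Finset A) (X : Set V) :
    netFlow T H φ X ≤ (outArcs T H φ X).card := by
  rw [outArcs, Finset.card_filter, netFlow]
  push_cast
  refine Finset.sum_le_sum fun a _ => ?_
  unfold ind
  by_cases h1 : T a ∈ X <;> by_cases h2 : H a ∈ X <;> simp [h1, h2]

theorem outArcs_mono {D D' : Finset A} (h : D ⊆ D') (X : Set V) :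
    outArcs T H D X ⊆ outArcs T H D' X := Finset.filter_subset_filter _ h

/-- A flow is bounded by every cut. -/
theorem IsFlow.le_cut {D φ : Finset A} {s t : V} {x : ℕ} (h : IsFlow T H φ s t x) (hφ : φ ⊆ D)
    {X : Set V} (hs : s ∈ X) (ht : t ∉ X) : x ≤ (outArcs T H D X).card := by
  have h1 := netFlow_le_card_outArcs (T := T) (H := H) φ X
  rw [h X hs ht] at h1
  exact (Nat.cast_le.1 h1).trans (Finset.card_le_card (outArcs_mono hφ X))

/-- If no residual arc leaves `X`, then the flow saturates the cut. -/
theorem netFlow_eq_cut {D φ : Finset A} (hφ : φ ⊆ D) {X : Set V}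
    (hX : ∀ a x y, Residual T H D φ a x y → x ∈ X → y ∈ X) :
    netFlow T H φ X = (outArcs T H D X).card := by
  have hout : outArcs T H D X = outArcs T H φ X := by
    refine Finset.Subset.antisymm (fun a ha => ?_) (outArcs_mono hφ X)
    simp only [outArcs, Finset.mem_filter] at ha ⊢
    refine ⟨?_, ha.2⟩
    by_contra h
    exact ha.2.2 (hX a _ _ (Or.inl ⟨ha.1, h, rfl, rfl⟩) ha.2.1)
  rw [hout, outArcs, Finset.card_filter, netFlow]
  push_cast
  refine Finset.sum_congr rfl fun a ha => ?_
  have := hX a _ _ (Or.inr ⟨ha, rfl, rfl⟩)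
  unfold ind
  by_cases h1 : T a ∈ X <;> by_cases h2 : H a ∈ X <;> simp_all

/-! ### Augmenting paths and max-flow min-cut -/

/-- A path with `len` steps along a labelled relation, without repeated vertices. -/
structure IsPath (step : A → V → V → Prop) (s t : V) (len : ℕ) (p : ℕ → V) (arc : ℕ → A) :
    Prop where
  start : p 0 = s
  finish : p len = t
  step : ∀ i < len, step (arc i) (p i) (p (i + 1))
  inj : ∀ i j, i ≤ len → j ≤ len → p i = p j → i = j

/-- The closed set consists of the vertices reachable by simple paths. A step to a vertex that is
already on the path is replaced by truncating the path there, which keeps the vertices distinct. -/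
theorem exists_path_or_closed [Nonempty A] (step : A → V → V → Prop) (s t : V) :
    (∃ len p arc, IsPath step s t len p arc) ∨
      ∃ X : Set V, s ∈ X ∧ t ∉ X ∧ ∀ a x y, step a x y → x ∈ X → y ∈ X := by
  obtain ⟨a₀⟩ := ‹Nonempty A›
  by_cases h : ∃ len p arc, IsPath step s t len p arc
  · exact Or.inl h
  refine Or.inr ⟨{v | ∃ len p arc, IsPath step s v len p arc},
    ⟨0, fun _ => s, fun _ => a₀, rfl, rfl, by simp, by intros; omega⟩, h, ?_⟩
  rintro a x y hxy ⟨len, p, arc, hp⟩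
  by_cases hy : ∃ i ≤ len, p i = y
  · obtain ⟨i, hi, rfl⟩ := hy
    exact ⟨i, p, arc, hp.start, rfl, fun j hj => hp.step j (hj.trans_le hi),
      fun j j' hj hj' => hp.inj j j' (hj.trans hi) (hj'.trans hi)⟩
  · push Not at hy
    refine ⟨len + 1, Function.update p (len + 1) y, Function.update arc len a, ?_, ?_, ?_, ?_⟩
    · rw [Function.update_of_ne (by omega)]; exact hp.start
    · simp
    · intro i hi
      rcases Nat.lt_succ_iff_lt_or_eq.1 hi with hi | rfl
      · rw [Function.update_of_ne (by omega), Function.update_of_ne (by omega),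
          Function.update_of_ne (by omega)]
        exact hp.step i hi
      · rw [Function.update_self, Function.update_of_ne (by omega), Function.update_self,
          hp.finish]
        exact hxy
    · intro i j hi hj hij
      rcases Nat.lt_or_ge i (len + 1) with hi' | hi' <;>
        rcases Nat.lt_or_ge j (len + 1) with hj' | hj'
      · rw [Function.update_of_ne (by omega), Function.update_of_ne (by omega)] at hij
        exact hp.inj i j (by omega) (by omega) hij
      · obtain rfl : j = len + 1 := by omega
        rw [Function.update_of_ne (by omega), Function.update_self] at hij
        exact absurd hij (hy i (by omega))
      · obtain rfl : i = len + 1 := by omega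
        rw [Function.update_self, Function.update_of_ne (by omega)] at hij
        exact absurd hij.symm (hy j (by omega))
      · omega

/-- Switching all arcs of a path in the residual graph. -/
theorem exists_flip_path {D φ : Finset A} (hφ : φ ⊆ D) {s t : V} {len : ℕ} {p : ℕ → V}
    {arc : ℕ → A} (hp : IsPath (Residual T H D φ) s t len p arc) :
    ∃ φ' ⊆ D, (∀ X, netFlow T H φ' X = netFlow T H φ X + ind X s - ind X t) ∧
      (∀ a, (∀ j < len, arc j ≠ a) → (a ∈ φ' ↔ a ∈ φ)) ∧
      ∀ j < len, (arc j ∈ φ' ↔ arc j ∉ φ) := by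
  -- Membership in φ fixes the direction in which an arc is residual, so an arc has only one
  -- possible start, and the path repeats no vertex. Hence no arc is switched twice.
  have arc_inj : ∀ i j, i < len → j < len → arc i = arc j → i = j := by
    intro i j hi hj hij
    have h1 := hp.step i hi
    have h2 := hp.step j hj
    rw [hij] at h1
    refine hp.inj i j hi.le hj.le ?_
    rcases h1 with h1 | h1 <;> rcases h2 with h2 | h2
    · exact h1.2.2.1.symm.trans h2.2.2.1
    · exact absurd h2.1 h1.2.1
    · exact absurd h1.1 h2.2.1
    · exact h1.2.1.symm.trans h2.2.1
  have key : ∀ i ≤ len, ∃ φ' ⊆ D,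
      (∀ X, netFlow T H φ' X = netFlow T H φ X + ind X (p 0) - ind X (p i)) ∧
      (∀ a, (∀ j < i, arc j ≠ a) → (a ∈ φ' ↔ a ∈ φ)) ∧
      ∀ j < i, (arc j ∈ φ' ↔ arc j ∉ φ) := by
    intro i
    induction i with
    | zero => exact fun _ => ⟨φ, hφ, by simp, by simp, by simp⟩
    | succ i ih =>
      intro hi
      obtain ⟨φ', h1, h2, h3, h4⟩ := ih (by omega)
      have hmem : arc i ∈ φ' ↔ arc i ∈ φ :=
        h3 _ fun j hj h => by have := arc_inj j i (by omega) (by omega) h; omega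
      have hres : Residual T H D φ' (arc i) (p i) (p (i + 1)) := by
        have := hp.step i (by omega)
        unfold Residual at this ⊢
        rwa [hmem]
      refine ⟨flip φ' (arc i), flip_subset hres h1, fun X => ?_, fun a ha => ?_, fun j hj => ?_⟩
      · rw [netFlow_flip hres, h2]; ring
      · rw [mem_flip, ← h3 a fun j hj => ha j (by omega)]
        have := (ha i (by omega)).symm
        simp [this]
      · rw [mem_flip]
        rcases Nat.lt_succ_iff_lt_or_eq.1 hj with hj | rfl
        · have : arc j ≠ arc i := fun h => by
            have := arc_inj j i (by omega) (by omega) h; omega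
          simp [this, h4 j hj]
        · simp [hmem]
  have := key len le_rfl
  rwa [hp.start, hp.finish] at this

/-- Max-flow min-cut: a flow of value `lam` exists if all cuts have at least `lam` arcs. -/
theorem exists_flow [Nonempty A] {D : Finset A} {s t : V} {lam : ℕ}
    (hcut : ∀ X : Set V, s ∈ X → t ∉ X → lam ≤ (outArcs T H D X).card) :
    ∃ φ ⊆ D, IsFlow T H φ s t lam := by
  suffices h : ∀ x ≤ lam, ∃ φ ⊆ D, IsFlow T H φ s t x from h lam le_rfl
  intro x
  induction x with
  | zero => exact fun _ => ⟨∅, by simp, fun X _ _ => by simp [netFlow]⟩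
  | succ x ih =>
    intro hx
    obtain ⟨φ, hφ, hf⟩ := ih (by omega)
    rcases exists_path_or_closed (Residual T H D φ) s t with ⟨len, p, arc, hp⟩ | ⟨X, hs, ht, hX⟩
    · obtain ⟨φ', h1, h2, -, -⟩ := exists_flip_path hφ hp
      refine ⟨φ', h1, fun X hs ht => ?_⟩
      rw [h2, hf X hs ht]
      simp [ind, hs, ht]
    · have h1 := netFlow_eq_cut hφ hX
      rw [hf X hs ht] at h1
      have := hcut X hs ht
      omega

/-! ### Arc-disjoint paths and Menger's theorem -/

/-- `a` is an arc from `x` to `y` in `D`. -/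
def IsArc (T H : A → V) (D : Finset A) (a : A) (x y : V) : Prop := a ∈ D ∧ T a = x ∧ H a = y

/-- The arcs of a path. -/
noncomputable def pathArcs (len : ℕ) (arc : ℕ → A) : Finset A := (Finset.range len).image arc

theorem mem_pathArcs {len : ℕ} {arc : ℕ → A} {a : A} :
    a ∈ pathArcs len arc ↔ ∃ i < len, arc i = a := by
  simp [pathArcs]

theorem IsPath.reverse {step : A → V → V → Prop} {s t : V} {len : ℕ} {p : ℕ → V} {arc : ℕ → A}
    (hp : IsPath step s t len p arc) :
    IsPath (fun a x y => step a y x) t s len (fun i => p (len - i))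
      (fun i => arc (len - 1 - i)) where
  start := hp.finish
  finish := by simpa using hp.start
  step i hi := by
    have := hp.step (len - 1 - i) (by omega)
    rw [show len - 1 - i + 1 = len - i by omega] at this
    rwa [show len - (i + 1) = len - 1 - i by omega]
  inj i j hi hj h := by have := hp.inj _ _ (by omega) (by omega) h; omega

/-- A flow of value `lam` contains `lam` arc-disjoint paths. -/
theorem IsFlow.exists_paths [Nonempty A] {s t : V} {lam : ℕ} {φ : Finset A} (hf : IsFlow T H φ s t
    lam) :
    ∃ (len : ℕ → ℕ) (p : ℕ → ℕ → V) (arc : ℕ → ℕ → A),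
      (∀ q < lam, IsPath (IsArc T H φ) s t (len q) (p q) (arc q)) ∧
      ∀ q < lam, ∀ q' < lam, q ≠ q' →
        Disjoint (pathArcs (len q) (arc q)) (pathArcs (len q') (arc q')) := by
  induction lam generalizing φ with
  | zero => exact ⟨fun _ => 0, fun _ _ => s, fun _ _ => Classical.arbitrary A, by simp, by simp⟩
  | succ lam ih =>
    rcases exists_path_or_closed (IsArc T H φ) s t with ⟨l, p₁, arc₁, hp⟩ | ⟨X, hs, ht, hX⟩
    swap
    -- No arc of φ leaves a closed set, so the net flow out of it is at most 0, although the flow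
    -- has positive value.
    · have h1 := hf X hs ht
      have h2 := netFlow_le_card_outArcs (T := T) (H := H) φ X
      have h3 : outArcs T H φ X = ∅ := by
        refine Finset.filter_eq_empty_iff.2 fun a ha h => h.2 (hX a _ _ ⟨ha, rfl, rfl⟩ h.1)
      rw [h1, h3] at h2
      simp at h2
      omega
    -- With φ itself as the ambient arc set, the reversed path is residual; switching it removes the
    -- arcs of the path from φ and lowers the value by one.
    have hrev : IsPath (Residual T H φ φ) t s l (fun i => p₁ (l - i))
        (fun i => arc₁ (l - 1 - i)) := by
      have := hp.reverse
      refine ⟨this.start, this.finish, fun i hi => ?_, this.inj⟩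
      have := this.step i hi
      exact Or.inr ⟨this.1, this.2.2, this.2.1⟩
    obtain ⟨φ', h1, h2, -, h4⟩ := exists_flip_path subset_rfl hrev
    have hf' : IsFlow T H φ' s t lam := fun X hs ht => by
      rw [h2, hf X hs ht]
      simp [ind, hs, ht]
    have hdisj : Disjoint (pathArcs l arc₁) φ' := by
      rw [Finset.disjoint_left]
      intro a ha
      obtain ⟨j, hj, rfl⟩ := mem_pathArcs.1 ha
      have := h4 (l - 1 - j) (by omega)
      simp only [show l - 1 - (l - 1 - j) = j by omega] at this
      rw [this, not_not]
      exact (hp.step j hj).1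
    obtain ⟨len, p, arc, hP, hd⟩ := ih hf'
    have hsub : ∀ q < lam, pathArcs (len q) (arc q) ⊆ φ' := fun q hq a ha => by
      obtain ⟨j, hj, rfl⟩ := mem_pathArcs.1 ha
      exact ((hP q hq).step j hj).1
    refine ⟨Function.update len lam l, Function.update p lam p₁, Function.update arc lam arc₁,
      fun q hq => ?_, fun q hq q' hq' hne => ?_⟩
    · rcases Nat.lt_succ_iff_lt_or_eq.1 hq with hq | rfl
      · simp only [Function.update_of_ne hq.ne]
        have := hP q hq
        exact ⟨this.start, this.finish, fun i hi => ⟨h1 (this.step i hi).1, (this.step i hi).2⟩,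
          this.inj⟩
      · simpa using hp
    · rcases Nat.lt_succ_iff_lt_or_eq.1 hq with hq | rfl <;>
        rcases Nat.lt_succ_iff_lt_or_eq.1 hq' with hq' | rfl
      · simpa only [Function.update_of_ne hq.ne, Function.update_of_ne hq'.ne] using
          hd q hq q' hq' hne
      · simp only [Function.update_of_ne hq.ne, Function.update_self]
        exact (hdisj.mono_right (hsub q hq)).symm
      · simp only [Function.update_of_ne hq'.ne, Function.update_self]
        exact hdisj.mono_right (hsub q' hq')
      · exact absurd rfl hne

/-- A sequence that starts in `X` and ends outside leaves `X` at some point. -/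
theorem exists_leave {X : Set V} {p : ℕ → V} {i j : ℕ} (hij : i ≤ j) (hi : p i ∈ X)
    (hj : p j ∉ X) : ∃ m, i ≤ m ∧ m < j ∧ p m ∈ X ∧ p (m + 1) ∉ X := by
  induction j, hij using Nat.le_induction with
  | base => exact absurd hi hj
  | succ j hij ih =>
    by_cases h : p j ∈ X
    · exact ⟨j, hij, by omega, h, hj⟩
    · obtain ⟨m, h1, h2, h3⟩ := ih h
      exact ⟨m, h1, by omega, h3⟩

theorem IsPath.arc_inj {D : Finset A} {s t : V} {len : ℕ} {p : ℕ → V} {arc : ℕ → A}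
    (hp : IsPath (IsArc T H D) s t len p arc) {i j : ℕ} (hi : i < len) (hj : j < len)
    (h : arc i = arc j) : i = j := by
  refine hp.inj i j hi.le hj.le ?_
  rw [← (hp.step i hi).2.1, ← (hp.step j hj).2.1, h]

/-- Menger's theorem, with the numbers of arcs of the paths in cuts spelled out: there are `lam`
paths such that every cut `Z` contains, for each of the paths, `lam - 1` arcs outside the path, and
every cut with exactly `lam` arcs is covered by the paths. -/
theorem menger [Nonempty A] {D : Finset A} {s t : V} {lam : ℕ}
    (hcut : ∀ X : Set V, s ∈ X → t ∉ X → lam ≤ (outArcs T H D X).card) :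
    ∃ (len : ℕ → ℕ) (p : ℕ → ℕ → V) (arc : ℕ → ℕ → A),
      (∀ q < lam, IsPath (IsArc T H D) s t (len q) (p q) (arc q)) ∧
      (∀ q < lam, ∀ Z : Set V, s ∈ Z → t ∉ Z →
        (outArcs T H (pathArcs (len q) (arc q)) Z).card + lam ≤ (outArcs T H D Z).card + 1) ∧
      ∀ X : Set V, s ∈ X → t ∉ X → (outArcs T H D X).card = lam → ∀ a ∈ outArcs T H D X,
        ∃ q < lam, a ∈ pathArcs (len q) (arc q) := by
  obtain ⟨φ, hφ, hf⟩ := exists_flow hcut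
  obtain ⟨len, p, arc, hP, hd⟩ := hf.exists_paths
  have hP' : ∀ q < lam, IsPath (IsArc T H D) s t (len q) (p q) (arc q) := fun q hq =>
    ⟨(hP q hq).start, (hP q hq).finish, fun i hi =>
      ⟨hφ ((hP q hq).step i hi).1, ((hP q hq).step i hi).2⟩, (hP q hq).inj⟩
  have hone : ∀ q < lam, ∀ Z : Set V, s ∈ Z → t ∉ Z →
      1 ≤ (outArcs T H (pathArcs (len q) (arc q)) Z).card := by
    intro q hq Z hs ht
    obtain ⟨m, -, hm, h1, h2⟩ := exists_leave (X := Z) (p := p q) (Nat.zero_le (len q))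
      (by rwa [(hP q hq).start]) (by rwa [(hP q hq).finish])
    refine Finset.card_pos.2 ⟨arc q m, Finset.mem_filter.2
      ⟨mem_pathArcs.2 ⟨m, hm, rfl⟩, ?_⟩⟩
    rwa [((hP q hq).step m hm).2.1, ((hP q hq).step m hm).2.2, and_iff_right h1]
  have hunion : ∀ Z : Set V, ((Finset.range lam).biUnion fun q =>
      outArcs T H (pathArcs (len q) (arc q)) Z) ⊆ outArcs T H D Z := by
    intro Z a ha
    obtain ⟨q, hq, ha⟩ := Finset.mem_biUnion.1 ha
    refine outArcs_mono (fun b hb => ?_) Z ha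
    obtain ⟨j, hj, rfl⟩ := mem_pathArcs.1 hb
    exact ((hP' q (Finset.mem_range.1 hq)).step j hj).1
  have hcard : ∀ Z : Set V, ((Finset.range lam).biUnion fun q =>
      outArcs T H (pathArcs (len q) (arc q)) Z).card =
      ∑ q ∈ Finset.range lam, (outArcs T H (pathArcs (len q) (arc q)) Z).card := by
    intro Z
    refine Finset.card_biUnion fun q hq q' hq' hne => ?_
    exact Finset.disjoint_filter_filter
      (hd q (Finset.mem_range.1 hq) q' (Finset.mem_range.1 hq') hne)
  refine ⟨len, p, arc, hP', fun q hq Z hs ht => ?_, fun X hs ht hX a ha => ?_⟩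
  -- The other lam - 1 paths are disjoint from path q, and each contributes at least one arc to the
  -- cut.
  · have h1 := Finset.card_le_card (hunion Z)
    rw [hcard Z, ← Finset.add_sum_erase _ _ (Finset.mem_range.2 hq)] at h1
    have h2 : ((Finset.range lam).erase q).card • 1 ≤ ∑ q' ∈ (Finset.range lam).erase q,
        (outArcs T H (pathArcs (len q') (arc q')) Z).card :=
      Finset.card_nsmul_le_sum _ _ _ fun q' hq' =>
        hone q' (Finset.mem_range.1 (Finset.mem_of_mem_erase hq')) Z hs ht
    rw [Finset.card_erase_of_mem (Finset.mem_range.2 hq), Finset.card_range, smul_eq_mul] at h2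
    omega
  -- In a cut with exactly lam arcs, the disjoint contributions of the lam paths leave no arc over.
  · have h1 : (Finset.range lam).card • 1 ≤ ∑ q ∈ Finset.range lam,
        (outArcs T H (pathArcs (len q) (arc q)) X).card :=
      Finset.card_nsmul_le_sum _ _ _ fun q' hq' => hone q' (Finset.mem_range.1 hq') X hs ht
    rw [Finset.card_range, smul_eq_mul, mul_one, ← hcard X] at h1
    have h2 := Finset.eq_of_subset_of_card_le (hunion X) (by omega)
    rw [← h2] at ha
    obtain ⟨q, hq, ha⟩ := Finset.mem_biUnion.1 ha
    exact ⟨q, Finset.mem_range.1 hq, (Finset.mem_filter.1 ha).1⟩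

/-- A path that leaves `X` only once lies in `X` up to that point and outside afterwards. -/
theorem IsPath.mem_iff {D : Finset A} {s t : V} {len : ℕ} {p : ℕ → V} {arc : ℕ → A}
    (hp : IsPath (IsArc T H D) s t len p arc) {X : Set V} (hs : s ∈ X) (ht : t ∉ X)
    (hX : (outArcs T H (pathArcs len arc) X).card ≤ 1) {i : ℕ} (hi : i < len) (h1 : p i ∈ X)
    (h2 : p (i + 1) ∉ X) {j : ℕ} (hj : j ≤ len) : p j ∈ X ↔ j ≤ i := by
  have huniq : ∀ m < len, p m ∈ X → p (m + 1) ∉ X → m = i := by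
    intro m hm h3 h4
    refine hp.arc_inj hm hi (Finset.card_le_one.1 hX _ ?_ _ ?_)
    · exact Finset.mem_filter.2 ⟨mem_pathArcs.2 ⟨m, hm, rfl⟩,
        by rwa [(hp.step m hm).2.1, (hp.step m hm).2.2, and_iff_right h3]⟩
    · exact Finset.mem_filter.2 ⟨mem_pathArcs.2 ⟨i, hi, rfl⟩,
        by rwa [(hp.step i hi).2.1, (hp.step i hi).2.2, and_iff_right h1]⟩
  constructor
  · intro h
    by_contra hij
    obtain ⟨m, hm, hm', h3, h4⟩ := exists_leave hj h (by rwa [hp.finish])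
    have := huniq m hm' h3 h4
    omega
  · intro hij
    by_contra h
    obtain ⟨m, -, hm', h3, h4⟩ := exists_leave (Nat.zero_le j) (by rwa [hp.start]) h
    have := huniq m (by omega) h3 h4
    omega

end Flow

/-! ## Cuts, and exchanging edges of a deletion set -/

section Exchange

variable {ε V : Type} (J : ε → V → V → Prop)

/-- The edge `e` leaves the set `X`. -/
def Leaves (e : ε) (X : Set V) : Prop := ∃ a b, a ∈ X ∧ b ∉ X ∧ J e a b

/-- The edges of `E` that leave `X`. -/
noncomputable def cut (E : Finset ε) (X : Set V) : Finset ε := E.filter (Leaves J · X)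

/-- Every cut has at least `lam` edges. -/
def CutConnected (lam : ℕ) (E : Finset ε) : Prop :=
  ∀ X : Set V, X.Nonempty → X ≠ Set.univ → lam ≤ (cut J E X).card

/-- `J` describes how the edges of a graph or digraph without parallel edges are traversed: an edge
is determined by its end vertices, and it can be traversed in one or in both directions. -/
structure IsEdgeSystem : Prop where
  ext : ∀ e e' a b, J e a b → J e' a b → e = e'
  ends : ∀ e, ∃ a b, J e a b ∧ ∀ c d, J e c d → (c = a ∧ d = b) ∨ (c = b ∧ d = a)
  oriented : (∀ e a b c d, J e a b → J e c d → c = a ∧ d = b) ∨ ∀ e a b, J e a b → J e b a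

variable {J}

theorem Leaves.ne {e : ε} {X : Set V} (h : Leaves J e X) : X.Nonempty ∧ X ≠ Set.univ := by
  obtain ⟨a, b, ha, hb, -⟩ := h
  exact ⟨⟨a, ha⟩, fun h => hb (h ▸ Set.mem_univ b)⟩

theorem card_cut_sdiff [DecidableEq ε] {E S : Finset ε} (h : S ⊆ E) (X : Set V) :
    (cut J (E \ S) X).card + (cut J S X).card = (cut J E X).card := by
  rw [cut, cut, cut, ← Finset.card_union_of_disjoint
    (Finset.disjoint_filter_filter Finset.sdiff_disjoint), ← Finset.filter_union,
    Finset.sdiff_union_of_subset h]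

theorem card_cut_singleton (e : ε) (X : Set V) :
    (cut J {e} X).card = if Leaves J e X then 1 else 0 := by
  rw [cut, Finset.filter_singleton]
  split_ifs <;> rfl

theorem card_cut_mono {E E' : Finset ε} (h : E ⊆ E') (X : Set V) :
    (cut J E X).card ≤ (cut J E' X).card :=
  Finset.card_le_card (Finset.filter_subset_filter _ h)

theorem CutConnected.mono {lam : ℕ} {E E' : Finset ε} (h : CutConnected J lam E) (hE : E ⊆ E') :
    CutConnected J lam E' := fun X h1 h2 => (h X h1 h2).trans (card_cut_mono hE X)

/-- Leaving a set depends only on the membership of two end vertices, in one or in both orders.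
Inequalities between cuts thereby become finite case checks for a single edge. -/
theorem IsEdgeSystem.exists_leaves_iff (hJ : IsEdgeSystem J) (e : ε) : ∃ a b,
    (∀ X : Set V, Leaves J e X ↔ a ∈ X ∧ b ∉ X) ∨
      ∀ X : Set V, Leaves J e X ↔ (a ∈ X ∧ b ∉ X) ∨ (b ∈ X ∧ a ∉ X) := by
  obtain ⟨a, b, hab, h⟩ := hJ.ends e
  refine ⟨a, b, hJ.oriented.imp (fun hd X => ⟨?_, fun hX => ⟨a, b, hX.1, hX.2, hab⟩⟩)
    fun hs X => ⟨?_, ?_⟩⟩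
  · rintro ⟨c, d, hc, hd', hcd⟩
    obtain ⟨rfl, rfl⟩ := hd e a b c d hab hcd
    exact ⟨hc, hd'⟩
  · rintro ⟨c, d, hc, hd', hcd⟩
    rcases h c d hcd with ⟨rfl, rfl⟩ | ⟨rfl, rfl⟩
    · exact Or.inl ⟨hc, hd'⟩
    · exact Or.inr ⟨hc, hd'⟩
  · rintro (hX | hX)
    · exact ⟨a, b, hX.1, hX.2, hab⟩
    · exact ⟨b, a, hX.1, hX.2, hs e a b hab⟩

/-- Submodularity of the cut function, which holds for each edge separately. -/
theorem card_cut_inter_add_union (hJ : IsEdgeSystem J) (E : Finset ε) (X Y : Set V) :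
    (cut J E (X ∩ Y)).card + (cut J E (X ∪ Y)).card ≤ (cut J E X).card + (cut J E Y).card := by
  simp only [cut, Finset.card_filter, ← Finset.sum_add_distrib]
  refine Finset.sum_le_sum fun e _ => ?_
  obtain ⟨a, b, h | h⟩ := hJ.exists_leaves_iff e <;> simp only [h] <;>
    by_cases h1 : a ∈ X <;> by_cases h2 : a ∈ Y <;> by_cases h3 : b ∈ X <;>
      by_cases h4 : b ∈ Y <;> simp [h1, h2, h3, h4]

theorem leaves_compl (hs : ∀ e a b, J e a b → J e b a) (e : ε) (X : Set V) :
    Leaves J e Xᶜ ↔ Leaves J e X := by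
  constructor
  · rintro ⟨a, b, ha, hb, h⟩
    exact ⟨b, a, not_not.1 hb, ha, hs _ _ _ h⟩
  · rintro ⟨a, b, ha, hb, h⟩
    exact ⟨b, a, hb, fun h => h ha, hs _ _ _ h⟩

theorem cut_compl (hs : ∀ e a b, J e a b → J e b a) (E : Finset ε) (X : Set V) :
    cut J E Xᶜ = cut J E X := Finset.filter_congr fun e _ => leaves_compl hs e X

/-- Posimodularity: since a set and its complement have the same cut in a graph, this is
submodularity for X and the complement of Y. -/
theorem card_cut_diff_add_diff (hJ : IsEdgeSystem J) (hs : ∀ e a b, J e a b → J e b a)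
    (E : Finset ε) (X Y : Set V) :
    (cut J E (X \ Y)).card + (cut J E (Y \ X)).card ≤ (cut J E X).card + (cut J E Y).card := by
  have h := card_cut_inter_add_union hJ E X Yᶜ
  rw [cut_compl hs E Y, ← cut_compl hs E (X ∪ Yᶜ), Set.compl_union, compl_compl,
    ← Set.sdiff_eq, Set.inter_comm Xᶜ, ← Set.sdiff_eq] at h
  exact h

/-- The pairs of vertices between which an edge of `E` can be traversed. -/
noncomputable def arcsOf [Fintype V] (J : ε → V → V → Prop) (E : Finset ε) : Finset (V × V) :=
  Finset.univ.filter fun x => ∃ e ∈ E, J e x.1 x.2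

/-- An undirected edge gives two opposite arcs, but at most one of them leaves a given set;
conversely, an arc comes from only one edge because there are no parallel edges. -/
theorem card_outArcs_arcsOf [Fintype V] (hJ : IsEdgeSystem J) (E : Finset ε) (X : Set V) :
    (outArcs Prod.fst Prod.snd (arcsOf J E) X).card = (cut J E X).card := by
  have hex : ∀ x ∈ outArcs Prod.fst Prod.snd (arcsOf J E) X, ∃ e ∈ E, J e x.1 x.2 := fun x hx =>
    (Finset.mem_filter.1 (Finset.mem_filter.1 hx).1).2
  refine Finset.card_bij (fun x hx => (hex x hx).choose) ?_ ?_ ?_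
  · intro x hx
    have h := (hex x hx).choose_spec
    have hx' := (Finset.mem_filter.1 hx).2
    exact Finset.mem_filter.2 ⟨h.1, x.1, x.2, hx'.1, hx'.2, h.2⟩
  · intro x hx y hy hxy
    have h1 := (hex x hx).choose_spec.2
    have h2 := (hex y hy).choose_spec.2
    have hx' := (Finset.mem_filter.1 hx).2
    have hy' := (Finset.mem_filter.1 hy).2
    change (hex x hx).choose = (hex y hy).choose at hxy
    rw [← hxy] at h2
    obtain ⟨a, b, -, h⟩ := hJ.ends (hex x hx).choose
    rcases h _ _ h1 with h3 | h3 <;> rcases h _ _ h2 with h4 | h4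
    · exact Prod.ext (h3.1.trans h4.1.symm) (h3.2.trans h4.2.symm)
    · exact absurd (h4.2.trans h3.1.symm ▸ hx'.1) hy'.2
    · exact absurd (h4.2.trans h3.1.symm ▸ hx'.1) hy'.2
    · exact Prod.ext (h3.1.trans h4.1.symm) (h3.2.trans h4.2.symm)
  · intro e he
    obtain ⟨he, a, b, ha, hb, hab⟩ := Finset.mem_filter.1 he
    have hx : (a, b) ∈ outArcs Prod.fst Prod.snd (arcsOf J E) X :=
      Finset.mem_filter.2 ⟨Finset.mem_filter.2 ⟨Finset.mem_univ _, e, he, hab⟩, ha, hb⟩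
    exact ⟨(a, b), hx, hJ.ext _ _ a b (hex _ hx).choose_spec.2 hab⟩

/-! ### Exchanging edges along a common path -/

/-- Many edges in cuts of minimum size between `u` and `v` yield many such edges on one path. -/
theorem exists_common_path [Fintype V] (hJ : IsEdgeSystem J) {E L : Finset ε} {u v : V}
    {lam b : ℕ} (hcut : ∀ X : Set V, u ∈ X → v ∉ X → lam ≤ (cut J E X).card) (X : ε → Set V)
    (hX : ∀ f ∈ L, u ∈ X f ∧ v ∉ X f ∧ (cut J E (X f)).card = lam)
    (hf : ∀ f ∈ L, f ∈ E ∧ Leaves J f (X f)) (hL : lam * b < L.card) :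
    ∃ L' ⊆ L, b < L'.card ∧ ∃ (len : ℕ) (p : ℕ → V) (idx : ε → ℕ),
      (∀ f ∈ L', idx f < len ∧ J f (p (idx f)) (p (idx f + 1))) ∧
      (∀ f ∈ L', ∀ j ≤ len, p j ∈ X f ↔ j ≤ idx f) ∧ Set.InjOn idx L' ∧
      ∀ Z : Set V, u ∈ Z → v ∉ Z → ∀ S ⊆ L',
        (∀ f ∈ S, p (idx f) ∈ Z ∧ p (idx f + 1) ∉ Z) → S.card + lam ≤ (cut J E Z).card + 1 := by
  have : Nonempty (V × V) := ⟨(u, v)⟩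
  obtain ⟨len, p, arc, hP, hI, hcov⟩ := menger (T := Prod.fst) (H := Prod.snd) (D := arcsOf J E)
    (s := u) (t := v) (lam := lam) fun X h1 h2 => by
      rw [card_outArcs_arcsOf hJ]; exact hcut X h1 h2
  simp only [card_outArcs_arcsOf hJ] at hI hcov
  have hex : ∀ f ∈ L, ∃ q < lam, ∃ i < len q, J f (p q i) (p q (i + 1)) ∧ p q i ∈ X f ∧
      p q (i + 1) ∉ X f := by
    intro f hfL
    obtain ⟨hfE, a, b, ha, hb, hab⟩ := hf f hfL
    obtain ⟨hu, hv, hc⟩ := hX f hfL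
    obtain ⟨q, hq, hmem⟩ := hcov (X f) hu hv hc (a, b)
      (Finset.mem_filter.2 ⟨Finset.mem_filter.2 ⟨Finset.mem_univ _, f, hfE, hab⟩, ha, hb⟩)
    obtain ⟨i, hi, hia⟩ := mem_pathArcs.1 hmem
    have h1 := (hP q hq).step i hi
    rw [hia] at h1
    have h2 : a = p q i := h1.2.1
    have h3 : b = p q (i + 1) := h1.2.2
    exact ⟨q, hq, i, hi, h2 ▸ h3 ▸ hab, h2 ▸ ha, h3 ▸ hb⟩
  choose! Q hQ i hi hJi hXi hXi' using hex
  -- Pigeonhole: more than lam * b edges on lam paths leave more than b on one of them.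
  obtain ⟨q, hq, hcard⟩ := Finset.exists_lt_card_fiber_of_mul_lt_card_of_maps_to
    (f := Q) (t := Finset.range lam) (fun f hf => Finset.mem_range.2 (hQ f hf))
    (n := b) (by rwa [Finset.card_range])
  rw [Finset.mem_range] at hq
  have hL' : ∀ f ∈ L.filter fun f => Q f = q, f ∈ L ∧ Q f = q := fun f h => Finset.mem_filter.1 h
  have hinj : Set.InjOn i (L.filter fun f => Q f = q : Finset ε) := by
    intro f hf f' hf' hff
    obtain ⟨h1, h2⟩ := hL' f hf
    obtain ⟨h3, h4⟩ := hL' f' hf'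
    have h5 := hJi f h1
    have h6 := hJi f' h3
    rw [h2, hff] at h5
    rw [h4] at h6
    exact hJ.ext _ _ _ _ h5 h6
  refine ⟨L.filter fun f => Q f = q, Finset.filter_subset _ _, hcard, len q, p q, i, ?_, ?_, hinj,
    ?_⟩
  · intro f hf
    obtain ⟨h1, h2⟩ := hL' f hf
    rw [← h2]
    exact ⟨hi f h1, hJi f h1⟩
  · intro f hf j hj
    obtain ⟨h1, rfl⟩ := hL' f hf
    obtain ⟨hu, hv, hc⟩ := hX f h1
    -- In a cut of exactly lam edges, the bound from Menger's theorem leaves room for only one arc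
    -- of the path.
    refine (hP _ hq).mem_iff hu hv ?_ (hi f h1) (hXi f h1) (hXi' f h1) hj
    have := hI _ hq (X f) hu hv
    omega
  · intro Z hu hv S hS hSZ
    refine le_trans (Nat.add_le_add_right ?_ _) (hI q hq Z hu hv)
    refine Finset.card_le_card_of_injOn (fun f => arc q (i f)) ?_ ?_
    · intro f hf
      have h1 := hL' f (hS hf)
      have h2 : i f < len q := h1.2 ▸ hi f h1.1
      have h3 := (hP q hq).step _ h2
      refine Finset.mem_filter.2 ⟨mem_pathArcs.2 ⟨i f, h2, rfl⟩, ?_⟩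
      rw [h3.2.1, h3.2.2]
      exact hSZ f hf
    · intro f hf f' hf' hff
      have h1 := hL' f (hS hf)
      have h2 := hL' f' (hS hf')
      refine hinj (hS hf) (hS hf') ((hP q hq).arc_inj ?_ ?_ hff)
      · exact h1.2 ▸ hi f h1.1
      · exact h2.2 ▸ hi f' h2.1

/-- The cut still has lam edges when f is gone, and f is one more. -/
theorem lt_card_cut_of_deletable [DecidableEq ε] {lam : ℕ} {E : Finset ε} {f : ε} (hf : f ∈ E)
    (h : CutConnected J lam (E \ {f})) {X : Set V} (hX : Leaves J f X) :
    lam + 1 ≤ (cut J E X).card := by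
  have h1 := h X hX.ne.1 hX.ne.2
  have h2 := card_cut_sdiff (J := J) (Finset.singleton_subset_iff.2 hf) X
  rw [card_cut_singleton, if_pos hX] at h2
  omega

/-- In a digraph, deletable edges on one path that lie in minimum cuts after the deletion of an
edge `e` can be deleted simultaneously. -/
theorem cutConnected_sdiff_path [DecidableEq ε] (hJ : IsEdgeSystem J)
    (hd : ∀ e a b c d, J e a b → J e c d → c = a ∧ d = b) {E D S : Finset ε} {e : ε} {u v : V}
    {lam : ℕ} (hE : CutConnected J lam E) (he : e ∈ E) (heuv : J e u v) (hD : D ⊆ E \ {e})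
    {X : ε → Set V} (hS : S ⊆ E) (hdel : ∀ f ∈ S, CutConnected J lam (E \ {f}))
    (hX : ∀ f ∈ S, u ∈ X f ∧ v ∉ X f ∧ (cut J E (X f)).card = lam + 1) {len : ℕ} {p : ℕ → V}
    {idx : ε → ℕ} (hp : ∀ f ∈ S, idx f < len ∧ J f (p (idx f)) (p (idx f + 1)))
    (hpX : ∀ f ∈ S, ∀ j ≤ len, p j ∈ X f ↔ j ≤ idx f)
    (hI : ∀ Z : Set V, u ∈ Z → v ∉ Z → ∀ S' ⊆ S,
        (∀ f ∈ S', p (idx f) ∈ Z ∧ p (idx f + 1) ∉ Z) → S'.card + lam ≤ (cut J D Z).card + 1) :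
    CutConnected J lam (E \ S) := by
  have hleave : ∀ f ∈ S, ∀ Y, Leaves J f Y → p (idx f) ∈ Y ∧ p (idx f + 1) ∉ Y := by
    rintro f hf Y ⟨a, b, ha, hb, hab⟩
    obtain ⟨rfl, rfl⟩ := hd _ _ _ _ _ (hp f hf).2 hab
    exact ⟨ha, hb⟩
  have hcutE : ∀ Z : Set V, u ∈ Z → v ∉ Z → (cut J D Z).card + 1 ≤ (cut J E Z).card := by
    intro Z hu hv
    have h1 := card_cut_sdiff (J := J) (Finset.singleton_subset_iff.2 he) Z
    rw [card_cut_singleton, if_pos ⟨u, v, hu, hv, heuv⟩] at h1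
    have h2 := card_cut_mono (J := J) hD Z
    omega
  -- Sets without v are uncrossed with X f, where f is the first edge of R on the path. All of R
  -- leaves Y ∪ X f, and so does e, hence this cut has at least |R| + lam edges in E. The deletable
  -- edge f leaves Y ∩ X f, which therefore has at least lam + 1. Submodularity and the size lam + 1
  -- of the cut X f give the bound for Y.
  have hv : ∀ Y : Set V, v ∉ Y → ∀ R ⊆ S, R.Nonempty → (∀ f ∈ R, Leaves J f Y) →
      R.card + lam ≤ (cut J E Y).card := by
    intro Y hvY R hRS hR hRY
    obtain ⟨f, hf, hmin⟩ := R.exists_min_image idx hR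
    have hfS := hRS hf
    have hfY := hleave f hfS Y (hRY f hf)
    have h1 : lam + 1 ≤ (cut J E (Y ∩ X f)).card := by
      refine lt_card_cut_of_deletable (hS hfS) (hdel f hfS)
        ⟨_, _, ⟨hfY.1, ?_⟩, fun h => hfY.2 h.1, (hp f hfS).2⟩
      exact (hpX f hfS _ (hp f hfS).1.le).2 le_rfl
    have h2 := hI (Y ∪ X f) (Or.inr (hX f hfS).1) (fun h => h.elim hvY (hX f hfS).2.1) R hRS
      fun g hg => ?_
    · have h3 := hcutE (Y ∪ X f) (Or.inr (hX f hfS).1) (fun h => h.elim hvY (hX f hfS).2.1)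
      have h4 := card_cut_inter_add_union hJ E Y (X f)
      have h5 := (hX f hfS).2.2
      omega
    · have hgY := hleave g (hRS hg) Y (hRY g hg)
      refine ⟨Or.inl hgY.1, fun h => h.elim hgY.2 fun h => ?_⟩
      have h3 := (hpX f hfS _ (hp g (hRS hg)).1).1 h
      have h4 := hmin g hg
      omega
  intro Y hY hY'
  have h0 := card_cut_sdiff (J := J) hS Y
  suffices h : (cut J S Y).card + lam ≤ (cut J E Y).card by omega
  rcases (cut J S Y).eq_empty_or_nonempty with hR | hR
  · rw [hR, Finset.card_empty, zero_add]
    exact hE Y hY hY'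
  have hRS : cut J S Y ⊆ S := Finset.filter_subset _ _
  have hRY : ∀ f ∈ cut J S Y, Leaves J f Y := fun f hf => (Finset.mem_filter.1 hf).2
  -- Arbitrary sets are uncrossed with X f for the last such edge f on the path. Now all edges in
  -- question leave Y ∩ X f, which avoids v and is covered by the previous case, and f leaves Y ∪ X
  -- f.
  obtain ⟨f, hf, hmax⟩ := (cut J S Y).exists_max_image idx hR
  have hfS := hRS hf
  have hfY := hleave f hfS Y (hRY f hf)
  have h1 : lam + 1 ≤ (cut J E (Y ∪ X f)).card := by
    refine lt_card_cut_of_deletable (hS hfS) (hdel f hfS)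
      ⟨_, _, Or.inl hfY.1, fun h => h.elim hfY.2 fun h => ?_, (hp f hfS).2⟩
    have := (hpX f hfS _ (hp f hfS).1).1 h
    omega
  have h2 := hv (Y ∩ X f) (fun h => (hX f hfS).2.1 h.2) _ hRS hR fun g hg => by
    have hgY := hleave g (hRS hg) Y (hRY g hg)
    refine ⟨_, _, ⟨hgY.1, ?_⟩, fun h => hgY.2 h.1, (hp g (hRS hg)).2⟩
    exact (hpX f hfS _ (hp g (hRS hg)).1.le).2 (hmax g hg)
  have h3 := card_cut_inter_add_union hJ E Y (X f)
  have h4 := (hX f hfS).2.2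
  omega

/-- In a graph, minimum cuts `Y f` that do not separate `u` from `v`, each associated with one of
several nested minimum cuts between `u` and `v`, can be made disjoint. -/
theorem exists_disjoint_cuts [Fintype V] (hJ : IsEdgeSystem J)
    (hs : ∀ e a b, J e a b → J e b a) {D S : Finset ε} {u v : V} {lam : ℕ}
    (hD : CutConnected J lam D) {X : ε → Set V} {a b : ε → V}
    (hX : ∀ f ∈ S, u ∈ X f ∧ v ∉ X f ∧ (cut J D (X f)).card = lam)
    (hb : ∀ f ∈ S, b f ∉ X f)
    (htot : ∀ f ∈ S, ∀ g ∈ S, f ≠ g → b f ∈ X g ∨ b g ∈ X f)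
    (hY : ∀ f ∈ S, ∃ Y : Set V, u ∉ Y ∧ v ∉ Y ∧ b f ∈ Y ∧ a f ∉ Y ∧ (cut J D Y).card = lam) :
    ∃ Y : ε → Set V, (∀ f ∈ S, u ∉ Y f ∧ v ∉ Y f ∧ b f ∈ Y f ∧ a f ∉ Y f ∧
      (cut J D (Y f)).card = lam) ∧ ∀ f ∈ S, ∀ g ∈ S, f ≠ g → Disjoint (Y f) (Y g) := by
  -- Inclusion-minimal sets are chosen; uncrossing with the sets X yields minimum cuts inside them,
  -- which must then be equal to them.
  have hmin : ∀ f ∈ S, ∃ Y : Set V, (u ∉ Y ∧ v ∉ Y ∧ b f ∈ Y ∧ a f ∉ Y ∧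
      (cut J D Y).card = lam) ∧ ∀ Y' : Set V, (u ∉ Y' ∧ v ∉ Y' ∧ b f ∈ Y' ∧ a f ∉ Y' ∧
      (cut J D Y').card = lam) → Y' ⊆ Y → Y' = Y := by
    intro f hf
    obtain ⟨Y, hY⟩ := (Set.toFinite {Y : Set V | u ∉ Y ∧ v ∉ Y ∧ b f ∈ Y ∧ a f ∉ Y ∧
      (cut J D Y).card = lam}).exists_minimal (hY f hf)
    exact ⟨Y, hY.1, fun Y' h1 h2 => le_antisymm h2 (hY.2 h1 h2)⟩
  choose! Y hY hYmin using hmin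
  -- Posimodularity: u lies in X f \ Y f and b f in Y f \ X f, so both differences are genuine cuts
  -- and both are minimum. By minimality Y f is the second one.
  have hdisj : ∀ f ∈ S, Disjoint (Y f) (X f) := by
    intro f hf
    obtain ⟨h1, h2, h3, h4, h5⟩ := hY f hf
    obtain ⟨h6, h7, h8⟩ := hX f hf
    have h9 : (cut J D (Y f \ X f)).card = lam := by
      have h := card_cut_diff_add_diff hJ hs D (X f) (Y f)
      have h10 := hD (X f \ Y f) ⟨u, h6, h1⟩ fun h => (h ▸ Set.mem_univ v : v ∈ X f \ Y f).2 |>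
        fun _ => h7 (h ▸ Set.mem_univ v : v ∈ X f \ Y f).1
      have h11 := hD (Y f \ X f) ⟨b f, h3, hb f hf⟩ fun h =>
        h1 (h ▸ Set.mem_univ u : u ∈ Y f \ X f).1
      omega
    rw [← hYmin f hf (Y f \ X f) ⟨fun h => h1 h.1, fun h => h2 h.1, ⟨h3, hb f hf⟩,
      fun h => h4 h.1, h9⟩ Set.sdiff_subset]
    exact Set.disjoint_sdiff_left
  -- Submodularity: the union misses v and the intersection contains b f, so the intersection is
  -- again a minimum cut. Consequently, of two of the sets one lies inside some X g and the other is
  -- disjoint from it.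
  have hsub : ∀ f ∈ S, ∀ g ∈ S, b f ∈ X g → Y f ⊆ X g := by
    intro f hf g hg hfg
    obtain ⟨h1, h2, h3, h4, h5⟩ := hY f hf
    obtain ⟨h6, h7, h8⟩ := hX g hg
    have h9 : (cut J D (Y f ∩ X g)).card = lam := by
      have h := card_cut_inter_add_union hJ D (Y f) (X g)
      have h10 := hD (Y f ∪ X g) ⟨u, Or.inr h6⟩ fun h =>
        (h ▸ Set.mem_univ v : v ∈ Y f ∪ X g).elim h2 h7
      have h11 := hD (Y f ∩ X g) ⟨b f, h3, hfg⟩ fun h =>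
        h1 (h ▸ Set.mem_univ u : u ∈ Y f ∩ X g).1
      omega
    rw [← hYmin f hf (Y f ∩ X g) ⟨fun h => h1 h.1, fun h => h2 h.1, ⟨h3, hfg⟩,
      fun h => h4 h.1, h9⟩ Set.inter_subset_left]
    exact Set.inter_subset_right
  refine ⟨Y, hY, fun f hf g hg hne => ?_⟩
  rcases htot f hf g hg hne with h | h
  · exact ((hdisj g hg).mono_right (hsub f hf g hg h)).symm
  · exact (hdisj f hf).mono_right (hsub g hg f hf h)

/-- A set of `m` edges meets the cuts of at most `2 * m` disjoint vertex sets. -/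
theorem card_le_of_disjoint_cuts [Fintype V] (hJ : IsEdgeSystem J) {F S : Finset ε}
    {Y : ε → Set V} (hY : ∀ f ∈ S, ∃ g ∈ F, Leaves J g (Y f))
    (hdisj : ∀ f ∈ S, ∀ g ∈ S, f ≠ g → Disjoint (Y f) (Y g)) : S.card ≤ F.card * 2 := by
  rcases S.eq_empty_or_nonempty with rfl | ⟨f₀, hf₀⟩
  · simp
  obtain ⟨-, -, x₀, -⟩ := hY f₀ hf₀
  have : Nonempty V := ⟨x₀⟩
  choose! g hg hgY using hY
  choose! a b ha hb hab using hgY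
  -- Each set contains an end a f of an edge of F. These ends are distinct because the sets are
  -- disjoint, and each edge has at most two ends.
  refine le_trans (Finset.card_le_card_of_injOn a (t := F.biUnion fun e =>
    Finset.univ.filter fun x => ∃ y, J e x y) ?_ ?_) (Finset.card_biUnion_le_card_mul _ _ _ ?_)
  · intro f hf
    exact Finset.mem_biUnion.2 ⟨g f, hg f hf, Finset.mem_filter.2
        ⟨Finset.mem_univ _, b f, hab f hf⟩⟩
  · intro f hf f' hf' h
    by_contra hne
    have h1 := ha f hf
    rw [h] at h1
    exact Set.disjoint_left.1 (hdisj f hf f' hf' hne) h1 (ha f' hf')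
  · intro e _
    obtain ⟨c, d, -, h⟩ := hJ.ends e
    refine (Finset.card_le_card (t := {c, d}) fun x hx => ?_).trans Finset.card_le_two
    obtain ⟨-, y, hxy⟩ := Finset.mem_filter.1 hx
    rcases h _ _ hxy with h | h <;> simp [h.1]

/-- Deletable edges that are not deletable after the removal of `F` become undeletable in the course
of the removal of the edges of `F` one by one. -/
theorem exists_critical_edge [DecidableEq ε] {lam b : ℕ} (F : Finset ε) : ∀ {G L : Finset ε},
    F ⊆ G →
    (∀ f ∈ L, CutConnected J lam (G \ {f})) → (∀ f ∈ L, ¬ CutConnected J lam ((G \ F) \ {f})) →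
    F.card * b < L.card → ∃ F₁ F₂ : Finset ε, ∃ e, e ∉ F₁ ∧ e ∉ F₂ ∧ Disjoint F₁ F₂ ∧
      F = insert e (F₁ ∪ F₂) ∧ ∃ L' ⊆ L, b < L'.card ∧
        (∀ f ∈ L', CutConnected J lam ((G \ F₁) \ {f})) ∧
        ∀ f ∈ L', ¬ CutConnected J lam ((G \ insert e F₁) \ {f}) := by
  induction F using Finset.induction_on with
  | empty =>
    intro G L _ h1 h2 hL
    obtain ⟨f, hf⟩ := Finset.card_pos.1 (Nat.zero_lt_of_lt hL)
    exact absurd (h1 f hf) (by simpa using h2 f hf)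
  | insert g F hg ih =>
    intro G L hF h1 h2 hL
    rw [Finset.card_insert_of_notMem hg] at hL
    -- Either the removal of g alone spoils more than b edges of L and e = g works, or at most b
    -- edges are lost and the rest of L satisfies the hypotheses after the removal of g.
    by_cases hb : b < (L.filter fun f => ¬ CutConnected J lam ((G \ {g}) \ {f})).card
    · refine ⟨∅, F, g, by simp, hg, by simp, by simp, _, Finset.filter_subset _ _, hb, ?_, ?_⟩
      · intro f hf
        simpa using h1 f (Finset.mem_filter.1 hf).1
      · intro f hf
        simpa using (Finset.mem_filter.1 hf).2
    have hcard := Finset.card_filter_add_card_filter_not (s := L)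
      fun f => CutConnected J lam ((G \ {g}) \ {f})
    have hFg : F ⊆ G \ {g} := fun x hx => Finset.mem_sdiff.2
      ⟨hF (Finset.mem_insert_of_mem hx), fun h => hg (Finset.mem_singleton.1 h ▸ hx)⟩
    have hsd : ∀ F' : Finset ε, (G \ {g}) \ F' = G \ insert g F' := fun F' => by
      rw [sdiff_sdiff_left]; rfl
    obtain ⟨F₁, F₂, e, he₁, he₂, hdis, hFe, L', hL', hbL, h3, h4⟩ := ih (G := G \ {g})
      (L := L.filter fun f => CutConnected J lam ((G \ {g}) \ {f})) hFg
      (fun f hf => (Finset.mem_filter.1 hf).2)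
      (fun f hf => by rw [hsd]; exact h2 f (Finset.mem_filter.1 hf).1)
      (by rw [add_mul, one_mul] at hL; omega)
    rw [hsd] at h3 h4
    refine ⟨insert g F₁, F₂, e, ?_, he₂, ?_, ?_, L', hL'.trans (Finset.filter_subset _ _), hbL, h3,
      fun f hf => by rw [Finset.insert_comm]; exact h4 f hf⟩
    · rw [Finset.mem_insert, not_or]
      exact ⟨fun h => hg (by rw [hFe, ← h]; exact Finset.mem_insert_self _ _), he₁⟩
    · rw [Finset.disjoint_insert_left]
      exact ⟨fun h => hg (by rw [hFe]; simp [h]), hdis⟩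
    · rw [hFe, Finset.insert_union, Finset.insert_comm]

/-- If `F` is a set of edges whose removal preserves connectivity and `L` is a sufficiently large
    set
of deletable edges outside `F`, then an edge of `L` can be added to `F`, or exchanged for an edge of
`F`, or `F` can be replaced by a set of edges of `L`. -/
theorem exists_exchange [Fintype V] [DecidableEq ε] (hJ : IsEdgeSystem J) {lam : ℕ} (hlam : 0 < lam)
    {G F L : Finset ε} (hF : F ⊆ G) (hGF : CutConnected J lam (G \ F)) (hL : L ⊆ G)
    (hFL : Disjoint F L) (hdel : ∀ f ∈ L, CutConnected J lam (G \ {f})) (hne : L.Nonempty)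
    (hcard : lam * (F.card * (4 * F.card)) ≤ L.card) :
    (∃ f ∈ L, CutConnected J lam (G \ insert f F)) ∨
    (∃ f ∈ L, ∃ e ∈ F, CutConnected J lam (G \ insert f (F.erase e))) ∨
    ∃ S ⊆ L, S.card = F.card ∧ CutConnected J lam (G \ S) := by
  by_cases hadd : ∃ f ∈ L, CutConnected J lam (G \ insert f F)
  · exact Or.inl hadd
  refine Or.inr ?_
  have hundel : ∀ f ∈ L, ¬ CutConnected J lam ((G \ F) \ {f}) := fun f hf h => hadd
    ⟨f, hf, by rwa [sdiff_sdiff_left, Finset.sup_eq_union, Finset.union_comm] at h⟩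
  have hFpos : 0 < F.card := by
    rw [Finset.card_pos]
    by_contra h
    rw [Finset.not_nonempty_iff_eq_empty] at h
    obtain ⟨f, hf⟩ := hne
    exact hundel f hf (by simpa [h] using hdel f hf)
  -- The value of b is chosen such that the later pigeonhole over lam paths leaves at least 4|F|
  -- edges on one path. The required inequality is strict because lam * |F| is positive.
  obtain ⟨F₁, F₂, e, he₁, he₂, hdis, hFe, L', hL', hbL, h3, h4⟩ :=
    exists_critical_edge (b := lam * (4 * F.card - 1)) F hF hdel hundel (by
      have h1 : F.card * (lam * (4 * F.card - 1)) + lam * F.card = lam * (F.card * (4 * F.card)) :=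
          by
        obtain ⟨m, hm⟩ : ∃ m, F.card = m + 1 := ⟨F.card - 1, by omega⟩
        rw [hm, show 4 * (m + 1) - 1 = 4 * m + 3 by omega]; ring
      have h2 : 0 < lam * F.card := Nat.mul_pos hlam hFpos
      omega)
  have heF : e ∈ F := by rw [hFe]; exact Finset.mem_insert_self _ _
  have hF₁ : F₁ ⊆ F := by rw [hFe]; exact fun x hx => by simp [hx]
  have hF₂ : F₂ ⊆ F := by rw [hFe]; exact fun x hx => by simp [hx]
  have hF₂card : F₂.card + 1 ≤ F.card := by
    rw [← Finset.card_insert_of_notMem he₂]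
    exact Finset.card_le_card (Finset.insert_subset heF hF₂)
  set E := G \ F₁ with hE
  set D := G \ F with hD
  have heE : e ∈ E := Finset.mem_sdiff.2 ⟨hF heF, he₁⟩
  have hDE : D ⊆ E \ {e} := by
    rw [hD, hE, sdiff_sdiff_left]
    refine Finset.sdiff_subset_sdiff subset_rfl ?_
    exact Finset.union_subset hF₁ (Finset.singleton_subset_iff.2 heF)
  have hDE' : D = E \ insert e F₂ := by
    rw [hD, hE, sdiff_sdiff_left, hFe, Finset.sup_eq_union, Finset.union_insert]
  have heF₂E : insert e F₂ ⊆ E := Finset.insert_subset heE fun x hx => Finset.mem_sdiff.2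
    ⟨hF (hF₂ hx), fun h => Finset.disjoint_left.1 hdis h hx⟩
  have hEcc : CutConnected J lam E := hGF.mono (hDE.trans Finset.sdiff_subset)
  have hEe : CutConnected J lam (E \ {e}) := hGF.mono hDE
  have hins : G \ insert e F₁ = E \ {e} := by
    rw [hE, sdiff_sdiff_left, Finset.sup_eq_union, Finset.union_comm]; rfl
  rw [hins] at h4
  have hL'D : L' ⊆ D := fun f hf => Finset.mem_sdiff.2
    ⟨hL (hL' hf), fun h => Finset.disjoint_left.1 hFL h (hL' hf)⟩
  have hL'E : L' ⊆ E := hL'D.trans (hDE.trans Finset.sdiff_subset)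
  -- minimum cuts through the edges of `L'` after the removal of `e`
  have hcuts : ∀ f ∈ L', ∃ X : Set V, Leaves J f X ∧ Leaves J e X ∧
      (cut J E X).card = lam + 1 ∧ (cut J D X).card = lam := by
    intro f hf
    have h5 := h4 f hf
    simp only [CutConnected, not_forall, not_le] at h5
    obtain ⟨X, hX, hX', h5⟩ := h5
    have hfe : f ∈ E \ {e} := hDE (hL'D hf)
    have h6 := card_cut_sdiff (J := J) (Finset.singleton_subset_iff.2 hfe) X
    have h7 := hEe X hX hX'
    have h8 := hGF X hX hX'
    have h9 := card_cut_mono (J := J) hDE X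
    have h10 := card_cut_sdiff (J := J) (Finset.singleton_subset_iff.2 heE) X
    rw [card_cut_singleton] at h6 h10
    -- Without e the cut has at least lam edges, but fewer than lam once f is deleted as well; so f
    -- crosses it and exactly lam edges remain without e. As f is deletable in E, the cut has at
    -- least lam + 1 edges there, so e crosses it too.
    have hfX : Leaves J f X := by by_contra h; rw [if_neg h] at h6; omega
    have h11 := lt_card_cut_of_deletable (hL'E hf) (h3 f hf) hfX
    rw [if_pos hfX] at h6
    have heX : Leaves J e X := by by_contra h; rw [if_neg h] at h10; omega
    rw [if_pos heX] at h10
    exact ⟨X, hfX, heX, by omega, by omega⟩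
  obtain ⟨u, v, huv, huv'⟩ := hJ.ends e
  rcases hJ.oriented with hd | hs
  · -- digraphs
    right
    have hcuts' : ∀ f ∈ L', ∃ X : Set V, Leaves J f X ∧ u ∈ X ∧ v ∉ X ∧
        (cut J E X).card = lam + 1 ∧ (cut J D X).card = lam := by
      intro f hf
      obtain ⟨X, h5, ⟨a, b, ha, hb, hab⟩, h6⟩ := hcuts f hf
      obtain ⟨rfl, rfl⟩ := hd _ _ _ _ _ huv hab
      exact ⟨X, h5, ha, hb, h6⟩
    choose! X hfX hu hv hcE hcD using hcuts'
    obtain ⟨L'', hL'', hcard'', len, p, idx, hp, hpX, -, hI⟩ := exists_common_path hJ (E := D)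
      (L := L') (u := u) (v := v) (lam := lam) (fun X h5 h6 => hGF X ⟨u, h5⟩ fun h => h6
          (by simp [h])) X
      (fun f hf => ⟨hu f hf, hv f hf, hcD f hf⟩) (fun f hf => ⟨hL'D hf, hfX f hf⟩) hbL
    obtain ⟨S, hS, hScard⟩ := Finset.exists_subset_card_eq (s := L'') (n := F.card) (by omega)
    refine ⟨S, (hS.trans hL'').trans hL', hScard, ?_⟩
    have hSL' := hS.trans hL''
    -- It suffices to delete S from the smaller edge set E.
    refine CutConnected.mono ?_ (Finset.sdiff_subset_sdiff (Finset.sdiff_subset (t := F₁))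
        subset_rfl)
    exact cutConnected_sdiff_path hJ hd hEcc heE huv hDE (hSL'.trans hL'E)
      (fun f hf => h3 f (hSL' hf)) (fun f hf => ⟨hu f (hSL' hf), hv f (hSL' hf), hcE f (hSL' hf)⟩)
      (fun f hf => hp f (hS hf)) (fun f hf => hpX f (hS hf))
      fun Z h5 h6 S' hS' => hI Z h5 h6 S' (hS'.trans hS)
  · -- graphs
    left
    have hcuts' : ∀ f ∈ L', ∃ X : Set V, Leaves J f X ∧ u ∈ X ∧ v ∉ X ∧
        (cut J D X).card = lam := by
      intro f hf
      obtain ⟨X, h5, ⟨a, b, ha, hb, hab⟩, -, h6⟩ := hcuts f hf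
      rcases huv' a b hab with ⟨rfl, rfl⟩ | ⟨rfl, rfl⟩
      · exact ⟨X, h5, ha, hb, h6⟩
      · exact ⟨Xᶜ, (leaves_compl hs _ _).2 h5, hb, fun h => h ha, by rwa [cut_compl hs]⟩
    choose! X hfX hu hv hcD using hcuts'
    obtain ⟨L'', hL'', hcard'', len, p, idx, hp, hpX, hinj, -⟩ := exists_common_path hJ (E := D)
      (L := L') (u := u) (v := v) (lam := lam) (fun X h5 h6 => hGF X ⟨u, h5⟩ fun h => h6
          (by simp [h])) X
      (fun f hf => ⟨hu f hf, hv f hf, hcD f hf⟩) (fun f hf => ⟨hL'D hf, hfX f hf⟩) hbL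
    by_contra hno
    push Not at hno
    -- Exchanging f for e turns D into D + e - f. A cut with fewer than lam edges there must contain
    -- f and cannot contain e, because D itself has at least lam edges in it. So it has exactly lam
    -- edges in D and does not separate u from v; passing to the complement if necessary, it avoids
    -- both.
    have hY : ∀ f ∈ L'', ∃ Y : Set V, u ∉ Y ∧ v ∉ Y ∧ Leaves J f Y ∧ (cut J D Y).card = lam := by
      intro f hf
      have hfL' := hL'' hf
      have h5 := hno f (hL' hfL') e heF
      have hins' : (G \ insert f (F.erase e)) = (insert e D) \ {f} := by
        have hfF : f ∉ F := fun h => Finset.disjoint_left.1 hFL h (hL' hfL')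
        ext x
        simp only [hD, Finset.mem_sdiff, Finset.mem_insert, Finset.mem_erase, Finset.mem_singleton]
        by_cases hxe : x = e
        · subst hxe
          have : x ≠ f := fun h => hfF (h ▸ heF)
          simp [this, hF heF]
        · simp only [hxe]; tauto
      rw [hins'] at h5
      simp only [CutConnected, not_forall, not_le] at h5
      obtain ⟨Y, hY, hY', h5⟩ := h5
      have heD : e ∉ D := fun h => (Finset.mem_sdiff.1 h).2 heF
      have h6 := card_cut_sdiff (J := J)
        (Finset.singleton_subset_iff.2 (Finset.mem_insert_of_mem (hL'D hfL') : f ∈ insert e D)) Y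
      have h7 := card_cut_sdiff (J := J)
        (Finset.singleton_subset_iff.2 (Finset.mem_insert_self e D)) Y
      have h8 : insert e D \ {e} = D := by
        rw [← Finset.erase_eq]; exact Finset.erase_insert heD
      rw [h8] at h7
      have h9 := hGF Y hY hY'
      rw [card_cut_singleton] at h6 h7
      have hfY : Leaves J f Y := by by_contra h; rw [if_neg h] at h6; omega
      rw [if_pos hfY] at h6
      have heY : ¬ Leaves J e Y := by intro h; rw [if_pos h] at h7; omega
      rw [if_neg heY] at h7
      have heq : u ∈ Y ↔ v ∈ Y := by
        constructor
        · intro h; by_contra h'; exact heY ⟨u, v, h, h', huv⟩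
        · intro h; by_contra h'; exact heY ⟨v, u, h, h', hs _ _ _ huv⟩
      by_cases huY : u ∈ Y
      · exact ⟨Yᶜ, fun h => h huY, fun h => h (heq.1 huY), (leaves_compl hs _ _).2 hfY, by
          rw [cut_compl hs]; omega⟩
      · exact ⟨Y, huY, fun h => huY (heq.2 h), hfY, by omega⟩
    -- As f is deletable in E, the cut has more edges in E than in D. An additional edge cannot be
    -- e, both ends of which are outside Y, so it belongs to F₂.
    have hF₂Y : ∀ f ∈ L'', ∀ Y : Set V, u ∉ Y → v ∉ Y → Leaves J f Y → (cut J D Y).card = lam →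
        ∃ g ∈ F₂, Leaves J g Y := by
      intro f hf Y huY hvY hfY hc
      have h5 := lt_card_cut_of_deletable (hL'E (hL'' hf)) (h3 f (hL'' hf)) hfY
      have h6 := card_cut_sdiff (J := J) heF₂E Y
      rw [← hDE'] at h6
      obtain ⟨g, hg⟩ : (cut J (insert e F₂) Y).Nonempty := Finset.card_pos.1 (by omega)
      obtain ⟨hg, hgY⟩ := Finset.mem_filter.1 hg
      rcases Finset.mem_insert.1 hg with rfl | hg
      · obtain ⟨a, b, ha, hb, hab⟩ := hgY
        rcases huv' a b hab with ⟨rfl, rfl⟩ | ⟨rfl, rfl⟩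
        · exact absurd ha huY
        · exact absurd ha hvY
      · exact ⟨g, hg, hgY⟩
    have hcount : ∀ S ⊆ L'', ∀ Y : ε → Set V, (∀ f ∈ S, u ∉ Y f ∧ v ∉ Y f ∧ Leaves J f (Y f) ∧
        (cut J D (Y f)).card = lam) → (∀ f ∈ S, ∀ g ∈ S, f ≠ g → Disjoint (Y f) (Y g)) →
        S.card ≤ F₂.card * 2 := fun S hS Y h5 h6 => card_le_of_disjoint_cuts hJ
      (fun f hf => hF₂Y f (hS hf) (Y f) (h5 f hf).1 (h5 f hf).2.1 (h5 f hf).2.2.1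
        (h5 f hf).2.2.2) h6
    have hend : ∀ f ∈ L'', ∀ Y, Leaves J f Y → (p (idx f) ∈ Y ∧ p (idx f + 1) ∉ Y) ∨
        (p (idx f + 1) ∈ Y ∧ p (idx f) ∉ Y) := by
      rintro f hf Y ⟨a, b, ha, hb, hab⟩
      obtain ⟨c, d, -, h⟩ := hJ.ends f
      have h5 := h _ _ (hp f hf).2
      have h6 := h _ _ hab
      rcases h5 with ⟨h5, h5'⟩ | ⟨h5, h5'⟩ <;> rcases h6 with ⟨rfl, rfl⟩ | ⟨rfl, rfl⟩ <;>
        simp [h5, h5', ha, hb]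
    choose! Y huY hvY hfY hcY using hY
    -- The edges are classified by the end of f, earlier or later on the path, that lies in Y f;
    -- within a class the sets can be made disjoint.
    have hsplit := Finset.card_filter_add_card_filter_not (s := L'') fun f => p (idx f) ∈ Y f
    have hlt : ∀ f ∈ L'', ∀ g ∈ L'', f ≠ g → idx f < idx g ∨ idx g < idx f := fun f hf g hg hne =>
      lt_or_gt_of_ne fun h => hne (hinj hf hg h)
    -- For the earlier ends, u and v trade places and the sets X f are complemented, as if the path
    -- were traversed backwards.
    have hA : (L''.filter fun f => p (idx f) ∈ Y f).card ≤ F₂.card * 2 := by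
      have hsub := Finset.filter_subset (fun f => p (idx f) ∈ Y f) L''
      obtain ⟨Z, hZ, hZd⟩ := exists_disjoint_cuts hJ hs hGF (S := L''.filter
          fun f => p (idx f) ∈ Y f)
        (u := v) (v := u) (X := fun f => (X f)ᶜ) (a := fun f => p (idx f + 1))
        (b := fun f => p (idx f))
        (fun f hf => ⟨hv f (hL'' (hsub hf)), fun h => h (hu f (hL'' (hsub hf))), by
          rw [cut_compl hs]; exact hcD f (hL'' (hsub hf))⟩)
        (fun f hf h => h ((hpX f (hsub hf) _ (hp f (hsub hf)).1.le).2 le_rfl))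
        (fun f hf g hg hne => by
          rcases hlt f (hsub hf) g (hsub hg) hne with h | h
          · right; intro h5
            have := (hpX f (hsub hf) _ (hp g (hsub hg)).1.le).1 h5
            omega
          · left; intro h5
            have := (hpX g (hsub hg) _ (hp f (hsub hf)).1.le).1 h5
            omega)
        (fun f hf => by
          have h5 := Finset.mem_filter.1 hf
          refine ⟨Y f, hvY f h5.1, huY f h5.1, h5.2, ?_, hcY f h5.1⟩
          rcases hend f h5.1 _ (hfY f h5.1) with h6 | h6
          · exact h6.2
          · exact absurd h5.2 h6.2)
      refine hcount _ hsub Z (fun f hf => ?_) hZd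
      obtain ⟨h5, h6, h7, h8, h9⟩ := hZ f hf
      exact ⟨h6, h5, ⟨_, _, h7, h8, (hp f (hsub hf)).2⟩, h9⟩
    have hB : (L''.filter fun f => ¬ p (idx f) ∈ Y f).card ≤ F₂.card * 2 := by
      have hsub := Finset.filter_subset (fun f => ¬ p (idx f) ∈ Y f) L''
      obtain ⟨Z, hZ, hZd⟩ := exists_disjoint_cuts hJ hs hGF
        (S := L''.filter fun f => ¬ p (idx f) ∈ Y f)
        (u := u) (v := v) (X := X) (a := fun f => p (idx f)) (b := fun f => p (idx f + 1))
        (fun f hf => ⟨hu f (hL'' (hsub hf)), hv f (hL'' (hsub hf)), hcD f (hL'' (hsub hf))⟩)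
        (fun f hf h => by
          have := (hpX f (hsub hf) _ (hp f (hsub hf)).1).1 h
          omega)
        (fun f hf g hg hne => by
          rcases hlt f (hsub hf) g (hsub hg) hne with h | h
          · exact Or.inl ((hpX g (hsub hg) _ (hp f (hsub hf)).1).2 h)
          · exact Or.inr ((hpX f (hsub hf) _ (hp g (hsub hg)).1).2 h))
        (fun f hf => by
          have h5 := Finset.mem_filter.1 hf
          refine ⟨Y f, huY f h5.1, hvY f h5.1, ?_, h5.2, hcY f h5.1⟩
          rcases hend f h5.1 _ (hfY f h5.1) with h6 | h6
          · exact absurd h6.1 h5.2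
          · exact h6.1)
      refine hcount _ hsub Z (fun f hf => ?_) hZd
      obtain ⟨h5, h6, h7, h8, h9⟩ := hZ f hf
      exact ⟨h5, h6, ⟨_, _, h7, h8, hs _ _ _ (hp f (hsub hf)).2⟩, h9⟩
    -- The two classes have at most 4|F₂| ≤ 4(|F| - 1) edges together, but L'' has at least 4|F|.
    omega

end Exchange

/-! ## The edge-connectivity of graphs and digraphs in terms of cuts -/

section Bridge

variable {V : Type}

theorem Kind.isEdgeSystem (K : Kind) : IsEdgeSystem (K.Joins (V := V)) := by
  cases K with
  | directed =>
    refine ⟨?_, ?_, Or.inl ?_⟩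
    · rintro e e' a b rfl rfl; rfl
    · rintro ⟨a, b⟩
      refine ⟨a, b, rfl, fun c d h => ?_⟩
      simp only [Prod.mk.injEq] at h
      exact Or.inl ⟨h.1.symm, h.2.symm⟩
    · rintro e a b c d rfl h
      simp only [Prod.mk.injEq] at h
      exact ⟨h.1.symm, h.2.symm⟩
  | undirected =>
    refine ⟨?_, ?_, Or.inr ?_⟩
    · rintro e e' a b rfl rfl; rfl
    · intro e
      induction e using Sym2.ind with
      | _ a b =>
        refine ⟨a, b, rfl, fun c d h => ?_⟩
        rcases Sym2.eq_iff.1 h with h | h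
        · exact Or.inl ⟨h.1.symm, h.2.symm⟩
        · exact Or.inr ⟨h.2.symm, h.1.symm⟩
    · rintro e a b rfl
      exact Sym2.eq_swap

/-- If v is not reachable from u, then no edge leaves the set of vertices reachable from u;
conversely, membership in a set that no edge leaves propagates along every walk. -/
theorem connected_iff_leaves (K : Kind) (E : Set (K.Edge V)) :
    Connected K E ↔ ∀ X : Set V, X.Nonempty → X ≠ Set.univ → ∃ e ∈ E, Leaves K.Joins e X := by
  constructor
  · rintro h X ⟨u, hu⟩ hX
    obtain ⟨v, hv⟩ := (Set.ne_univ_iff_exists_notMem X).1 hX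
    by_contra hno
    push Not at hno
    refine hv (Relation.ReflTransGen.head_induction_on
      (motive := fun a _ => a ∈ X → v ∈ X) (h u v) id ?_ hu)
    rintro a b ⟨e, he, hab⟩ _ ih ha
    by_contra hv'
    exact hno e he ⟨a, b, ha, fun hb => hv' (ih hb), hab⟩
  · intro h u v
    by_contra hno
    obtain ⟨e, he, a, b, ha, hb, hab⟩ := h
      {x | Relation.ReflTransGen (fun a b => ∃ e ∈ E, K.Joins e a b) u x} ⟨u, .refl⟩
      fun h => hno (h ▸ Set.mem_univ v : v ∈ {x | Relation.ReflTransGen _ u x})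
    exact hb (Relation.ReflTransGen.tail ha ⟨e, he, hab⟩)

/-- A cut with fewer than lam edges could be deleted as a whole, while fewer than lam deletions
cannot exhaust a cut with lam edges. From here on connectivity is a matter of cut sizes. -/
theorem edgeConnected_iff (K : Kind) {lam : ℕ} (hlam : 0 < lam) (E : Finset (K.Edge V)) :
    EdgeConnected K lam (E : Set (K.Edge V)) ↔ CutConnected K.Joins lam E := by
  constructor
  · rintro ⟨-, h⟩ X hX hX'
    by_contra hlt
    obtain ⟨e, he, heX⟩ := (connected_iff_leaves K _).1 (h (cut K.Joins E X)
      (Finset.coe_subset.2 (Finset.filter_subset _ _)) (not_le.1 hlt)) X hX hX'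
    exact he.2 (Finset.mem_coe.2 (Finset.mem_filter.2 ⟨Finset.mem_coe.1 he.1, heX⟩))
  · intro h
    have key : ∀ S : Finset (K.Edge V), S.card < lam →
        Connected K ((E : Set (K.Edge V)) \ (S : Set (K.Edge V))) := by
      intro S hS
      refine (connected_iff_leaves K _).2 fun X hX hX' => ?_
      obtain ⟨e, he, heS⟩ := Finset.exists_mem_notMem_of_card_lt_card (hS.trans_le (h X hX hX'))
      obtain ⟨he, heX⟩ := Finset.mem_filter.1 he
      exact ⟨e, ⟨Finset.mem_coe.2 he, heS⟩, heX⟩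
    exact ⟨by simpa using key ∅ hlam, fun S _ hS => key S hS⟩

end Bridge

/-! ## The search space -/

section Search

variable {ι V : Type} [LinearOrder ι] (J : ι → V → V → Prop) (lam : ℕ) (w : ι → ℝ)

/-- The edges of `A` whose removal preserves connectivity. -/
noncomputable def deletable (A : Finset ι) : Finset ι :=
  A.filter fun f => CutConnected J lam (A \ {f})

/-- The edge `x` comes before `y` in the order of decreasing weights. -/
def Before (x y : ι) : Prop := w y < w x ∨ (w y ≤ w x ∧ x < y)

/-- The number of deletable edges that come before `f`. -/
noncomputable def rank (A : Finset ι) (f : ι) : ℕ :=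
  ((deletable J lam A).filter fun x => Before w x f).card

/-- Removal of the deletable edge of rank `c`, if there is one. -/
noncomputable def next (A : Finset ι) (c : ℕ) : Finset ι :=
  A.filter fun f => ¬ (f ∈ deletable J lam A ∧ rank J lam w A f = c)

/-- The edge set after the first `r` removals. -/
noncomputable def run (A : Finset ι) (c : ℕ → ℕ) : ℕ → Finset ι
  | 0 => A
  | r + 1 => next J lam w (run A c r) (c r)

variable {J lam w}

theorem Before.trichotomy {x y : ι} (h : x ≠ y) : Before w x y ∨ Before w y x := by
  unfold Before
  rcases lt_trichotomy (w x) (w y) with h1 | h1 | h1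
  · exact Or.inr (Or.inl h1)
  · rcases lt_or_gt_of_ne h with h2 | h2
    · exact Or.inl (Or.inr ⟨h1.ge, h2⟩)
    · exact Or.inr (Or.inr ⟨h1.le, h2⟩)
  · exact Or.inl (Or.inl h1)

theorem Before.le {x y : ι} (h : Before w x y) : w y ≤ w x := h.elim le_of_lt And.left

theorem Before.trans {x y z : ι} (h : Before w x y) (h' : Before w y z) : Before w x z := by
  rcases h with h | h <;> rcases h' with h' | h'
  · exact Or.inl (h'.trans h)
  · exact Or.inl (h'.1.trans_lt h)
  · exact Or.inl (h'.trans_le h.1)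
  · exact Or.inr ⟨h'.1.trans h.1, h.2.trans h'.2⟩

theorem Before.irrefl (x : ι) : ¬ Before w x x := by simp [Before]

theorem rank_lt_rank {A : Finset ι} {x y : ι} (hx : x ∈ deletable J lam A) (h : Before w x y) :
    rank J lam w A x < rank J lam w A y := by
  refine Finset.card_lt_card ((Finset.ssubset_iff_of_subset fun z hz => ?_).2 ⟨x, ?_, ?_⟩)
  · have := Finset.mem_filter.1 hz
    exact Finset.mem_filter.2 ⟨this.1, this.2.trans h⟩
  · exact Finset.mem_filter.2 ⟨hx, h⟩
  · exact fun hx' => Before.irrefl x (Finset.mem_filter.1 hx').2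

/-- Ties in weight are broken by the order of ι, so the deletable edges are totally ordered and a
rank determines an edge. -/
theorem rank_injOn (A : Finset ι) :
    Set.InjOn (rank J lam w A) (deletable J lam A : Set ι) := by
  intro x hx y hy hxy
  by_contra hne
  rcases Before.trichotomy (w := w) hne with h | h
  · exact (rank_lt_rank hx h).ne hxy
  · exact (rank_lt_rank hy h).ne hxy.symm

/-- If some deletable edge has rank at least `N`, then there are `N` deletable edges of smaller
rank. -/
theorem le_card_rank_lt {A : Finset ι} {N : ℕ} {f : ι} (hf : f ∈ deletable J lam A)
    (hN : N ≤ rank J lam w A f) :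
    N ≤ ((deletable J lam A).filter fun x => rank J lam w A x < N).card := by
  -- Let x have the least rank that is at least N. All predecessors of x then have ranks below N,
  -- and their number is the rank of x.
  obtain ⟨x, hx, hmin⟩ := ((deletable J lam A).filter fun x => N ≤ rank J lam w A
      x).exists_min_image
    (rank J lam w A) ⟨f, Finset.mem_filter.2 ⟨hf, hN⟩⟩
  obtain ⟨hx, hNx⟩ := Finset.mem_filter.1 hx
  refine hNx.trans (Finset.card_le_card fun y hy => ?_)
  obtain ⟨hy, hyx⟩ := Finset.mem_filter.1 hy
  refine Finset.mem_filter.2 ⟨hy, ?_⟩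
  by_contra h
  have h1 := hmin y (Finset.mem_filter.2 ⟨hy, not_lt.1 h⟩)
  have h2 := rank_lt_rank hy hyx
  omega

theorem weight_le_of_rank_lt {A : Finset ι} {x y : ι} (hy : y ∈ deletable J lam A)
    (h : rank J lam w A x < rank J lam w A y) : w y ≤ w x := by
  have hne : x ≠ y := by rintro rfl; exact lt_irrefl _ h
  rcases Before.trichotomy (w := w) hne with h' | h'
  · exact h'.le
  · exact absurd (rank_lt_rank hy h') h.not_gt

theorem next_subset (A : Finset ι) (c : ℕ) : next J lam w A c ⊆ A := Finset.filter_subset _ _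

theorem next_eq_sdiff {A : Finset ι} {f : ι} (hf : f ∈ deletable J lam A) :
    next J lam w A (rank J lam w A f) = A \ {f} := by
  ext x
  simp only [next, Finset.mem_filter, Finset.mem_sdiff, Finset.mem_singleton]
  refine and_congr_right fun _ => not_congr ⟨fun h => rank_injOn A h.1 hf h.2, ?_⟩
  rintro rfl
  exact ⟨hf, rfl⟩

/-- A rank that does not occur leaves the set unchanged, so every sequence of digits describes a
legal run. -/
theorem next_eq_or (A : Finset ι) (c : ℕ) : next J lam w A c = A ∨
    ∃ f ∈ deletable J lam A, next J lam w A c = A \ {f} := by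
  by_cases h : ∃ f ∈ deletable J lam A, rank J lam w A f = c
  · obtain ⟨f, hf, rfl⟩ := h
    exact Or.inr ⟨f, hf, next_eq_sdiff hf⟩
  · left
    refine Finset.filter_true_of_mem fun f _ hf => h ⟨f, hf⟩

theorem run_subset (A : Finset ι) (c : ℕ → ℕ) : ∀ r, run J lam w A c r ⊆ A
  | 0 => subset_rfl
  | r + 1 => (next_subset _ _).trans (run_subset A c r)

theorem card_sdiff_run (A : Finset ι) (c : ℕ → ℕ) (r : ℕ) :
    (A \ run J lam w A c r).card ≤ r := by
  induction r with
  | zero => simp [run]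
  | succ r ih =>
    rcases next_eq_or (J := J) (lam := lam) (w := w) (run J lam w A c r) (c r) with h | ⟨f, -, h⟩
    · rw [run, h]; omega
    · rw [run, h]
      refine (Finset.card_le_card (t := insert f (A \ run J lam w A c r)) fun x hx => ?_).trans
        ((Finset.card_insert_le _ _).trans (by omega))
      simp only [Finset.mem_sdiff, Finset.mem_singleton, Finset.mem_insert] at hx ⊢
      tauto

/-- Only deletable edges are removed. Together with `card_sdiff_run` this is the soundness of the
search: every run produces an admissible deletion set. -/
theorem cutConnected_run {A : Finset ι} (hA : CutConnected J lam A) (c : ℕ → ℕ) (r : ℕ) :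
    CutConnected J lam (run J lam w A c r) := by
  induction r with
  | zero => exact hA
  | succ r ih =>
    rcases next_eq_or (J := J) (lam := lam) (w := w) (run J lam w A c r) (c r) with h | ⟨f, hf, h⟩
    · rw [run, h]; exact ih
    · rw [run, h]; exact (Finset.mem_filter.1 hf).2

/-- The definition splits off the last removal, whereas the induction on the deletion set needs the
first one. -/
theorem run_succ' (A : Finset ι) (c : ℕ → ℕ) (r : ℕ) :
    run J lam w A c (r + 1) = run J lam w (next J lam w A (c 0)) (fun i => c (i + 1)) r := by
  induction r with
  | zero => rfl
  | succ r ih => rw [run, ih]; rfl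

theorem run_congr (A : Finset ι) {c c' : ℕ → ℕ} {r : ℕ} (h : ∀ i < r, c i = c' i) :
    run J lam w A c r = run J lam w A c' r := by
  induction r with
  | zero => rfl
  | succ r ih => rw [run, run, ih fun i hi => h i (by omega), h r (by omega)]

/-- Among the deletion sets of at least the weight of `F`, one contains an edge of small rank. -/
theorem exists_small_rank [Fintype V] (hJ : IsEdgeSystem J) (hlam : 0 < lam)
    {A F : Finset ι} {N k : ℕ} (hF : F ⊆ A) (hne : F.Nonempty) (hk : F.card ≤ k)
    (hN : lam * (k * (4 * k)) ≤ N) (hAF : CutConnected J lam (A \ F)) :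
    ∃ F' ⊆ A, F'.card ≤ k ∧ CutConnected J lam (A \ F') ∧ ∑ i ∈ F, w i ≤ ∑ i ∈ F', w i ∧
      ∃ f ∈ F', f ∈ deletable J lam A ∧ rank J lam w A f < N := by
  have hFdel : ∀ f ∈ F, f ∈ deletable J lam A := fun f hf => Finset.mem_filter.2 ⟨hF hf,
    hAF.mono (Finset.sdiff_subset_sdiff subset_rfl (Finset.singleton_subset_iff.2 hf))⟩
  by_cases hsmall : ∃ f ∈ F, rank J lam w A f < N
  · obtain ⟨f, hf, hfN⟩ := hsmall
    exact ⟨F, hF, hk, hAF, le_rfl, f, hf, hFdel f hf, hfN⟩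
  push Not at hsmall
  obtain ⟨f₀, hf₀⟩ := hne
  set L := (deletable J lam A).filter fun x => rank J lam w A x < N with hLdef
  have hLcard : N ≤ L.card := le_card_rank_lt (hFdel f₀ hf₀) (hsmall f₀ hf₀)
  have hLmem : ∀ f ∈ L, f ∈ deletable J lam A ∧ rank J lam w A f < N := fun f hf =>
    Finset.mem_filter.1 hf
  have hLA : L ⊆ A := (Finset.filter_subset _ _).trans (Finset.filter_subset _ _)
  have hFL : Disjoint F L := Finset.disjoint_left.2 fun x hx hx' =>
    absurd (hLmem x hx').2 (not_lt.2 (hsmall x hx))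
  have hle : ∀ x ∈ F, ∀ y ∈ L, w x ≤ w y := fun x hx y hy =>
    weight_le_of_rank_lt (hFdel x hx) ((hLmem y hy).2.trans_le (hsmall x hx))
  have hFpos : 0 < F.card := Finset.card_pos.2 ⟨f₀, hf₀⟩
  have hLcard' : lam * (F.card * (4 * F.card)) ≤ L.card := le_trans (by gcongr) (hN.trans hLcard)
  have hLne : L.Nonempty := Finset.card_pos.1 (lt_of_lt_of_le (by positivity) hLcard')
  -- Trading e for f keeps the size of F and does not decrease the weight.
  have hswap : ∀ f ∈ L, ∀ e ∈ F, CutConnected J lam (A \ insert f (F.erase e)) →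
      ∃ F' ⊆ A, F'.card ≤ k ∧ CutConnected J lam (A \ F') ∧ ∑ i ∈ F, w i ≤ ∑ i ∈ F', w i ∧
      ∃ f ∈ F', f ∈ deletable J lam A ∧ rank J lam w A f < N := by
    intro f hf e he hc
    have hfF : f ∉ F.erase e := fun h =>
      Finset.disjoint_left.1 hFL (Finset.mem_of_mem_erase h) hf
    refine ⟨insert f (F.erase e), Finset.insert_subset (hLA hf) ((Finset.erase_subset _ _).trans
        hF),
      ?_, hc, ?_, f, Finset.mem_insert_self _ _, hLmem f hf⟩
    · rw [Finset.card_insert_of_notMem hfF, Finset.card_erase_of_mem he]; omega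
    · rw [Finset.sum_insert hfF, ← Finset.add_sum_erase _ _ he]
      exact add_le_add (hle e he f hf) le_rfl
  rcases exists_exchange hJ hlam hF hAF hLA hFL (fun f hf => (Finset.mem_filter.1 (hLmem f hf).1).2)
    hLne hLcard' with ⟨f, hf, h⟩ | ⟨f, hf, e, he, h⟩ | ⟨S, hS, hScard, h⟩
  -- An addition might exceed the budget k, but an edge that can be added can also replace any edge
  -- of F, since fewer deletions preserve connectivity.
  · exact hswap f hf f₀ hf₀ (h.mono (Finset.sdiff_subset_sdiff subset_rfl
      (Finset.insert_subset_insert _ (Finset.erase_subset _ _))))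
  · exact hswap f hf e he h
  -- Each edge of S weighs at least as much as the heaviest edge of F, and S has as many edges as F.
  · obtain ⟨x, hx, hmax⟩ := F.exists_max_image w ⟨f₀, hf₀⟩
    obtain ⟨f, hf⟩ : S.Nonempty := Finset.card_pos.1 (by omega)
    refine ⟨S, hS.trans hLA, by omega, h, ?_, f, hf, hLmem f (hS hf)⟩
    calc ∑ i ∈ F, w i ≤ F.card • w x := Finset.sum_le_card_nsmul _ _ _ hmax
      _ = S.card • w x := by rw [hScard]
      _ ≤ ∑ i ∈ S, w i := Finset.card_nsmul_le_sum _ _ _ fun y hy => hle x hx y (hS hy)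

/-- Removing `k` edges of ranks below `N` one by one reaches the maximum weight. -/
theorem exists_run_weight [Fintype V] (hJ : IsEdgeSystem J) (hlam : 0 < lam) (hw : ∀ i, 0 ≤ w i)
    {N k : ℕ} : ∀ {A F : Finset ι}, CutConnected J lam A → F ⊆ A → F.card ≤ k →
    lam * (k * (4 * k)) ≤ N → CutConnected J lam (A \ F) → ∃ c : ℕ → ℕ, (∀ r < k, c r < N) ∧
      ∑ i ∈ F, w i ≤ ∑ i ∈ A \ run J lam w A c k, w i := by
  induction k with
  | zero =>
    intro A F hA hF hk hN hAF
    obtain rfl : F = ∅ := Finset.card_eq_zero.1 (by omega)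
    exact ⟨fun _ => 0, by simp, by simp [run]⟩
  | succ k ih =>
    intro A F hA hF hk hN hAF
    have hNpos : 0 < N := lt_of_lt_of_le (by positivity) hN
    have hN' : lam * (k * (4 * k)) ≤ N := le_trans (by gcongr <;> omega) hN
    rcases F.eq_empty_or_nonempty with rfl | hne
    -- Once F is used up, the remaining steps may delete anything, because the weights are
    -- nonnegative.
    · exact ⟨fun _ => 0, fun _ _ => hNpos, by
        rw [Finset.sum_empty]; exact Finset.sum_nonneg fun i _ => hw i⟩
    obtain ⟨F', hF', hk', hAF', hle, f, hf, hfdel, hfN⟩ :=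
      exists_small_rank hJ hlam hF hne hk hN hAF
    -- After the deletion of f, the rest of F' is admissible with one step less, and N remains large
    -- enough for the smaller budget.
    have hrest : (A \ {f}) \ F'.erase f = A \ F' := by
      ext x
      simp only [Finset.mem_sdiff, Finset.mem_singleton, Finset.mem_erase]
      by_cases hx : x = f
      · simp [hx, hf]
      · simp [hx]
    obtain ⟨c, hc, hcw⟩ := ih (A := A \ {f}) (F := F'.erase f) (Finset.mem_filter.1 hfdel).2
      (fun x hx => Finset.mem_sdiff.2 ⟨hF' (Finset.mem_of_mem_erase hx),
        fun h => Finset.ne_of_mem_erase hx (Finset.mem_singleton.1 h)⟩)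
      (by rw [Finset.card_erase_of_mem hf]; omega) hN' (by rwa [hrest])
    refine ⟨fun r => Nat.casesOn r (rank J lam w A f) c, ?_, ?_⟩
    · rintro (_ | r) hr
      · exact hfN
      · exact hc r (by omega)
    · refine hle.trans ?_
      rw [run_succ']
      change _ ≤ ∑ i ∈ A \ run J lam w (next J lam w A (rank J lam w A f)) c k, w i
      rw [next_eq_sdiff hfdel]
      have hsub := run_subset (J := J) (lam := lam) (w := w) (A \ {f}) c k
      have hfA : f ∈ A := hF' hf
      have hins : A \ run J lam w (A \ {f}) c k =
          insert f ((A \ {f}) \ run J lam w (A \ {f}) c k) := by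
        ext x
        simp only [Finset.mem_sdiff, Finset.mem_singleton, Finset.mem_insert]
        by_cases hx : x = f
        · subst hx
          have : x ∉ run J lam w (A \ {x}) c k := fun h =>
            (Finset.mem_sdiff.1 (hsub h)).2 (Finset.mem_singleton_self x)
          simp [hfA, this]
        · simp [hx]
      rw [hins, Finset.sum_insert (by simp), ← Finset.add_sum_erase _ _ hf]
      exact add_le_add le_rfl hcw

end Search

/-! ## Total correctness with running times -/

/-- The arrays of natural numbers that a program may change. -/
def Program.writesNat : Program → List ℕ
  | .skip => []
  | .setNat a _ _ => [a]
  | .setReal _ _ _ => []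
  | .seq P Q => P.writesNat ++ Q.writesNat
  | .ite _ P Q => P.writesNat ++ Q.writesNat
  | .loop _ P => P.writesNat

/-- The arrays of reals that a program may change. -/
def Program.writesReal : Program → List ℕ
  | .skip => []
  | .setNat _ _ _ => []
  | .setReal a _ _ => [a]
  | .seq P Q => P.writesReal ++ Q.writesReal
  | .ite _ P Q => P.writesReal ++ Q.writesReal
  | .loop _ P => P.writesReal

@[simp] theorem storeNat_nat_self (σ : Memory) (a i x : ℕ) :
    (σ.storeNat a i x).nat a = Function.update (σ.nat a) i x := by
  simp [Memory.storeNat]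

theorem storeNat_nat_of_ne (σ : Memory) {a b : ℕ} (h : b ≠ a) (i x : ℕ) :
    (σ.storeNat a i x).nat b = σ.nat b := by
  simp [Memory.storeNat, h]

@[simp] theorem storeNat_real (σ : Memory) (a i x : ℕ) : (σ.storeNat a i x).real = σ.real := rfl

@[simp] theorem storeReal_nat (σ : Memory) (a i : ℕ) (x : ℝ) :
    (σ.storeReal a i x).nat = σ.nat := rfl

@[simp] theorem storeReal_real_self (σ : Memory) (a i : ℕ) (x : ℝ) :
    (σ.storeReal a i x).real a = Function.update (σ.real a) i x := by
  simp [Memory.storeReal]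

theorem storeReal_real_of_ne (σ : Memory) {a b : ℕ} (h : b ≠ a) (i : ℕ) (x : ℝ) :
    (σ.storeReal a i x).real b = σ.real b := by
  simp [Memory.storeReal, h]

/-- `σ'` agrees with `σ` on the arrays that `P` does not change. -/
structure Frame (P : Program) (σ σ' : Memory) : Prop where
  nat : ∀ a, a ∉ P.writesNat → σ'.nat a = σ.nat a
  real : ∀ a, a ∉ P.writesReal → σ'.real a = σ.real a

theorem Frame.refl (P : Program) (σ : Memory) : Frame P σ σ := ⟨fun _ _ => rfl, fun _ _ => rfl⟩

theorem Frame.trans {P : Program} {σ σ₁ σ₂ : Memory} (h : Frame P σ σ₁) (h' : Frame P σ₁ σ₂) :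
    Frame P σ σ₂ :=
  ⟨fun a ha => (h'.nat a ha).trans (h.nat a ha), fun a ha => (h'.real a ha).trans (h.real a ha)⟩

theorem Frame.mono {P Q : Program} {σ σ' : Memory} (h : Frame P σ σ')
    (hn : ∀ a ∈ P.writesNat, a ∈ Q.writesNat) (hr : ∀ a ∈ P.writesReal, a ∈ Q.writesReal) :
    Frame Q σ σ' :=
  ⟨fun a ha => h.nat a fun h' => ha (hn a h'), fun a ha => h.real a fun h' => ha (hr a h')⟩

/-- `σ'` agrees with `σ` on the arrays of natural numbers in `l`. -/
def Agree (l : List ℕ) (σ σ' : Memory) : Prop := ∀ a ∈ l, σ'.nat a = σ.nat a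

theorem Frame.agree {P : Program} {σ σ' : Memory} (h : Frame P σ σ') {l : List ℕ}
    (hl : ∀ a ∈ l, a ∉ P.writesNat) : Agree l σ σ' := fun a ha => h.nat a (hl a ha)

theorem agree_storeNat (σ : Memory) {l : List ℕ} {b : ℕ} (hb : b ∉ l) (i x : ℕ) :
    Agree l σ (σ.storeNat b i x) :=
  fun a ha => storeNat_nat_of_ne σ (fun h : a = b => hb (h ▸ ha)) i x

theorem Agree.trans {l : List ℕ} {σ σ₁ σ₂ : Memory} (h : Agree l σ σ₁) (h' : Agree l σ₁ σ₂) :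
    Agree l σ σ₂ := fun a ha => (h' a ha).trans (h a ha)

theorem Agree.symm {l : List ℕ} {σ σ₁ : Memory} (h : Agree l σ σ₁) : Agree l σ₁ σ :=
  fun a ha => (h a ha).symm

/-- Which arrays a program can touch is read off its syntax. Facts about all other arrays then
survive the program by a decidable check. -/
theorem Runs.frame {P : Program} {σ σ' : Memory} {t : ℕ} (h : Runs P σ t σ') : Frame P σ σ' := by
  induction h with
  | skip σ => exact Frame.refl _ _
  | setNat σ a i x =>
    refine ⟨fun b hb => storeNat_nat_of_ne _ (by simpa [Program.writesNat] using hb) _ _,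
      fun b _ => rfl⟩
  | setReal σ a i x =>
    refine ⟨fun b _ => rfl,
      fun b hb => storeReal_real_of_ne _ (by simpa [Program.writesReal] using hb) _ _⟩
  | seq _ _ ih₁ ih₂ =>
    exact (ih₁.mono (by simp +contextual [Program.writesNat])
      (by simp +contextual [Program.writesReal])).trans
      (ih₂.mono (by simp +contextual [Program.writesNat]) (by simp +contextual
          [Program.writesReal]))
  | iteTrue _ _ ih =>
    exact ih.mono (by simp +contextual [Program.writesNat]) (by simp +contextual
        [Program.writesReal])
  | iteFalse _ _ ih =>
    exact ih.mono (by simp +contextual [Program.writesNat]) (by simp +contextual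
        [Program.writesReal])
  | loopTrue _ _ _ ih₁ ih₂ =>
    exact (ih₁.mono (by simp [Program.writesNat]) (by simp [Program.writesReal])).trans ih₂
  | loopFalse _ => exact Frame.refl _ _

/-- Started with memory `σ`, the program `P` halts after at most `T` steps with a memory that
satisfies `Q`. -/
def Halts (P : Program) (σ : Memory) (T : ℕ) (Q : Memory → Prop) : Prop :=
  ∃ t σ', Runs P σ t σ' ∧ t ≤ T ∧ Q σ'

theorem Halts.mono {P : Program} {σ : Memory} {T T' : ℕ} {Q Q' : Memory → Prop}
    (h : Halts P σ T Q) (hT : T ≤ T') (hQ : ∀ σ', Frame P σ σ' → Q σ' → Q' σ') :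
    Halts P σ T' Q' := by
  obtain ⟨t, σ', h1, h2, h3⟩ := h
  exact ⟨t, σ', h1, h2.trans hT, hQ σ' h1.frame h3⟩

theorem Halts.seq {P R : Program} {σ : Memory} {T₁ T₂ : ℕ} {Q Q' : Memory → Prop}
    (h : Halts P σ T₁ Q) (h' : ∀ σ', Frame P σ σ' → Q σ' → Halts R σ' T₂ Q') :
    Halts (.seq P R) σ (T₁ + T₂) Q' := by
  obtain ⟨t, σ₁, h1, h2, h3⟩ := h
  obtain ⟨t', σ₂, h4, h5, h6⟩ := h' σ₁ h1.frame h3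
  exact ⟨t + t', σ₂, .seq h1 h4, by omega, h6⟩

theorem Halts.setNat {a : ℕ} {i x : NatExpr} {σ : Memory} {Q : Memory → Prop}
    (h : Q (σ.storeNat a (i.eval σ) (x.eval σ))) :
    Halts (.setNat a i x) σ (i.cost + x.cost + 1) Q := ⟨_, _, .setNat .., le_rfl, h⟩

theorem Halts.ite {b : Test} {P R : Program} {σ : Memory} {T : ℕ} {Q : Memory → Prop}
    (h : b.Holds σ → Halts P σ T Q) (h' : ¬ b.Holds σ → Halts R σ T Q) :
    Halts (.ite b P R) σ (b.cost + T) Q := by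
  by_cases hb : b.Holds σ
  · obtain ⟨t, σ', h1, h2, h3⟩ := h hb
    exact ⟨_, σ', .iteTrue hb h1, by omega, h3⟩
  · obtain ⟨t, σ', h1, h2, h3⟩ := h' hb
    exact ⟨_, σ', .iteFalse hb h1, by omega, h3⟩

theorem Halts.skip {σ : Memory} {T : ℕ} {Q : Memory → Prop} (hT : 1 ≤ T) (h : Q σ) :
    Halts .skip σ T Q := ⟨1, σ, .skip σ, hT, h⟩

theorem Halts.setNat_seq {a : ℕ} {i x : NatExpr} {R : Program} {σ : Memory} {T : ℕ}
    {Q : Memory → Prop} (h : Halts R (σ.storeNat a (i.eval σ) (x.eval σ)) T Q) :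
    Halts (.seq (.setNat a i x) R) σ (i.cost + x.cost + 1 + T) Q :=
  Halts.seq (Halts.setNat (Q := fun σ' => σ' = _) rfl) fun _ _ h' => h' ▸ h

/-- Loops that decrease the measure `μ` in each round. -/
theorem Halts.loop {b : Test} {P : Program} {T : ℕ} (Inv : Memory → Prop) (μ : Memory → ℕ)
    {σ : Memory} (h0 : Inv σ)
    (hstep : ∀ σ', Frame (.loop b P) σ σ' → Inv σ' → b.Holds σ' →
      Halts P σ' T fun σ'' => Inv σ'' ∧ μ σ'' < μ σ') :
    Halts (.loop b P) σ (μ σ * (T + b.cost) + b.cost) fun σ' => Inv σ' ∧ ¬ b.Holds σ' := by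
  suffices h : ∀ m σ', μ σ' ≤ m → Frame (.loop b P) σ σ' → Inv σ' →
      Halts (.loop b P) σ' (m * (T + b.cost) + b.cost) fun σ'' => Inv σ'' ∧ ¬ b.Holds σ'' from
    h _ σ le_rfl (Frame.refl _ _) h0
  intro m
  induction m with
  | zero =>
    intro σ' hm hF hI
    by_cases hb : b.Holds σ'
    · obtain ⟨t, σ'', -, -, -, h⟩ := hstep σ' hF hI hb
      omega
    · exact ⟨_, σ', .loopFalse hb, by omega, hI, hb⟩
  | succ m ih =>
    intro σ' hm hF hI
    by_cases hb : b.Holds σ'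
    · obtain ⟨t, σ'', h1, h2, h3, h4⟩ := hstep σ' hF hI hb
      obtain ⟨t', σ₃, h5, h6, h7⟩ := ih σ'' (by omega)
        (hF.trans (h1.frame.mono (by simp [Program.writesNat]) (by simp [Program.writesReal]))) h3
      refine ⟨_, σ₃, .loopTrue hb h1 h5, ?_, h7⟩
      have : (m + 1) * (T + b.cost) = m * (T + b.cost) + (T + b.cost) := by ring
      omega
    · exact ⟨_, σ', .loopFalse hb, by omega, hI, hb⟩

/-! ### Variables and counting loops -/

/-- The variable `v`: cell `0` of the array `v` of natural numbers. -/
abbrev rd (v : ℕ) : NatExpr := .read v (.lit 0)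

/-- Cell number `i` of the array `a`, where `i` is a variable. -/
abbrev rdAt (a i : ℕ) : NatExpr := .read a (rd i)

/-- Assignment to a variable. -/
abbrev setVar (v : ℕ) (x : NatExpr) : Program := .setNat v (.lit 0) x

/-- The test for equality. -/
abbrev Test.eq (x y : NatExpr) : Test := .and (.natLe x y) (.natLe y x)

/-- The test whether a flag is set. -/
abbrev Test.flag (x : NatExpr) : Test := .natLe (.lit 1) x

/-- The variable `i` runs from `0` up to, but not including, the value of the variable `b`. -/
def forLoop (i b : ℕ) (P : Program) : Program :=
  .seq (setVar i (.lit 0))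
    (.loop (.not (.natLe (rd b) (rd i))) (.seq P (setVar i (.add (rd i) (.lit 1)))))

/-- The invariant is asserted right after the counter has been stored, which accounts for `storeNat`
in the hypotheses. Besides the body, each round costs 6 steps for the test and 6 for the increment;
the initial assignment and the last test cost 3 + 6. -/
theorem Halts.forLoop {i b : ℕ} {P : Program} {T n : ℕ} (Inv : ℕ → Memory → Prop) {σ : Memory}
    (hn : σ.nat b 0 = n) (hib : b ≠ i) (hiP : i ∉ P.writesNat) (hbP : b ∉ P.writesNat)
    (h0 : Inv 0 (σ.storeNat i 0 0))
    (hstep : ∀ j < n, ∀ σ', Frame (forLoop i b P) σ σ' → Inv j σ' → σ'.nat i 0 = j →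
      Halts P σ' T fun σ'' => Inv (j + 1) (σ''.storeNat i 0 (j + 1))) :
    Halts (forLoop i b P) σ (n * (T + 12) + 9) (Inv n) := by
  have hmem : ∀ a, a ∉ (WeightedECS.forLoop i b P).writesNat → a ≠ i ∧ a ∉ P.writesNat := by
    intro a ha
    simp only [WeightedECS.forLoop, Program.writesNat, List.mem_append, List.mem_singleton,
      not_or] at ha
    exact ⟨ha.1, ha.2.1⟩
  have key := Halts.loop (b := .not (.natLe (rd b) (rd i)))
    (P := .seq P (setVar i (.add (rd i) (.lit 1)))) (T := T + 6) (σ := σ.storeNat i 0 0)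
    (fun σ' => σ'.nat b 0 = n ∧ σ'.nat i 0 ≤ n ∧ Inv (σ'.nat i 0) σ')
    (fun σ' => n - σ'.nat i 0) ⟨by rw [storeNat_nat_of_ne _ hib, hn], by simp, by simpa using h0⟩ ?_
  · obtain ⟨t, σ', h1, h2, ⟨h3, h4, h5⟩, h6⟩ := key
    simp only [storeNat_nat_self, Function.update_self, Nat.sub_zero] at h2
    simp only [Test.Holds, NatExpr.eval, not_not] at h6
    have h7 : σ'.nat i 0 = n := by omega
    rw [h7] at h5
    refine ⟨_, σ', .seq (.setNat ..) h1, ?_, h5⟩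
    simp only [NatExpr.cost, Test.cost] at h2 ⊢
    have : n * (T + 6 + (1 + 1 + (1 + 1) + 1 + 1)) = n * (T + 12) := by ring
    omega
  · rintro σ' hF ⟨h1, h2, h3⟩ h4
    simp only [Test.Holds, NatExpr.eval, not_le] at h4
    have hF' : Frame (WeightedECS.forLoop i b P) σ σ' := by
      refine ⟨fun a ha => ?_, fun a ha => ?_⟩
      · rw [hF.nat a, storeNat_nat_of_ne _ (hmem a ha).1]
        have := hmem a ha
        simp [Program.writesNat, this]
      · refine hF.real a ?_
        simpa [WeightedECS.forLoop, Program.writesReal] using ha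
    refine (Halts.seq (hstep _ (by omega) σ' hF' h3 rfl) (T₂ := 6)
      (Q' := fun σ'' => (σ''.nat b 0 = n ∧ σ''.nat i 0 ≤ n ∧ Inv (σ''.nat i 0) σ'') ∧
        n - σ''.nat i 0 < n - σ'.nat i 0) fun σ'' hF'' h5 => ?_).mono le_rfl fun _ _ h => h
    refine Halts.mono (Halts.setNat (Q := fun τ => τ = σ''.storeNat i 0 (σ'.nat i 0 + 1)) ?_)
      (by simp [NatExpr.cost]) ?_
    · simp only [NatExpr.eval, hF''.nat i hiP]
    · rintro τ - rfl
      simp only [storeNat_nat_self, Function.update_self]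
      refine ⟨⟨?_, by omega, h5⟩, by omega⟩
      rw [storeNat_nat_of_ne _ hib, hF''.nat b hbP, h1]

/-! ### Loop-free programs -/

/-- The weakest precondition of a program without loops. -/
def Program.wp : Program → Memory → (Memory → Prop) → Prop
  | .skip, σ, Q => Q σ
  | .setNat a i x, σ, Q => Q (σ.storeNat a (i.eval σ) (x.eval σ))
  | .setReal a i x, σ, Q => Q (σ.storeReal a (i.eval σ) (x.eval σ))
  | .seq P R, σ, Q => P.wp σ fun σ' => R.wp σ' Q
  | .ite b P R, σ, Q => (b.Holds σ → P.wp σ Q) ∧ (¬ b.Holds σ → R.wp σ Q)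
  | .loop _ _, _, _ => False

/-- A bound on the running time of a program without loops. -/
def Program.bound : Program → ℕ
  | .skip => 1
  | .setNat _ i x => i.cost + x.cost + 1
  | .setReal _ i x => i.cost + x.cost + 1
  | .seq P Q => P.bound + Q.bound
  | .ite b P Q => b.cost + max P.bound Q.bound
  | .loop _ _ => 0

/-- Both the postcondition and the time bound of loop-free code can be computed. A loop has a false
precondition, so its meaningless bound 0 does no harm. -/
theorem Halts.of_wp {P : Program} {σ : Memory} {T : ℕ} {Q : Memory → Prop} (h : P.wp σ Q)
    (hT : P.bound ≤ T) : Halts P σ T Q := by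
  suffices h : Halts P σ P.bound Q from h.mono hT fun _ _ h => h
  clear hT
  induction P generalizing σ Q with
  | skip => exact Halts.skip le_rfl h
  | setNat a i x => exact Halts.setNat h
  | setReal a i x => exact ⟨_, _, .setReal .., le_rfl, h⟩
  | seq P R ihP ihR => exact Halts.seq (ihP h) fun σ' _ h' => ihR h'
  | ite b P R ihP ihR =>
    exact Halts.ite (fun hb => (ihP (h.1 hb)).mono (le_max_left _ _) fun _ _ h => h)
      fun hb => (ihR (h.2 hb)).mono (le_max_right _ _) fun _ _ h => h
  | loop b P => exact h.elim

/-! ## Search trees in residual graphs -/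

section Tree

/-- The number of visited vertices. -/
noncomputable def countVis (n : ℕ) (vis : ℕ → ℕ) : ℕ :=
  ((Finset.range n).filter fun v => vis v ≠ 0).card

/-- The visited vertices form a search tree with root `s` in the residual graph of `φ`: `par v` is
the arc through which `v` was reached, and `lev` increases along the tree. -/
structure IsTree (n : ℕ) (T H : ℕ → ℕ) (D φ : Finset ℕ) (s : ℕ) (vis par lev : ℕ → ℕ) : Prop where
  root : vis s ≠ 0
  lev_lt : ∀ v < n, vis v ≠ 0 → lev v < countVis n vis
  parent : ∀ v < n, vis v ≠ 0 → v ≠ s →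
    ∃ x < n, Residual T H D φ (par v) x v ∧ vis x ≠ 0 ∧ lev x < lev v

variable {n : ℕ} {T H : ℕ → ℕ} {D φ : Finset ℕ} {s : ℕ} {vis par lev : ℕ → ℕ}

theorem countVis_le : countVis n vis ≤ n :=
  (Finset.card_filter_le _ _).trans (Finset.card_range n).le

theorem countVis_update {y : ℕ} (hy : vis y = 0) (hyn : y < n) :
    countVis n (Function.update vis y 1) = countVis n vis + 1 := by
  unfold countVis
  rw [← Finset.card_insert_of_notMem (a := y) (s := (Finset.range n).filter fun v => vis v ≠ 0)
    (by simp [hy])]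
  congr 1
  ext v
  by_cases hv : v = y
  · subst hv; simp [hyn]
  · simp [hv]

/-- A tree can be extended along a residual arc. -/
theorem IsTree.extend (h : IsTree n T H D φ s vis par lev) {a x y : ℕ}
    (hr : Residual T H D φ a x y) (hxn : x < n) (hx : vis x ≠ 0) (hyn : y < n) (hy : vis y = 0) :
    IsTree n T H D φ s (Function.update vis y 1) (Function.update par y a)
      (Function.update lev y (countVis n vis)) := by
  -- The level of the new vertex is the number of vertices visited before it, which exceeds all
  -- earlier levels by `lev_lt`.
  have hxy : x ≠ y := fun h => hx (h ▸ hy)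
  refine ⟨?_, ?_, ?_⟩
  · rw [Function.update_of_ne (fun h' : s = y => h.root (h' ▸ hy))]; exact h.root
  · intro v hvn hv
    rw [countVis_update hy hyn]
    by_cases hvy : v = y
    · rw [hvy, Function.update_self]; omega
    · rw [Function.update_of_ne hvy] at hv ⊢
      have := h.lev_lt v hvn hv
      omega
  · intro v hvn hv hvs
    by_cases hvy : v = y
    · subst hvy
      refine ⟨x, hxn, by rwa [Function.update_self], by rwa [Function.update_of_ne hxy], ?_⟩
      rw [Function.update_of_ne hxy, Function.update_self]
      exact h.lev_lt x hxn hx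
    · rw [Function.update_of_ne hvy] at hv ⊢
      obtain ⟨z, hzn, hz, hzv, hzl⟩ := h.parent v hvn hv hvs
      have hzy : z ≠ y := fun h => hzv (h ▸ hy)
      exact ⟨z, hzn, hz, by rwa [Function.update_of_ne hzy], by
        rwa [Function.update_of_ne hzy, Function.update_of_ne hvy]⟩

/-- The state of the augmentation of `φ` along the tree path from `s` to `t`, when the part of the
path from `v` to `t` has been treated. -/
structure IsPartialAugment (n : ℕ) (T H : ℕ → ℕ) (D φ : Finset ℕ) (s t : ℕ) (vis par lev : ℕ → ℕ)
    (φ' : Finset ℕ) (v : ℕ) : Prop where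
  lt : v < n
  reached : vis v ≠ 0
  subset : φ' ⊆ D
  net : ∀ X, netFlow T H φ' X = netFlow T H φ X + ind X v - ind X t
  agree : ∀ u < n, vis u ≠ 0 → u ≠ s → lev u ≤ lev v → (par u ∈ φ' ↔ par u ∈ φ)

/-- So far only parent arcs of vertices at higher levels have been switched. The parent arc of v
thus has the same status as in φ, and its current flag tells which end is the parent. The decreasing
level ensures termination. -/
theorem IsPartialAugment.step (h : IsTree n T H D φ s vis par lev) {t v : ℕ} {φ' : Finset ℕ}
    (ha : IsPartialAugment n T H D φ s t vis par lev φ' v) (hvs : v ≠ s) {y : ℕ}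
    (hy : y = if par v ∈ φ' then H (par v) else T (par v)) :
    IsPartialAugment n T H D φ s t vis par lev (flip φ' (par v)) y ∧ lev y < lev v := by
  obtain ⟨x, hxn, hx, hxv, hxl⟩ := h.parent v ha.lt ha.reached hvs
  have hag := ha.agree v ha.lt ha.reached hvs le_rfl
  have hx' : Residual T H D φ' (par v) x v := by unfold Residual at hx ⊢; rwa [hag]
  have hyx : y = x := by
    rcases hx' with h' | h'
    · rw [hy, if_neg h'.2.1, h'.2.2.1]
    · rw [hy, if_pos h'.1, h'.2.1]
  rw [hyx]
  refine ⟨⟨hxn, hxv, flip_subset hx' ha.subset, fun X => ?_, fun u hun hu hus hul => ?_⟩, hxl⟩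
  · rw [netFlow_flip hx', ha.net]; ring
  -- Membership in φ determines the vertex that a residual arc leads to, so different tree vertices
  -- have different parent arcs.
  · have hne : par u ≠ par v := by
      intro hpar
      obtain ⟨z, -, hz, -, -⟩ := h.parent u hun hu hus
      rw [hpar] at hz
      have huv : u = v := by
        rcases hz with hz | hz <;> rcases hx with hx | hx
        · exact hz.2.2.2.symm.trans hx.2.2.2
        · exact absurd hx.1 hz.2.1
        · exact absurd hz.1 hx.2.1
        · exact hz.2.2.symm.trans hx.2.2
      subst huv
      omega
    rw [mem_flip, ← ha.agree u hun hu hus (hul.trans hxl.le)]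
    simp [hne]

end Tree

/-! ## The program that tests the connectivity -/

local notation "vN" => (5 : ℕ)
local notation "vArcs" => (7 : ℕ)
local notation "vLam" => (8 : ℕ)
local notation "aTail" => (11 : ℕ)
local notation "aHead" => (12 : ℕ)
local notation "aAlive" => (13 : ℕ)
local notation "aFlow" => (16 : ℕ)
local notation "aVis" => (17 : ℕ)
local notation "aPar" => (18 : ℕ)
local notation "vS" => (20 : ℕ)
local notation "vT" => (21 : ℕ)
local notation "vRound" => (22 : ℕ)
local notation "vArc" => (23 : ℕ)
local notation "vChanged" => (24 : ℕ)
local notation "vOk" => (25 : ℕ)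
local notation "vCur" => (26 : ℕ)
local notation "vTmp" => (27 : ℕ)

/-- Extend the search tree along the arc `vArc`, if possible. -/
def relax : Program :=
  .ite (.flag (rdAt aAlive vArc))
    (.ite (.flag (rdAt aFlow vArc))
      (.ite (.and (.flag (.read aVis (rdAt aHead vArc))) (.natLe (.read aVis (rdAt aTail vArc))
          (.lit 0)))
        (.seq (.setNat aVis (rdAt aTail vArc) (.lit 1))
          (.seq (.setNat aPar (rdAt aTail vArc) (rd vArc)) (setVar vChanged (.lit 1))))
        .skip)
      (.ite (.and (.flag (.read aVis (rdAt aTail vArc))) (.natLe (.read aVis (rdAt aHead vArc))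
          (.lit 0)))
        (.seq (.setNat aVis (rdAt aHead vArc) (.lit 1))
          (.seq (.setNat aPar (rdAt aHead vArc) (rd vArc)) (setVar vChanged (.lit 1))))
        .skip))
    .skip

/-- One round of the search. -/
def relaxAll : Program :=
  .seq (setVar vChanged (.lit 0)) (forLoop vArc vArcs relax)

/-- Search from `vS` in the residual graph. -/
def search : Program :=
  .seq (forLoop vArc vN (.setNat aVis (rd vArc) (.lit 0)))
    (.seq (.setNat aVis (rd vS) (.lit 1))
      (.seq (setVar vChanged (.lit 1)) (.loop (.flag (rd vChanged)) relaxAll)))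

/-- Augmentation of the flow along one arc. -/
def augmentStep : Program :=
  .seq (setVar vTmp (rdAt aPar vCur))
    (.ite (.flag (rdAt aFlow vTmp))
      (.seq (.setNat aFlow (rd vTmp) (.lit 0)) (setVar vCur (rdAt aHead vTmp)))
      (.seq (.setNat aFlow (rd vTmp) (.lit 1)) (setVar vCur (rdAt aTail vTmp))))

/-- Augmentation of the flow along the tree path from `vS` to `vT`. -/
def augment : Program :=
  .seq (setVar vCur (rd vT)) (.loop (.not (.eq (rd vCur) (rd vS))) augmentStep)

/-- Increase the flow by one unit, or clear `vOk`. -/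
def increaseFlow : Program :=
  .ite (.flag (rd vOk))
    (.seq search (.ite (.flag (rdAt aVis vT)) augment (setVar vOk (.lit 0))))
    .skip

/-- Clear `vOk` if there is no flow of value `vLam` from `vS` to `vT`. -/
def testPair : Program :=
  .ite (.and (.flag (rd vOk)) (.not (.eq (rd vS) (rd vT))))
    (.seq (forLoop vArc vArcs (.setNat aFlow (rd vArc) (.lit 0)))
      (forLoop vRound vLam increaseFlow))
    .skip

/-- Set `vOk` if and only if every cut has at least `vLam` arcs. -/
def testConnected : Program :=
  .seq (setVar vOk (.lit 1)) (forLoop vS vN (forLoop vT vN testPair))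

/-- The arcs below `M` whose flag in `f` is set. -/
noncomputable def flagged (M : ℕ) (f : ℕ → ℕ) : Finset ℕ := (Finset.range M).filter fun j => f j ≠ 0

theorem mem_flagged {M : ℕ} {f : ℕ → ℕ} {j : ℕ} : j ∈ flagged M f ↔ j < M ∧ f j ≠ 0 := by
  simp [flagged]

theorem flagged_flip {M j x : ℕ} {f : ℕ → ℕ} (hj : j < M) (hx : x ≠ 0 ↔ f j = 0) :
    flagged M (Function.update f j x) = flip (flagged M f) j := by
  ext i
  rw [mem_flip, mem_flagged, mem_flagged, mem_flagged]
  by_cases hi : i = j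
  · subst hi; simp [hj, hx]
  · simp [hi]

/-- The memory holds a digraph with `n` vertices and `M` arcs. -/
structure HoldsArcs (n M lam : ℕ) (σ : Memory) : Prop where
  n_eq : σ.nat vN 0 = n
  arcs_eq : σ.nat vArcs 0 = M
  lam_eq : σ.nat vLam 0 = lam
  tail_lt : ∀ j < M, σ.nat aTail j < n
  head_lt : ∀ j < M, σ.nat aHead j < n

theorem HoldsArcs.congr {n M lam : ℕ} {σ σ' : Memory} (h : HoldsArcs n M lam σ)
    (hA : Agree [vN, vArcs, vLam, aTail, aHead] σ σ') : HoldsArcs n M lam σ' := by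
  have h1 := hA vN (by simp)
  have h2 := hA vArcs (by simp)
  have h3 := hA vLam (by simp)
  have h4 := hA aTail (by simp)
  have h5 := hA aHead (by simp)
  exact ⟨by rw [h1, h.n_eq], by rw [h2, h.arcs_eq], by rw [h3, h.lam_eq],
    by rw [h4]; exact h.tail_lt, by rw [h5]; exact h.head_lt⟩

/-! ### Correctness of the connectivity test -/

section Test

variable {n M lam : ℕ} {σ : Memory}

/-- The alive arcs. -/
noncomputable abbrev aliveArcs (M : ℕ) (σ : Memory) : Finset ℕ := flagged M (σ.nat aAlive)

/-- The arcs that carry flow. -/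
noncomputable abbrev flowArcs (M : ℕ) (σ : Memory) : Finset ℕ := flagged M (σ.nat aFlow)

/-- The visited vertices form a search tree. -/
def HoldsTree (n M s : ℕ) (σ : Memory) : Prop :=
  ∃ lev, IsTree n (σ.nat aTail) (σ.nat aHead) (aliveArcs M σ) (flowArcs M σ) s (σ.nat aVis)
    (σ.nat aPar) lev

/-- No residual arc with number less than `j` leaves the visited set. -/
def ClosedBelow (M j : ℕ) (σ : Memory) : Prop :=
  ∀ a < j, ∀ x y, Residual (σ.nat aTail) (σ.nat aHead) (aliveArcs M σ) (flowArcs M σ) a x y →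
    σ.nat aVis x ≠ 0 → σ.nat aVis y ≠ 0

theorem HoldsTree.congr {s : ℕ} {σ' : Memory} (h : HoldsTree n M s σ)
    (hA : Agree [aTail, aHead, aAlive, aFlow, aVis, aPar] σ σ') : HoldsTree n M s σ' := by
  rw [HoldsTree, aliveArcs, flowArcs, hA aTail (by simp), hA aHead (by simp), hA aAlive (by simp),
    hA aFlow (by simp), hA aVis (by simp), hA aPar (by simp)]
  exact h

/-- As the flow uses alive arcs only, skipping a dead arc misses no residual arc. Either arc j does
not lead out of the visited set and nothing changes, or exactly one vertex joins the tree. -/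
theorem relax_spec (h : HoldsArcs n M lam σ) {s j : ℕ} (hj : j < M) (hjσ : σ.nat vArc 0 = j)
    (hsub : flowArcs M σ ⊆ aliveArcs M σ) (htree : HoldsTree n M s σ) :
    Halts relax σ 100 fun σ' => HoldsTree n M s σ' ∧
      ((σ'.nat aVis = σ.nat aVis ∧ σ'.nat vChanged 0 = σ.nat vChanged 0 ∧
        ∀ x y, Residual (σ.nat aTail) (σ.nat aHead) (aliveArcs M σ) (flowArcs M σ) j x y →
          σ.nat aVis x ≠ 0 → σ.nat aVis y ≠ 0) ∨
      (σ'.nat vChanged 0 = 1 ∧ countVis n (σ'.nat aVis) = countVis n (σ.nat aVis) + 1)) := by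
  have hT := h.tail_lt j hj
  have hH := h.head_lt j hj
  obtain ⟨lev, htree⟩ := htree
  refine Halts.of_wp ?_ (by decide)
  simp only [relax, Program.wp, Test.Holds, NatExpr.eval, hjσ]
  have hext : ∀ x y, Residual (σ.nat aTail) (σ.nat aHead) (aliveArcs M σ) (flowArcs M σ) j x y →
      x < n → σ.nat aVis x ≠ 0 → y < n → σ.nat aVis y = 0 → ∀ σ' : Memory,
      Agree [aTail, aHead, aAlive, aFlow] σ σ' → σ'.nat aVis = Function.update (σ.nat aVis) y 1 →
      σ'.nat aPar = Function.update (σ.nat aPar) y j → σ'.nat vChanged 0 = 1 → ∀ p : Prop,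
      HoldsTree n M s σ' ∧ (p ∨ (σ'.nat vChanged 0 = 1 ∧
        countVis n (σ'.nat aVis) = countVis n (σ.nat aVis) + 1)) := by
    intro x y hr hxn hx hyn hy σ' hA h5 h6 h7 p
    rw [HoldsTree, aliveArcs, flowArcs, hA aTail (by simp), hA aHead (by simp),
      hA aAlive (by simp), hA aFlow (by simp), h5, h6]
    exact ⟨⟨_, htree.extend hr hxn hx hyn hy⟩, Or.inr ⟨h7, countVis_update hy hyn⟩⟩
  refine ⟨fun ha => ⟨fun hf => ⟨fun hv => ?_, fun hv => ?_⟩, fun hf => ⟨fun hv => ?_,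
      fun hv => ?_⟩⟩,
    fun ha => ?_⟩
  · refine hext (σ.nat aHead j) (σ.nat aTail j) (Or.inr ⟨mem_flagged.2 ⟨hj, by omega⟩, rfl, rfl⟩)
      hH (by omega) hT (by omega) _ ?_ ?_ ?_ ?_ _ <;> simp [Agree, storeNat_nat_of_ne, hjσ]
  · refine ⟨⟨lev, htree⟩, Or.inl ⟨trivial, trivial, ?_⟩⟩
    rintro x y (⟨-, h1, -⟩ | ⟨h1, rfl, rfl⟩) hx
    · exact absurd (mem_flagged.2 ⟨hj, by omega⟩) h1
    · omega
  · refine hext (σ.nat aTail j) (σ.nat aHead j)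
      (Or.inl ⟨mem_flagged.2 ⟨hj, by omega⟩, fun h => hf (by have := (mem_flagged.1 h).2; omega),
        rfl, rfl⟩) hT (by omega) hH (by omega) _ ?_ ?_ ?_ ?_ _ <;>
      simp [Agree, storeNat_nat_of_ne, hjσ]
  · refine ⟨⟨lev, htree⟩, Or.inl ⟨trivial, trivial, ?_⟩⟩
    rintro x y (⟨-, h1, rfl, rfl⟩ | ⟨h1, -⟩) hx
    · omega
    · have := (mem_flagged.1 h1).2
      omega
  · refine ⟨⟨lev, htree⟩, Or.inl ⟨trivial, trivial, ?_⟩⟩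
    have hD : j ∉ aliveArcs M σ := fun h => ha (by have := (mem_flagged.1 h).2; omega)
    rintro x y (h1 | h1)
    · exact absurd h1.1 hD
    · exact absurd (hsub h1.1) hD

/-- In a round without changes the visited set was the same for every arc examined, so the checks of
the single arcs add up to closedness. Any other round visits a new vertex. -/
theorem relaxAll_spec (h : HoldsArcs n M lam σ) {s : ℕ} (hsub : flowArcs M σ ⊆ aliveArcs M σ)
    (htree : HoldsTree n M s σ) :
    Halts relaxAll σ (112 * M + 20) fun σ' => HoldsTree n M s σ' ∧
      ((σ'.nat vChanged 0 = 0 ∧ ClosedBelow M M σ') ∨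
      (σ'.nat vChanged 0 = 1 ∧ countVis n (σ.nat aVis) < countVis n (σ'.nat aVis))) := by
  refine (Halts.seq (Q := fun σ' => σ' = σ.storeNat vChanged 0 0)
    (Q' := fun σ' => HoldsTree n M s σ' ∧
      ((σ'.nat vChanged 0 = 0 ∧ ClosedBelow M M σ') ∨
      (σ'.nat vChanged 0 = 1 ∧ countVis n (σ.nat aVis) < countVis n (σ'.nat aVis))))
    (Halts.setNat rfl) ?_ (T₂ := M * (100 + 12) + 9)).mono (by simp [NatExpr.cost]; omega)
    fun _ _ h => h
  rintro σ' - rfl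
  refine Halts.forLoop (fun j σ' => HoldsTree n M s σ' ∧
    ((σ'.nat vChanged 0 = 0 ∧ σ'.nat aVis = σ.nat aVis ∧ ClosedBelow M j σ') ∨
      (σ'.nat vChanged 0 = 1 ∧ countVis n (σ.nat aVis) < countVis n (σ'.nat aVis))))
    (n := M) (by simp [storeNat_nat_of_ne, h.arcs_eq]) (by decide) (by decide) (by decide) ?_ ?_
    |>.mono le_rfl ?_
  · refine ⟨(htree.congr (agree_storeNat _ (by decide) _ _)).congr
      (agree_storeNat _ (by decide) _ _), Or.inl ⟨?_, ?_, ?_⟩⟩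
    · simp [storeNat_nat_of_ne]
    · simp [storeNat_nat_of_ne]
    · simp [ClosedBelow]
  · rintro j hj τ hF ⟨ht, hinv⟩ hjτ
    have hA : HoldsArcs n M lam τ := (h.congr (agree_storeNat _ (by decide) _ _)).congr
      (hF.agree (by decide))
    have hfa : Agree [aFlow, aAlive] σ τ := (agree_storeNat _ (by decide) _ _).trans
      (hF.agree (by decide))
    refine (relax_spec hA hj hjτ (by
      rwa [flowArcs, aliveArcs, hfa aFlow (by simp), hfa aAlive (by simp)]) ht).mono le_rfl ?_
    rintro ρ hFρ ⟨ht', hρ⟩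
    have h1 : ρ.nat aTail = τ.nat aTail := hFρ.nat _ (by decide)
    have h2 : ρ.nat aHead = τ.nat aHead := hFρ.nat _ (by decide)
    have h3 : ρ.nat aAlive = τ.nat aAlive := hFρ.nat _ (by decide)
    have h4 : ρ.nat aFlow = τ.nat aFlow := hFρ.nat _ (by decide)
    refine ⟨ht'.congr (agree_storeNat _ (by decide) _ _), ?_⟩
    simp only [ClosedBelow, aliveArcs, flowArcs, ne_eq, storeNat_nat_of_ne, Nat.reduceEqDiff,
      not_false_eq_true]
    rcases hinv with ⟨hc, hv, hcl⟩ | ⟨hc, hv⟩ <;> rcases hρ with ⟨hv', hc', hcl'⟩ | ⟨hc', hv'⟩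
    · refine Or.inl ⟨hc'.trans hc, hv'.trans hv, fun a ha x y hr => ?_⟩
      rw [h1, h2, h3, h4] at hr
      rw [hv']
      rcases Nat.lt_succ_iff_lt_or_eq.1 ha with ha | rfl
      · exact hcl a ha x y hr
      · exact hcl' x y hr
    · exact Or.inr ⟨hc', by rw [hv', hv]; omega⟩
    · exact Or.inr ⟨hc'.trans hc, by rw [hv']; exact hv⟩
    · exact Or.inr ⟨hc', by omega⟩
  · rintro τ - ⟨ht, hinv⟩
    exact ⟨ht, hinv.imp (fun h => ⟨h.1, h.2.2⟩) id⟩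

theorem search_spec (h : HoldsArcs n M lam σ) (hsub : flowArcs M σ ⊆ aliveArcs M σ)
    (hs : σ.nat vS 0 < n) :
    Halts search σ ((n + 1) * (112 * M + 60)) fun σ' => HoldsTree n M (σ.nat vS 0) σ' ∧
      ClosedBelow M M σ' := by
  set s := σ.nat vS 0 with hsdef
  have hclear : Halts (forLoop vArc vN (.setNat aVis (rd vArc) (.lit 0))) σ (n * (5 + 12) + 9)
      fun σ' => ∀ v < n, σ'.nat aVis v = 0 := by
    refine Halts.forLoop (fun j σ' => ∀ v < j, σ'.nat aVis v = 0) h.n_eq (by decide) (by decide)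
      (by decide) (by simp) ?_
    intro j hj τ hF hinv hjτ
    refine Halts.of_wp ?_ (by decide)
    simp only [Program.wp, NatExpr.eval, hjτ]
    intro v hv
    rcases Nat.lt_succ_iff_lt_or_eq.1 hv with hv | rfl
    · simpa [storeNat_nat_of_ne, hv.ne] using hinv v hv
    · simp [storeNat_nat_of_ne]
  refine (Halts.seq hclear (T₂ := (n + 1) * (112 * M + 20 + 4) + 30)
    (Q' := fun σ' => HoldsTree n M s σ' ∧ ClosedBelow M M σ') ?_).mono (by nlinarith) fun _ _ h => h
  intro σ₁ hF₁ hvis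
  have hs₁ : σ₁.nat vS 0 = s := congrFun (hF₁.nat vS (by decide)) 0
  have hA₁ : Agree [vN, vArcs, vLam, aTail, aHead, aAlive, aFlow] σ σ₁ := hF₁.agree (by decide)
  refine Halts.mono (Halts.setNat_seq (Halts.setNat_seq (T := (n + 1) * (112 * M + 20 + 4) + 4) ?_))
    (by simp [NatExpr.cost]; omega) fun _ _ h => h
  simp only [NatExpr.eval, hs₁]
  set σ₂ := (σ₁.storeNat aVis s 1).storeNat vChanged 0 1 with hσ₂
  have hA₂ : Agree [vN, vArcs, vLam, aTail, aHead, aAlive, aFlow] σ σ₂ := hA₁.trans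
    ((agree_storeNat _ (by decide) _ _).trans (agree_storeNat _ (by decide) _ _))
  have hvis₂ : σ₂.nat aVis = Function.update (σ₁.nat aVis) s 1 := by
    simp [hσ₂, storeNat_nat_of_ne]
  have hcount : countVis n (σ₂.nat aVis) = 1 := by
    rw [hvis₂, countVis_update (hvis s hs) hs, countVis]
    simp only [Nat.add_eq_right, Finset.card_eq_zero, Finset.filter_eq_empty_iff, Finset.mem_range,
      not_not]
    exact fun v hv => hvis v hv
  have htree₂ : HoldsTree n M s σ₂ := by
    have hroot : ∀ v < n, σ₂.nat aVis v ≠ 0 → v = s := by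
      intro v hv h
      by_contra hvs
      rw [hvis₂, Function.update_of_ne hvs] at h
      exact h (hvis v hv)
    refine ⟨fun _ => 0, ?_, ?_, ?_⟩
    · rw [hvis₂, Function.update_self]; exact one_ne_zero
    · intro v hv h
      rw [hcount]; exact one_pos
    · exact fun v hv h hvs => absurd (hroot v hv h) hvs
  -- The measure drops to 0 after a round without changes, and until then decreases with the number
  -- of unvisited vertices; so there are at most n + 1 rounds.
  refine (Halts.loop (T := 112 * M + 20) (fun τ => HoldsTree n M s τ ∧
      (τ.nat vChanged 0 = 0 → ClosedBelow M M τ))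
    (fun τ => if τ.nat vChanged 0 = 0 then 0 else n - countVis n (τ.nat aVis) + 1)
    ⟨htree₂, fun h => by simp [hσ₂] at h⟩ ?_).mono ?_ ?_
  · rintro τ hF ⟨ht, -⟩ hch
    simp only [Test.Holds, NatExpr.eval] at hch
    have hA : Agree [vN, vArcs, vLam, aTail, aHead, aAlive, aFlow] σ τ :=
      hA₂.trans (hF.agree (by decide))
    have hsub' : flowArcs M τ ⊆ aliveArcs M τ := by
      rwa [flowArcs, aliveArcs, hA aFlow (by simp), hA aAlive (by simp)]
    refine (relaxAll_spec (h.congr fun a ha => hA a ?_) hsub' ht).mono le_rfl ?_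
    · simp only [List.mem_cons, List.not_mem_nil, or_false] at ha ⊢; tauto
    · rintro ρ - ⟨ht', hρ⟩
      refine ⟨⟨ht', fun h0 => ?_⟩, ?_⟩
      · rcases hρ with hρ | hρ
        · exact hρ.2
        · omega
      · have hτ : τ.nat vChanged 0 ≠ 0 := by omega
        rcases hρ with hρ | hρ
        · rw [if_pos hρ.1, if_neg hτ]; omega
        · have hρ' : ρ.nat vChanged 0 ≠ 0 := by omega
          rw [if_neg hρ', if_neg hτ]
          have := countVis_le (n := n) (vis := ρ.nat aVis)
          omega
  · have h1 : (if σ₂.nat vChanged 0 = 0 then 0 else n - countVis n (σ₂.nat aVis) + 1) ≤ n + 1 := by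
      split_ifs <;> omega
    have h2 := Nat.mul_le_mul_right (112 * M + 20 + 4) h1
    simpa [Test.cost, NatExpr.cost] using h2
  · rintro τ - ⟨⟨h1, h2⟩, h3⟩
    simp only [Test.Holds, NatExpr.eval, not_le] at h3
    exact ⟨h1, h2 (by omega)⟩

theorem augmentStep_spec {s t v : ℕ} {φ : Finset ℕ} {lev : ℕ → ℕ}
    (hφ : φ ⊆ aliveArcs M σ) (hv : σ.nat vCur 0 = v) (hvs : v ≠ s)
    (htree : IsTree n (σ.nat aTail) (σ.nat aHead) (aliveArcs M σ) φ s (σ.nat aVis) (σ.nat aPar) lev)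
    (ha : IsPartialAugment n (σ.nat aTail) (σ.nat aHead) (aliveArcs M σ) φ s t (σ.nat aVis)
      (σ.nat aPar) lev (flowArcs M σ) v) :
    Halts augmentStep σ 100 fun σ' =>
      IsPartialAugment n (σ.nat aTail) (σ.nat aHead) (aliveArcs M σ) φ s t (σ.nat aVis)
        (σ.nat aPar) lev (flowArcs M σ') (σ'.nat vCur 0) ∧ lev (σ'.nat vCur 0) < lev v := by
  set j := σ.nat aPar v with hj
  have hjM : j < M := by
    obtain ⟨x, -, hx, -⟩ := htree.parent v ha.lt ha.reached hvs
    exact (mem_flagged.1 (hx.elim (fun h => h.1) fun h => hφ h.1)).1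
  refine Halts.of_wp ?_ (by decide)
  simp only [augmentStep, Program.wp, Test.Holds, NatExpr.eval, hv]
  have key : ∀ (σ' : Memory) (x : ℕ), (x ≠ 0 ↔ σ.nat aFlow j = 0) →
      σ'.nat aFlow = Function.update (σ.nat aFlow) j x →
      σ'.nat vCur 0 = (if j ∈ flowArcs M σ then σ.nat aHead j else σ.nat aTail j) →
      IsPartialAugment n (σ.nat aTail) (σ.nat aHead) (aliveArcs M σ) φ s t (σ.nat aVis)
        (σ.nat aPar) lev (flowArcs M σ') (σ'.nat vCur 0) ∧ lev (σ'.nat vCur 0) < lev v := by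
    intro σ' x hx h1 h2
    rw [flowArcs, h1, flagged_flip hjM hx]
    exact IsPartialAugment.step htree ha hvs h2
  constructor
  · intro hf
    simp only [storeNat_nat_self, Function.update_self, ← hj,
      storeNat_nat_of_ne _ (show aFlow ≠ vTmp by decide)] at hf
    refine key _ 0 (by simp; omega) ?_ ?_
    · simp [storeNat_nat_of_ne, ← hj]
    · rw [if_pos (mem_flagged.2 ⟨hjM, by omega⟩)]
      simp [storeNat_nat_of_ne, ← hj]
  · intro hf
    simp only [storeNat_nat_self, Function.update_self, ← hj,
      storeNat_nat_of_ne _ (show aFlow ≠ vTmp by decide)] at hf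
    refine key _ 1 (by simp; omega) ?_ ?_
    · simp [storeNat_nat_of_ne, ← hj]
    · rw [if_neg fun h => hf (by have := (mem_flagged.1 h).2; omega)]
      simp [storeNat_nat_of_ne, ← hj]

/-- The level of the current vertex decreases along the tree path and is at most n at the start,
which bounds the number of steps. Levels exist only in the proof; the program stores no more than
the parent arcs. -/
theorem augment_spec {s t x : ℕ} (hs : σ.nat vS 0 = s)
    (ht : σ.nat vT 0 = t) (htn : t < n) (hsub : flowArcs M σ ⊆ aliveArcs M σ)
    (hflow : IsFlow (σ.nat aTail) (σ.nat aHead) (flowArcs M σ) s t x) (htree : HoldsTree n M s σ)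
    (hvis : σ.nat aVis t ≠ 0) :
    Halts augment σ (n * 112 + 30) fun σ' => flowArcs M σ' ⊆ aliveArcs M σ' ∧
      IsFlow (σ'.nat aTail) (σ'.nat aHead) (flowArcs M σ') s t (x + 1) := by
  obtain ⟨lev, htree⟩ := htree
  refine Halts.mono (Halts.setNat_seq (T := n * 112 + 20) ?_) (by simp [NatExpr.cost]; omega)
    fun _ _ h => h
  simp only [NatExpr.eval, ht]
  set σ₁ := σ.storeNat vCur 0 t with hσ₁
  have hA₁ : Agree [vS, aTail, aHead, aAlive, aVis, aPar] σ σ₁ := agree_storeNat _ (by decide) _ _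
  refine (Halts.loop (T := 100)
    (fun τ => IsPartialAugment n (σ.nat aTail) (σ.nat aHead) (aliveArcs M σ) (flowArcs M σ) s t
      (σ.nat aVis) (σ.nat aPar) lev (flowArcs M τ) (τ.nat vCur 0))
    (fun τ => lev (τ.nat vCur 0)) ?_ ?_).mono ?_ ?_
  · simp only [hσ₁, storeNat_nat_self, Function.update_self, flowArcs,
      storeNat_nat_of_ne _ (show aFlow ≠ vCur by decide)]
    exact ⟨htn, hvis, hsub, fun X => by ring, fun _ _ _ _ _ => Iff.rfl⟩
  · rintro τ hF hI hc
    have hA : Agree [vS, aTail, aHead, aAlive, aVis, aPar] σ τ := hA₁.trans (hF.agree (by decide))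
    simp only [Test.Holds, NatExpr.eval, hA vS (by simp), hs] at hc
    have h1 := hA aTail (by simp)
    have h2 := hA aHead (by simp)
    have h3 := hA aAlive (by simp)
    have h4 := hA aVis (by simp)
    have h5 := hA aPar (by simp)
    rw [aliveArcs, ← h1, ← h2, ← h3, ← h4, ← h5] at hI htree
    refine (augmentStep_spec (by rwa [aliveArcs, h3]) rfl (by omega) htree hI).mono le_rfl ?_
    rintro ρ - hρ
    rwa [aliveArcs, h1, h2, h3, h4, h5] at hρ
  · have h1 : lev (σ₁.nat vCur 0) ≤ n := by
      simp only [hσ₁, storeNat_nat_self, Function.update_self]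
      exact (htree.lev_lt t htn hvis).le.trans countVis_le
    have h2 := Nat.mul_le_mul_right 112 h1
    simp only [Test.cost, NatExpr.cost]
    omega
  · rintro τ hF ⟨hI, hc⟩
    have hA : Agree [vS, aTail, aHead, aAlive, aVis, aPar] σ τ := hA₁.trans (hF.agree (by decide))
    simp only [Test.Holds, NatExpr.eval, hA vS (by simp), hs, not_not] at hc
    have hcur : τ.nat vCur 0 = s := by omega
    rw [hcur] at hI
    rw [aliveArcs, hA aTail (by simp), hA aHead (by simp), hA aAlive (by simp)]
    refine ⟨hI.subset, fun X hs ht => ?_⟩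
    rw [hI.net, hflow X hs ht]
    simp [ind, hs, ht]

/-- Every cut that separates `s` from `t` has at least `lam` alive arcs. -/
def PairConnected (M lam : ℕ) (σ : Memory) (s t : ℕ) : Prop :=
  ∀ X : Set ℕ, s ∈ X → t ∉ X →
    lam ≤ (outArcs (σ.nat aTail) (σ.nat aHead) (aliveArcs M σ) X).card

/-- Every cut has at least `lam` alive arcs. -/
def AllConnected (n M lam : ℕ) (σ : Memory) : Prop :=
  ∀ s < n, ∀ t < n, s ≠ t → PairConnected M lam σ s t

theorem PairConnected.congr {σ' : Memory} {s t : ℕ} (h : PairConnected M lam σ s t)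
    (hA : Agree [aTail, aHead, aAlive] σ σ') : PairConnected M lam σ' s t := by
  rw [PairConnected, aliveArcs, hA aTail (by simp), hA aHead (by simp), hA aAlive (by simp)]
  exact h

/-- The state of the test of the pair `s`, `t` after `r` rounds. -/
def FlowInv (M lam s t r : ℕ) (σ : Memory) : Prop :=
  (σ.nat vOk 0 ≠ 0 ∧ flowArcs M σ ⊆ aliveArcs M σ ∧
    IsFlow (σ.nat aTail) (σ.nat aHead) (flowArcs M σ) s t r) ∨
  (σ.nat vOk 0 = 0 ∧ ¬ PairConnected M lam σ s t)

theorem FlowInv.congr {s t r : ℕ} {σ' : Memory} (h : FlowInv M lam s t r σ)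
    (hA : Agree [vOk, aTail, aHead, aAlive, aFlow] σ σ') : FlowInv M lam s t r σ' := by
  rw [FlowInv, PairConnected, flowArcs, aliveArcs, hA vOk (by simp), hA aTail (by simp),
    hA aHead (by simp), hA aAlive (by simp), hA aFlow (by simp)]
  exact h

/-- If t is reached, the augmentation raises the value of the flow. Otherwise the flow saturates the
cut around the visited vertices, which thus has only r < lam arcs; the pair fails and later rounds
do nothing. -/
theorem increaseFlow_spec (h : HoldsArcs n M lam σ) {s t r : ℕ} (hs : σ.nat vS 0 = s)
    (ht : σ.nat vT 0 = t) (hsn : s < n) (htn : t < n) (hr : r < lam)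
    (hI : FlowInv M lam s t r σ) :
    Halts increaseFlow σ ((n + 1) * (112 * M + 172) + 100) (FlowInv M lam s t (r + 1)) := by
  refine (Halts.ite (T := (n + 1) * (112 * M + 60) + (n * 112 + 50)) (fun hok => ?_)
    fun hok => ?_).mono (by simp [Test.cost, NatExpr.cost]; nlinarith) fun _ _ h => h
  · simp only [Test.Holds, NatExpr.eval] at hok
    rcases hI with ⟨-, hsub, hflow⟩ | ⟨h0, -⟩
    swap
    · omega
    refine Halts.seq (search_spec h hsub (hs ▸ hsn)) ?_
    rintro σ₁ hF₁ ⟨htree, hclosed⟩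
    rw [hs] at htree
    have hA₁ : Agree [vOk, vS, vT, aTail, aHead, aAlive, aFlow] σ σ₁ := hF₁.agree (by decide)
    have h1 := hA₁ aTail (by simp)
    have h2 := hA₁ aHead (by simp)
    have h3 := hA₁ aAlive (by simp)
    have h4 := hA₁ aFlow (by simp)
    have hs₁ : σ₁.nat vS 0 = s := by rw [hA₁ vS (by simp), hs]
    have ht₁ : σ₁.nat vT 0 = t := by rw [hA₁ vT (by simp), ht]
    have hsub₁ : flowArcs M σ₁ ⊆ aliveArcs M σ₁ := by rwa [flowArcs, aliveArcs, h3, h4]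
    have hflow₁ : IsFlow (σ₁.nat aTail) (σ₁.nat aHead) (flowArcs M σ₁) s t r := by
      rwa [flowArcs, h1, h2, h4]
    refine (Halts.ite (T := n * 112 + 30) (fun hv => ?_) fun hv => ?_).mono
      (by simp [Test.cost, NatExpr.cost]; omega) fun _ _ h => h
    · simp only [Test.Holds, NatExpr.eval, ht₁] at hv
      refine (augment_spec hs₁ ht₁ htn hsub₁ hflow₁ htree (by omega)).mono le_rfl ?_
      rintro σ₂ hF₂ ⟨h5, h6⟩
      refine Or.inl ⟨?_, h5, h6⟩
      rw [hF₂.nat vOk (by decide), hA₁ vOk (by simp)]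
      omega
    · simp only [Test.Holds, NatExpr.eval, ht₁] at hv
      refine Halts.mono (Halts.setNat (Q := fun σ₂ => σ₂ = σ₁.storeNat vOk 0 0) rfl)
        (by simp [NatExpr.cost]) ?_
      rintro σ₂ - rfl
      refine Or.inr ⟨by simp, fun hp => ?_⟩
      replace hp : PairConnected M lam σ₁ s t :=
        hp.congr (agree_storeNat _ (by decide) _ _).symm
      obtain ⟨lev, htree⟩ := htree
      -- Marks beyond n are not controlled, hence the restriction to v < n; all arcs have their ends
      -- below n.
      have hcl : ∀ a x y, Residual (σ₁.nat aTail) (σ₁.nat aHead) (aliveArcs M σ₁) (flowArcs M σ₁)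
          a x y → x ∈ {v | v < n ∧ σ₁.nat aVis v ≠ 0} → y ∈ {v | v < n ∧ σ₁.nat aVis v ≠ 0} := by
        rintro a x y hr ⟨hx, hx'⟩
        have haM : a < M := (mem_flagged.1 (hr.elim (fun h => h.1) fun h => hsub₁ h.1)).1
        refine ⟨?_, hclosed a haM x y hr hx'⟩
        rcases hr with hr | hr
        · rw [← hr.2.2.2, h2]; exact h.head_lt a haM
        · rw [← hr.2.2, h1]; exact h.tail_lt a haM
      have hsX : s ∈ {v | v < n ∧ σ₁.nat aVis v ≠ 0} := ⟨hsn, htree.root⟩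
      have htX : t ∉ {v | v < n ∧ σ₁.nat aVis v ≠ 0} := fun h => hv (by have := h.2; omega)
      have h5 := netFlow_eq_cut hsub₁ hcl
      rw [hflow₁ _ hsX htX] at h5
      have h6 := hp _ hsX htX
      omega
  · simp only [Test.Holds, NatExpr.eval] at hok
    refine Halts.skip (by omega) ?_
    rcases hI with ⟨h0, -⟩ | h0
    · omega
    · exact Or.inr h0

/-- The state of the connectivity test when the pairs in `S` have been tested. -/
def TestInv (M lam : ℕ) (S : Set (ℕ × ℕ)) (σ : Memory) : Prop :=
  σ.nat vOk 0 ≠ 0 ↔ ∀ x ∈ S, x.1 ≠ x.2 → PairConnected M lam σ x.1 x.2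

theorem TestInv.congr {S : Set (ℕ × ℕ)} {σ' : Memory} (h : TestInv M lam S σ)
    (hA : Agree [vOk, aTail, aHead, aAlive] σ σ') : TestInv M lam S σ' := by
  unfold TestInv PairConnected aliveArcs
  rw [hA vOk (by simp), hA aTail (by simp), hA aHead (by simp), hA aAlive (by simp)]
  exact h

/-- A bound on the running time of the test of a pair. -/
def testPairTime (n M lam : ℕ) : ℕ := lam * ((n + 1) * (112 * M + 172) + 112) + 17 * M + 60

/-- A flow of value lam bounds every cut from below, and a failed round exhibits a cut that is too
small. Nothing needs to be done for s = t or after an earlier failure. -/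
theorem testPair_spec (h : HoldsArcs n M lam σ) {s t : ℕ} (hs : σ.nat vS 0 = s)
    (ht : σ.nat vT 0 = t) (hsn : s < n) (htn : t < n) {S : Set (ℕ × ℕ)} (hI : TestInv M lam S σ) :
    Halts testPair σ (testPairTime n M lam) (TestInv M lam (insert (s, t) S)) := by
  refine (Halts.ite (T := (M * (5 + 12) + 9) +
      (lam * ((n + 1) * (112 * M + 172) + 100 + 12) + 9)) (fun hok => ?_)
    fun hok => ?_).mono (by
      simp only [Test.cost, NatExpr.cost, testPairTime, Nat.add_assoc, Nat.reduceAdd]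
      omega) fun _ _ h => h
  · simp only [Test.Holds, NatExpr.eval, hs, ht] at hok
    have hst : s ≠ t := by omega
    have hall := hI.1 (by omega)
    refine Halts.seq (Q := fun σ' => ∀ j < M, σ'.nat aFlow j = 0) (Halts.forLoop
      (fun j σ' => ∀ i < j, σ'.nat aFlow i = 0) h.arcs_eq (by decide) (by decide) (by decide)
      (by simp) ?_) ?_
    · intro j hj τ hF hinv hjτ
      refine Halts.of_wp ?_ (by decide)
      simp only [Program.wp, NatExpr.eval, hjτ]
      intro v hv
      rcases Nat.lt_succ_iff_lt_or_eq.1 hv with hv | rfl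
      · simpa [storeNat_nat_of_ne, hv.ne] using hinv v hv
      · simp [storeNat_nat_of_ne]
    · intro σ₁ hF₁ hzero
      have hA₁ : Agree [vN, vArcs, vLam, vOk, vS, vT, aTail, aHead, aAlive] σ σ₁ :=
        hF₁.agree (by decide)
      have hempty : flowArcs M σ₁ = ∅ := by
        refine Finset.filter_eq_empty_iff.2 fun j hj => ?_
        simpa using hzero j (Finset.mem_range.1 hj)
      have h₁ : HoldsArcs n M lam σ₁ := h.congr (hF₁.agree (by decide))
      refine (Halts.forLoop (fun r σ' => FlowInv M lam s t r σ') h₁.lam_eq (by decide) (by decide)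
        (by decide) ?_ ?_).mono le_rfl ?_
      · refine FlowInv.congr (σ := σ₁) (Or.inl ⟨?_, ?_, ?_⟩) (agree_storeNat _ (by decide) _ _)
        · rw [hA₁ vOk (by simp)]; omega
        · rw [hempty]; exact Finset.empty_subset _
        · rw [hempty]; intro X _ _; simp [netFlow]
      · intro r hr τ hF hinv _
        have hA : Agree [vS, vT] σ₁ τ := hF.agree (by decide)
        refine (increaseFlow_spec (h₁.congr (hF.agree (by decide)))
          (by rw [hA vS (by simp), hA₁ vS (by simp), hs])
          (by rw [hA vT (by simp), hA₁ vT (by simp), ht]) hsn htn hr hinv).mono le_rfl ?_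
        exact fun ρ _ hρ => hρ.congr (agree_storeNat _ (by decide) _ _)
      · intro τ hF hinv
        have hA : Agree [aTail, aHead, aAlive] σ τ :=
          Agree.trans (σ₁ := σ₁) (hF₁.agree (by decide)) (hF.agree (by decide))
        rcases hinv with ⟨h0, hsub, hflow⟩ | ⟨h0, hnot⟩
        · refine iff_of_true h0 ?_
          rintro x (rfl | hx) hne
          · exact fun X hsX htX => hflow.le_cut hsub hsX htX
          · exact (hall x hx hne).congr hA
        · refine iff_of_false (not_not.2 h0) fun hp => hnot ?_
          exact hp (s, t) (Set.mem_insert _ _) hst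
  · simp only [Test.Holds, NatExpr.eval, hs, ht] at hok
    refine Halts.skip (by omega) ?_
    unfold TestInv at hI ⊢
    rw [hI]
    refine ⟨fun hall x hx hne => ?_, fun hall x hx => hall x (Set.mem_insert_of_mem _ hx)⟩
    rcases hx with rfl | hx
    · refine absurd hne ?_
      simp only [not_not]
      have := hI.2 hall
      omega
    · exact hall x hx hne

/-- A bound on the running time of the connectivity test. -/
def testTime (n M lam : ℕ) : ℕ := n * (n * (testPairTime n M lam + 12) + 21) + 13

theorem testConnected_spec (h : HoldsArcs n M lam σ) :
    Halts testConnected σ (testTime n M lam) fun σ' =>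
      σ'.nat vOk 0 ≠ 0 ↔ AllConnected n M lam σ := by
  refine Halts.mono (Halts.setNat_seq (T := n * (n * (testPairTime n M lam + 12) + 9 + 12) + 9)
    (Q := TestInv M lam {x | x.1 < n ∧ x.2 < n}) ?_) (by
    simp only [NatExpr.cost, testTime, Nat.add_assoc, Nat.reduceAdd]; omega) ?_
  · simp only [NatExpr.eval]
    set σ₁ := σ.storeNat vOk 0 1 with hσ₁
    have h₁ : HoldsArcs n M lam σ₁ := h.congr (agree_storeNat _ (by decide) _ _)
    refine (Halts.forLoop (fun s σ' => TestInv M lam {x | x.1 < s ∧ x.2 < n} σ') h₁.n_eq (by decide)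
      (by decide) (by decide) ?_ ?_).mono le_rfl fun _ _ h => h
    · refine TestInv.congr (σ := σ₁) ?_ (agree_storeNat _ (by decide) _ _)
      exact iff_of_true (by simp [hσ₁]) (by simp)
    · intro s hs τ hF hinv hsτ
      have hτ : HoldsArcs n M lam τ := h₁.congr (hF.agree (by decide))
      refine (Halts.forLoop (fun t σ' => TestInv M lam
        ({x | x.1 < s ∧ x.2 < n} ∪ {x | x.1 = s ∧ x.2 < t}) σ') hτ.n_eq (by decide)
        (by decide) (by decide) ?_ ?_).mono le_rfl ?_
      · refine TestInv.congr (σ := τ) ?_ (agree_storeNat _ (by decide) _ _)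
        simpa using hinv
      · intro t ht ρ hFρ hinv' htρ
        have hρ : HoldsArcs n M lam ρ := hτ.congr (hFρ.agree (by decide))
        have hsρ : ρ.nat vS 0 = s := (congrFun (hFρ.nat vS (by decide)) 0).trans hsτ
        refine (testPair_spec hρ hsρ htρ hs ht hinv').mono le_rfl fun π _ hπ => ?_
        have hset : insert (s, t) (({x : ℕ × ℕ | x.1 < s ∧ x.2 < n} ∪ {x | x.1 = s ∧ x.2 < t})) =
            {x : ℕ × ℕ | x.1 < s ∧ x.2 < n} ∪ {x | x.1 = s ∧ x.2 < t + 1} := by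
          ext ⟨a, b⟩
          simp only [Set.mem_insert_iff, Prod.mk.injEq, Set.mem_union, Set.mem_ofPred_eq]
          omega
        rw [hset] at hπ
        exact hπ.congr (agree_storeNat _ (by decide) _ _)
      · intro π _ hπ
        have hset : ({x : ℕ × ℕ | x.1 < s ∧ x.2 < n} ∪ {x | x.1 = s ∧ x.2 < n}) =
            {x : ℕ × ℕ | x.1 < s + 1 ∧ x.2 < n} := by
          ext ⟨a, b⟩
          simp only [Set.mem_union, Set.mem_ofPred_eq]
          omega
        rw [hset] at hπ
        exact hπ.congr (agree_storeNat _ (by decide) _ _)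
  · intro σ' hF hinv
    refine hinv.trans ⟨fun hall s hs t ht hst => ?_, fun hall x hx hne => ?_⟩
    · exact (hall (s, t) ⟨hs, ht⟩ hst).congr (hF.agree (by decide)).symm
    · exact (hall _ hx.1 _ hx.2 hne).congr (hF.agree (by decide))

end Test

/-! ## The search program -/

local notation "vEdges" => (6 : ℕ)
local notation "vBudget" => (9 : ℕ)
local notation "vBase" => (10 : ℕ)
local notation "aDigit" => (14 : ℕ)
local notation "aDel" => (15 : ℕ)
local notation "vStep" => (28 : ℕ)
local notation "vEdge" => (29 : ℕ)
local notation "vOther" => (30 : ℕ)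
local notation "vRank" => (31 : ℕ)
local notation "vDone" => (32 : ℕ)
local notation "vCarry" => (33 : ℕ)

/-- Set the flags of both arcs of the edge `vEdge` to `x`. -/
def setAlive (x : ℕ) : Program :=
  .seq (.setNat aAlive (rd vEdge) (.lit x))
    (.setNat aAlive (.add (rd vEdges) (rd vEdge)) (.lit x))

/-- Determine whether the edge `vEdge` is deletable. -/
def testEdge : Program :=
  .seq (.setNat aDel (rd vEdge) (.lit 0))
    (.ite (.flag (rdAt aAlive vEdge))
      (.seq (setAlive 0)
        (.seq testConnected
          (.seq (.ite (.flag (rd vOk)) (.setNat aDel (rd vEdge) (.lit 1)) .skip) (setAlive 1))))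
      .skip)

/-- Determine the deletable edges. -/
def findDeletable : Program := forLoop vEdge vEdges testEdge

/-- Count the edge `vOther` if it is deletable and comes before `vEdge`. -/
def countBefore : Program :=
  .ite (.and (.flag (rdAt aDel vOther)) (.not (.and
      (.realLe (.read 1 (rd vOther)) (.read 1 (rd vEdge)))
      (.not (.and (.realLe (.read 1 (rd vEdge)) (.read 1 (rd vOther)))
        (.natLe (.add (rd vOther) (.lit 1)) (rd vEdge)))))))
    (setVar vRank (.add (rd vRank) (.lit 1)))
    .skip

/-- Determine the rank of the edge `vEdge`. -/
def computeRank : Program :=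
  .seq (setVar vRank (.lit 0)) (forLoop vOther vEdges countBefore)

/-- Remove the edge `vEdge` if it is deletable and has the desired rank. -/
def removeEdge : Program :=
  .ite (.flag (rdAt aDel vEdge))
    (.seq computeRank (.ite (.eq (rd vRank) (rdAt aDigit vStep)) (setAlive 0) .skip))
    .skip

/-- Remove the deletable edge of the desired rank. -/
def removeNext : Program := .seq findDeletable (forLoop vEdge vEdges removeEdge)

/-- Remove the edges that are described by the digits. -/
def simulate : Program :=
  .seq (forLoop vArc vArcs (.setNat aAlive (rd vArc) (.lit 1))) (forLoop vStep vBudget removeNext)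

/-- Compute the weight of the removed edges. -/
def computeWeight : Program :=
  .seq (.setReal 2 (.lit 0) .zero)
    (forLoop vEdge vEdges (.ite (.flag (rdAt aAlive vEdge)) .skip
      (.setReal 2 (.lit 0) (.add (.read 2 (.lit 0)) (.read 1 (rd vEdge))))))

/-- Output the removed edges. -/
def report : Program :=
  .seq (setVar 3 (.lit 1))
    (.seq (forLoop vEdge vEdges (.ite (.flag (rdAt aAlive vEdge)) .skip
      (.setNat 4 (rd vEdge) (.lit 1))))
    (setVar vDone (.lit 1)))

/-- Propagate the carry. -/
def incrementDigit : Program :=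
  .ite (.flag (rd vCarry))
    (.ite (.natLe (rd vBase) (.add (rdAt aDigit vStep) (.lit 1)))
      (.setNat aDigit (rd vStep) (.lit 0))
      (.seq (.setNat aDigit (rd vStep) (.add (rdAt aDigit vStep) (.lit 1))) (setVar vCarry (.lit
          0))))
    .skip

/-- Move on to the next sequence of digits. -/
def increment : Program :=
  .seq (setVar vCarry (.lit 1))
    (.seq (forLoop vStep vBudget incrementDigit)
      (.ite (.flag (rd vCarry)) (setVar vDone (.lit 1)) .skip))

/-- Examine one sequence of digits. -/
def examine : Program :=
  .seq simulate (.seq computeWeight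
    (.ite (.realLe (.read 0 (.lit 0)) (.read 2 (.lit 0))) report increment))

/-- The array from which the tail of the second arc of an edge is copied. -/
def Kind.secondTail : Kind → ℕ
  | .directed => 1
  | .undirected => 2

/-- Copy the endpoints of the edge `vEdge`. In a digraph the second arc is a loop. -/
def copyEdge (K : Kind) : Program :=
  .seq (.setNat aTail (rd vEdge) (rdAt 1 vEdge))
    (.seq (.setNat aHead (rd vEdge) (rdAt 2 vEdge))
      (.seq (.setNat aHead (.add (rd vEdges) (rd vEdge)) (rdAt 1 vEdge))
        (.setNat aTail (.add (rd vEdges) (rd vEdge))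
          (rdAt K.secondTail vEdge))))

/-- Compute the number of ranks that have to be tried. -/
def computeBase : Program :=
  forLoop vEdge vBudget (forLoop vOther vBudget
    (setVar vBase (.add (rd vBase) (.add (.add (rd vLam) (rd vLam)) (.add (rd vLam) (rd vLam))))))

/-- Prepare the variables. -/
def prepare (K : Kind) : Program :=
  .seq (.seq (setVar vN (.read 0 (.lit 0))) (.seq (setVar vEdges (.read 0 (.lit 1)))
    (.seq (setVar vLam (.read 0 (.lit 2))) (.seq (setVar vBudget (.read 0 (.lit 3)))
      (setVar vArcs (.add (rd vEdges) (rd vEdges)))))))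
    (.seq (forLoop vEdge vEdges (copyEdge K)) computeBase)

/-- The whole algorithm. -/
def solve (K : Kind) : Program :=
  .seq (prepare K) (.loop (.natLe (rd vDone) (.lit 0)) examine)

/-! ### The instance as represented in memory -/

section Context

variable {K : Kind} (I : Instance K) (en : Fin I.E.card ≃ I.E)

/-- The edges, given by their numbers, as a system of traversable edges. -/
def edgeRel (i : Fin I.E.card) (a b : Fin I.n) : Prop := K.Joins (en i : K.Edge (Fin I.n)) a b

/-- The weight of the edge with a given number. -/
noncomputable def edgeWeight (i : Fin I.E.card) : ℝ := I.w (en i)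

/-- The number of ranks that have to be tried in each step. -/
def Instance.base (I : Instance K) : ℕ := I.k * (I.k * (4 * I.lam))

/-- The memory holds the instance in the format of the search program. -/
structure Holds (σ : Memory) : Prop where
  arcs : HoldsArcs I.n (I.E.card + I.E.card) I.lam σ
  edges : σ.nat vEdges 0 = I.E.card
  budget : σ.nat vBudget 0 = I.k
  base : σ.nat vBase 0 = I.base
  ends : ∀ i : Fin I.E.card, ∃ u v : Fin I.n, K.Joins (en i : K.Edge (Fin I.n)) u v ∧
    σ.nat aTail i = u ∧ σ.nat aHead i = v ∧ σ.nat aHead (I.E.card + i) = u ∧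
    σ.nat aTail (I.E.card + i) = if K.secondTail = 1 then (u : ℕ) else v
  target : σ.real 0 0 = I.α
  weight : ∀ i : Fin I.E.card, σ.real 1 i = edgeWeight I en i

/-- The flags of the arcs describe the edge set `A`. -/
def AliveIs {m : ℕ} (A : Finset (Fin m)) (σ : Memory) : Prop :=
  ∀ i : Fin m, (σ.nat aAlive i ≠ 0 ↔ i ∈ A) ∧ (σ.nat aAlive (m + i) ≠ 0 ↔ i ∈ A)

variable {I en} {σ σ' : Memory}

theorem Holds.congr (h : Holds I en σ)
    (hA : Agree [vN, vEdges, vArcs, vLam, vBudget, vBase, aTail, aHead] σ σ')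
    (h0 : σ'.real 0 = σ.real 0) (h1 : σ'.real 1 = σ.real 1) : Holds I en σ' := by
  refine ⟨h.arcs.congr fun a ha => hA a ?_, ?_, ?_, ?_, ?_, ?_, ?_⟩
  · simp only [List.mem_cons, List.not_mem_nil, or_false] at ha ⊢; tauto
  · rw [hA vEdges (by simp)]; exact h.edges
  · rw [hA vBudget (by simp)]; exact h.budget
  · rw [hA vBase (by simp)]; exact h.base
  · rw [hA aTail (by simp), hA aHead (by simp)]; exact h.ends
  · rw [h0]; exact h.target
  · rw [h1]; exact h.weight

theorem Holds.frame {P : Program} (h : Holds I en σ) (hF : Frame P σ σ')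
    (hP : ∀ a ∈ [vN, vEdges, vArcs, vLam, vBudget, vBase, aTail, aHead], a ∉ P.writesNat)
    (h0 : 0 ∉ P.writesReal ∧ 1 ∉ P.writesReal) : Holds I en σ' :=
  h.congr (hF.agree hP) (hF.real 0 h0.1) (hF.real 1 h0.2)

theorem AliveIs.congr {m : ℕ} {A : Finset (Fin m)} (h : AliveIs A σ) (hA : Agree [aAlive] σ σ') :
    AliveIs A σ' := by
  unfold AliveIs
  rw [hA aAlive (by simp)]
  exact h

theorem isEdgeSystem_edgeRel : IsEdgeSystem (edgeRel I en) := by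
  have h := K.isEdgeSystem (V := Fin I.n)
  refine ⟨fun e e' a b h1 h2 => ?_, fun e => h.ends _, ?_⟩
  · exact en.injective (Subtype.ext (h.ext _ _ a b h1 h2))
  · exact h.oriented.imp (fun h e => h _) fun h e => h _

/-- An undirected edge is stored as two opposite arcs; in a digraph the second arc is a loop, which
leaves no set. In either case at most one of the two arcs leaves X, so counting arcs amounts to
counting edges. -/
theorem card_outArcs_alive (h : Holds I en σ) {A : Finset (Fin I.E.card)} (hA : AliveIs A σ)
    (X : Set ℕ) :
    (outArcs (σ.nat aTail) (σ.nat aHead) (aliveArcs (I.E.card + I.E.card) σ) X).card =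
      (cut (edgeRel I en) A {v | (v : ℕ) ∈ X}).card := by
  have hmem : ∀ i : Fin I.E.card,
      (((i : ℕ) ∈ outArcs (σ.nat aTail) (σ.nat aHead) (aliveArcs (I.E.card + I.E.card) σ) X ∨
      I.E.card + (i : ℕ) ∈
        outArcs (σ.nat aTail) (σ.nat aHead) (aliveArcs (I.E.card + I.E.card) σ) X) ↔
      i ∈ cut (edgeRel I en) A {v | (v : ℕ) ∈ X}) ∧
      ¬ ((i : ℕ) ∈ outArcs (σ.nat aTail) (σ.nat aHead) (aliveArcs (I.E.card + I.E.card) σ) X ∧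
      I.E.card + (i : ℕ) ∈
        outArcs (σ.nat aTail) (σ.nat aHead) (aliveArcs (I.E.card + I.E.card) σ) X) := by
    intro i
    obtain ⟨u, v, huv, h1, h2, h3, h4⟩ := h.ends i
    have hi : (i : ℕ) < I.E.card + I.E.card := by omega
    have hi' : I.E.card + (i : ℕ) < I.E.card + I.E.card := by omega
    have hleaves : Leaves (edgeRel I en) i {v | (v : ℕ) ∈ X} ↔
        ((u : ℕ) ∈ X ∧ (v : ℕ) ∉ X) ∨ (K.secondTail ≠ 1 ∧ (v : ℕ) ∈ X ∧ (u : ℕ) ∉ X) := by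
      constructor
      · rintro ⟨a, b, ha, hb, hab⟩
        have ha' : (a : ℕ) ∈ X := ha
        have hb' : (b : ℕ) ∉ X := hb
        unfold edgeRel at hab
        cases K with
        | directed =>
          have := huv.symm.trans hab
          simp only [Prod.mk.injEq] at this
          obtain ⟨rfl, rfl⟩ := this
          exact Or.inl ⟨ha', hb'⟩
        | undirected =>
          rcases Sym2.eq_iff.1 (huv.symm.trans hab) with ⟨rfl, rfl⟩ | ⟨rfl, rfl⟩
          · exact Or.inl ⟨ha', hb'⟩
          · exact Or.inr ⟨by decide, ha', hb'⟩
      · rintro (⟨hu, hv⟩ | ⟨hK, hv, hu⟩)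
        · exact ⟨u, v, hu, hv, huv⟩
        · cases K with
          | directed => exact absurd rfl hK
          | undirected => exact ⟨v, u, hv, hu, huv.trans Sym2.eq_swap⟩
    have hA1 := (hA i).1
    have hA2 := (hA i).2
    have hm1 : (i : ℕ) ∈ outArcs (σ.nat aTail) (σ.nat aHead) (aliveArcs (I.E.card + I.E.card) σ) X ↔
        i ∈ A ∧ (u : ℕ) ∈ X ∧ (v : ℕ) ∉ X := by
      rw [outArcs, Finset.mem_filter, mem_flagged, h1, h2, hA1]
      simp [hi]
    have hm2 : I.E.card + (i : ℕ) ∈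
        outArcs (σ.nat aTail) (σ.nat aHead) (aliveArcs (I.E.card + I.E.card) σ) X ↔
        i ∈ A ∧ K.secondTail ≠ 1 ∧ (v : ℕ) ∈ X ∧ (u : ℕ) ∉ X := by
      rw [outArcs, Finset.mem_filter, mem_flagged, h3, h4, hA2]
      split_ifs with hK <;> simp [hK]
    rw [hm1, hm2, cut, Finset.mem_filter, hleaves]
    by_cases hu : (u : ℕ) ∈ X <;> by_cases hv : (v : ℕ) ∈ X <;> simp [hu, hv]
  have hlt : ∀ j ∈ outArcs (σ.nat aTail) (σ.nat aHead) (aliveArcs (I.E.card + I.E.card) σ) X,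
      j < I.E.card + I.E.card := fun j hj => (mem_flagged.1 (Finset.mem_filter.1 hj).1).1
  generalize outArcs (σ.nat aTail) (σ.nat aHead) (aliveArcs (I.E.card + I.E.card) σ) X = S
    at hmem hlt ⊢
  symm
  refine Finset.card_bij (fun i _ => if (i : ℕ) ∈ S then (i : ℕ) else I.E.card + i) ?_ ?_ ?_
  · intro i hi
    have := (hmem i).1.2 hi
    split_ifs with h'
    · exact h'
    · exact this.resolve_left h'
  · intro i _ j _ hij
    have := i.2
    have := j.2
    refine Fin.ext ?_
    split_ifs at hij <;> omega
  · intro j hj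
    have hjm := hlt j hj
    by_cases hj' : j < I.E.card
    · exact ⟨⟨j, hj'⟩, (hmem ⟨j, hj'⟩).1.1 (Or.inl hj), if_pos hj⟩
    · have hlt' : j - I.E.card < I.E.card := by omega
      have hadd : I.E.card + (j - I.E.card) = j := by omega
      have h5 := hmem ⟨j - I.E.card, hlt'⟩
      simp only [hadd] at h5
      refine ⟨⟨j - I.E.card, hlt'⟩, h5.1.1 (Or.inr hj), ?_⟩
      rw [if_neg fun h6 => h5.2 ⟨h6, hj⟩]
      exact hadd

/-- The program is analysed with sets of natural numbers, but only their traces on the n vertices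
matter. A proper nonempty set separates some pair of vertices, and a set that separates a pair is
proper and nonempty. -/
theorem allConnected_iff (h : Holds I en σ) {A : Finset (Fin I.E.card)} (hA : AliveIs A σ) :
    AllConnected I.n (I.E.card + I.E.card) I.lam σ ↔ CutConnected (edgeRel I en) I.lam A := by
  constructor
  · rintro hall X ⟨s, hs⟩ hX
    obtain ⟨t, ht⟩ := (Set.ne_univ_iff_exists_notMem X).1 hX
    have himg : ∀ v : Fin I.n, (v : ℕ) ∈ (Fin.val '' X) ↔ v ∈ X := fun v =>
      ⟨fun ⟨w, hw, hwv⟩ => Fin.ext hwv ▸ hw, fun hv => ⟨v, hv, rfl⟩⟩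
    have h1 := hall s s.2 t t.2 (fun h => ht (Fin.ext h ▸ hs)) (Fin.val '' X) ((himg s).2 hs)
      fun h => ht ((himg t).1 h)
    rw [card_outArcs_alive h hA] at h1
    have hset : {v : Fin I.n | (v : ℕ) ∈ Fin.val '' X} = X := Set.ext himg
    rwa [hset] at h1
  · intro hcc s hs t ht _ X hsX htX
    rw [card_outArcs_alive h hA]
    exact hcc _ ⟨⟨s, hs⟩, hsX⟩ fun h => htX
      (h ▸ Set.mem_univ (⟨t, ht⟩ : Fin I.n) : (⟨t, ht⟩ : Fin I.n) ∈ {v : Fin I.n | (v : ℕ) ∈ X})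

/-- Setting the flags of an edge. -/
theorem AliveIs.update {m : ℕ} {A : Finset (Fin m)} (hA : AliveIs A σ) (i : Fin m) (x : ℕ)
    (h : σ'.nat aAlive = Function.update (Function.update (σ.nat aAlive) i x) (m + i) x) :
    AliveIs (if x = 0 then A \ {i} else insert i A) σ' := by
  intro j
  have hi := i.2
  have hj := j.2
  have hcard : ∀ j : Fin m, j ∈ (if x = 0 then A \ {i} else insert i A) ↔
      (j = i ∧ x ≠ 0) ∨ (j ≠ i ∧ j ∈ A) := by
    intro j
    split_ifs with hx
    · simp [hx, and_comm]
    · by_cases hji : j = i <;> simp [hx, hji]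
  rw [hcard, h]
  by_cases hji : j = i
  · subst hji
    have : (j : ℕ) ≠ m + j := by omega
    simp [Function.update_of_ne this]
  · have h1 : (j : ℕ) ≠ i := fun h => hji (Fin.ext h)
    have h2 : (j : ℕ) ≠ m + i := by omega
    have h3 : m + (j : ℕ) ≠ i := by omega
    simp [h1, h2, h3, hji, hA j]

theorem setAlive_spec {m : ℕ} {A : Finset (Fin m)} (hA : AliveIs A σ) (hm : σ.nat vEdges 0 = m)
    (i : Fin m) (hi : σ.nat vEdge 0 = i) (x : ℕ) :
    Halts (setAlive x) σ 12 (AliveIs (if x = 0 then A \ {i} else insert i A)) := by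
  refine Halts.of_wp ?_ (by simp [setAlive, Program.bound, NatExpr.cost])
  simp only [setAlive, Program.wp, NatExpr.eval, hi]
  refine hA.update i x ?_
  simp [storeNat_nat_of_ne, hm, hi]

end Context

/-! ### Correctness of the removals, the weight, the output and the counter -/

section Steps

variable {K : Kind} {I : Instance K} {en : Fin I.E.card ≃ I.E} {σ σ' : Memory}

/-- The deletable edges, by their numbers. -/
noncomputable abbrev deletableEdges (I : Instance K) (en : Fin I.E.card ≃ I.E)
    (A : Finset (Fin I.E.card)) : Finset (Fin I.E.card) := deletable (edgeRel I en) I.lam A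

/-- The rank of an edge, by its number. -/
noncomputable abbrev edgeRank (I : Instance K) (en : Fin I.E.card ≃ I.E)
    (A : Finset (Fin I.E.card)) (i : Fin I.E.card) : ℕ :=
  rank (edgeRel I en) I.lam (edgeWeight I en) A i

/-- A bound on the running time of the connectivity test on the instance. -/
def Instance.testTime (I : Instance K) : ℕ :=
  WeightedECS.testTime I.n (I.E.card + I.E.card) I.lam

theorem testEdge_spec (h : Holds I en σ) {A : Finset (Fin I.E.card)} (hA : AliveIs A σ)
    {i : Fin I.E.card} (hi : σ.nat vEdge 0 = i) :
    Halts testEdge σ (I.testTime + 60) fun σ' => AliveIs A σ' ∧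
      (σ'.nat aDel i ≠ 0 ↔ i ∈ deletableEdges I en A) ∧
      ∀ j : ℕ, j ≠ i → σ'.nat aDel j = σ.nat aDel j := by
  refine (Halts.setNat_seq (T := 5 + (12 + (I.testTime + (12 + 12)))) ?_).mono
    (by simp [NatExpr.cost]; omega) fun _ _ h => h
  simp only [NatExpr.eval, hi]
  set σ₁ := σ.storeNat aDel i 0 with hσ₁
  have hA₁ : AliveIs A σ₁ := hA.congr (agree_storeNat _ (by decide) _ _)
  have h₁ : Holds I en σ₁ := h.congr (agree_storeNat _ (by decide) _ _) rfl rfl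
  have hi₁ : σ₁.nat vEdge 0 = i := by rw [hσ₁, storeNat_nat_of_ne _ (by decide)]; exact hi
  have hdel₁ : σ₁.nat aDel = Function.update (σ.nat aDel) i 0 := by simp [hσ₁]
  refine Halts.ite (fun hal => ?_) fun hal => ?_
  · simp only [Test.Holds, NatExpr.eval, hi₁] at hal
    have hiA : i ∈ A := (hA₁ i).1.1 (by omega)
    refine Halts.seq (setAlive_spec hA₁ h₁.edges i hi₁ 0) ?_
    intro σ₂ hF₂ hA₂
    rw [if_pos rfl] at hA₂
    have h₂ : Holds I en σ₂ := h₁.frame hF₂ (by decide) (by decide)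
    refine Halts.seq (testConnected_spec h₂.arcs) ?_
    intro σ₃ hF₃ hok
    rw [allConnected_iff h₂ hA₂] at hok
    have h₃ : Holds I en σ₃ := h₂.frame hF₃ (by decide) (by decide)
    have hA₃ : AliveIs (A \ {i}) σ₃ := hA₂.congr (hF₃.agree (by decide))
    have hi₃ : σ₃.nat vEdge 0 = i := by rw [hF₃.nat _ (by decide), hF₂.nat _ (by decide), hi₁]
    have hdel₃ : σ₃.nat aDel = Function.update (σ.nat aDel) i 0 := by
      rw [hF₃.nat _ (by decide), hF₂.nat _ (by decide), hdel₁]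
    have hidel : i ∈ deletableEdges I en A ↔ CutConnected (edgeRel I en) I.lam (A \ {i}) := by
      rw [deletableEdges, deletable, Finset.mem_filter, and_iff_right hiA]
    refine Halts.seq (Q := fun σ₄ => (σ₄.nat aDel i ≠ 0 ↔ i ∈ deletableEdges I en A) ∧
      ∀ j : ℕ, j ≠ i → σ₄.nat aDel j = σ.nat aDel j) (Halts.of_wp ⟨?_, ?_⟩ (by decide)) ?_
    · intro hflag
      simp only [Test.Holds, NatExpr.eval] at hflag
      simp only [Program.wp, NatExpr.eval, hi₃, storeNat_nat_self, hdel₃]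
      rw [hidel, ← hok]
      refine ⟨by simp; omega, fun j hj => ?_⟩
      rw [Function.update_of_ne hj, Function.update_of_ne hj]
    · intro hflag
      simp only [Test.Holds, NatExpr.eval] at hflag
      simp only [Program.wp, hdel₃]
      rw [hidel, ← hok]
      refine ⟨by simp; omega, fun j hj => ?_⟩
      rw [Function.update_of_ne hj]
    · rintro σ₄ hF₄ ⟨h5, h6⟩
      refine (setAlive_spec (hA₃.congr (hF₄.agree (by decide))) (m := I.E.card) ?_ i ?_ 1).mono
          le_rfl ?_
      · rw [hF₄.nat _ (by decide)]; exact h₃.edges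
      · rw [hF₄.nat _ (by decide)]; exact hi₃
      · intro σ₅ hF₅ hA₅
        rw [if_neg one_ne_zero] at hA₅
        have : insert i (A \ {i}) = A := by
          rw [← Finset.erase_eq]; exact Finset.insert_erase hiA
        rw [this] at hA₅
        refine ⟨hA₅, ?_⟩
        rw [hF₅.nat _ (by decide)]
        exact ⟨h5, h6⟩
  · simp only [Test.Holds, NatExpr.eval, hi₁] at hal
    refine Halts.skip (by omega) ⟨hA₁, ?_, ?_⟩
    · rw [hdel₁, Function.update_self]
      refine iff_of_false (by simp) fun hmem => hal ?_
      have := (hA₁ i).1.2 (Finset.mem_filter.1 hmem).1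
      omega
    · intro j hj
      rw [hdel₁, Function.update_of_ne hj]

/-- The flags of the deletable edges are correct. -/
def DelIs {m : ℕ} (D : Finset (Fin m)) (σ : Memory) : Prop := ∀ i : Fin m, σ.nat aDel i ≠ 0 ↔ i ∈ D

theorem DelIs.congr {m : ℕ} {D : Finset (Fin m)} (h : DelIs D σ) (hA : Agree [aDel] σ σ') :
    DelIs D σ' := by
  unfold DelIs
  rw [hA aDel (by simp)]
  exact h

theorem findDeletable_spec (h : Holds I en σ) {A : Finset (Fin I.E.card)} (hA : AliveIs A σ) :
    Halts findDeletable σ (I.E.card * (I.testTime + 72) + 9) fun σ' => AliveIs A σ' ∧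
      DelIs (deletableEdges I en A) σ' := by
  refine (Halts.forLoop (fun j σ' => AliveIs A σ' ∧ ∀ i : Fin I.E.card, (i : ℕ) < j →
    (σ'.nat aDel i ≠ 0 ↔ i ∈ deletableEdges I en A)) h.edges (by decide) (by decide) (by decide)
    ⟨hA.congr (agree_storeNat _ (by decide) _ _), by simp⟩ ?_).mono le_rfl
    fun σ' _ hσ' => ⟨hσ'.1, fun i => hσ'.2 i i.2⟩
  rintro j hj τ hF ⟨hAτ, hinv⟩ hjτ
  refine (testEdge_spec (i := ⟨j, hj⟩) (h.frame hF (by decide) (by decide)) hAτ hjτ).mono le_rfl ?_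
  rintro ρ - ⟨h1, h2, h3⟩
  refine ⟨h1.congr (agree_storeNat _ (by decide) _ _), fun i hi => ?_⟩
  rw [storeNat_nat_of_ne _ (by decide)]
  rcases Nat.lt_succ_iff_lt_or_eq.1 hi with hi | hi
  · rw [h3 i (by simp only; omega)]; exact hinv i hi
  · obtain rfl : i = ⟨j, hj⟩ := Fin.ext hi
    exact h2

theorem computeRank_spec (h : Holds I en σ) {A : Finset (Fin I.E.card)}
    (hD : DelIs (deletableEdges I en A) σ) {i : Fin I.E.card} (hi : σ.nat vEdge 0 = i) :
    Halts computeRank σ (I.E.card * 112 + 20) fun σ' => σ'.nat vRank 0 = edgeRank I en A i := by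
  refine (Halts.setNat_seq (T := I.E.card * (100 + 12) + 9) ?_).mono
    (by simp [NatExpr.cost]; omega) fun _ _ h => h
  simp only [NatExpr.eval]
  set σ₁ := σ.storeNat vRank 0 0 with hσ₁
  have h₁ : Holds I en σ₁ := h.congr (agree_storeNat _ (by decide) _ _) rfl rfl
  have hD₁ : DelIs (deletableEdges I en A) σ₁ := hD.congr (agree_storeNat _ (by decide) _ _)
  have hi₁ : σ₁.nat vEdge 0 = i := by rw [hσ₁, storeNat_nat_of_ne _ (by decide)]; exact hi
  refine (Halts.forLoop (fun j σ' => σ'.nat vRank 0 = (((deletableEdges I en A).filter fun x =>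
    Before (edgeWeight I en) x i).filter fun x : Fin I.E.card => (x : ℕ) < j).card) h₁.edges
        (by decide) (by decide)
    (by decide) ?_ ?_).mono le_rfl ?_
  · rw [storeNat_nat_of_ne _ (by decide), hσ₁]
    simp
  · intro j hj τ hF hinv hjτ
    have hτ : Holds I en τ := h₁.frame hF (by decide) (by decide)
    have hDτ : DelIs (deletableEdges I en A) τ := hD₁.congr (hF.agree (by decide))
    have hiτ : τ.nat vEdge 0 = i := (congrFun (hF.nat _ (by decide)) 0).trans hi₁
    have hw := hτ.weight ⟨j, hj⟩
    have hwi := hτ.weight i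
    have hDj := hDτ ⟨j, hj⟩
    simp only at hw hDj
    refine Halts.of_wp ?_ (by decide)
    simp only [countBefore, Program.wp, Test.Holds, NatExpr.eval, RealExpr.eval, hjτ, hiτ, hw, hwi]
    -- The machine tests only `≤`, so the strict comparisons in `Before` appear as a negation and,
    -- for the edge numbers, as a shift by one.
    have hcond : (1 ≤ τ.nat aDel j ∧ ¬(edgeWeight I en ⟨j, hj⟩ ≤ edgeWeight I en i ∧
        ¬(edgeWeight I en i ≤ edgeWeight I en ⟨j, hj⟩ ∧ j + 1 ≤ (i : ℕ)))) ↔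
        (⟨j, hj⟩ : Fin I.E.card) ∈ (deletableEdges I en A).filter fun x =>
          Before (edgeWeight I en) x i := by
      rw [Finset.mem_filter, ← hDj, Nat.one_le_iff_ne_zero, Before, not_and_or, not_le, not_not]
      rfl
    have hstep : (((deletableEdges I en A).filter fun x =>
        Before (edgeWeight I en) x i).filter fun x : Fin I.E.card => (x : ℕ) < j + 1).card =
        (((deletableEdges I en A).filter fun x =>
        Before (edgeWeight I en) x i).filter fun x : Fin I.E.card => (x : ℕ) < j).card + if
        (⟨j, hj⟩ : Fin I.E.card) ∈ (deletableEdges I en A).filter fun x =>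
          Before (edgeWeight I en) x i then 1 else 0 := by
      generalize (deletableEdges I en A).filter (fun x => Before (edgeWeight I en) x i) = S
      split_ifs with hS
      · rw [← Finset.card_insert_of_notMem (a := (⟨j, hj⟩ : Fin I.E.card)) (by simp)]
        congr 1
        ext x
        simp only [Finset.mem_filter, Finset.mem_insert, Fin.ext_iff]
        constructor
        · rintro ⟨h1, h2⟩
          rcases Nat.lt_succ_iff_lt_or_eq.1 h2 with h2 | h2
          · exact Or.inr ⟨h1, h2⟩
          · exact Or.inl h2
        · rintro (h1 | ⟨h1, h2⟩)
          · obtain rfl : x = ⟨j, hj⟩ := Fin.ext h1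
            exact ⟨hS, by simp⟩
          · exact ⟨h1, by omega⟩
      · rw [add_zero]
        congr 1
        ext x
        simp only [Finset.mem_filter]
        refine and_congr_right fun h1 => ⟨fun h2 => ?_, fun h2 => by omega⟩
        refine lt_of_le_of_ne (by omega) fun h3 => hS ?_
        obtain rfl : x = ⟨j, hj⟩ := Fin.ext h3
        exact h1
    rw [hcond]
    refine ⟨fun hc => ?_, fun hc => ?_⟩
    · rw [storeNat_nat_of_ne _ (by decide), hstep, if_pos hc]
      simp [hinv]
    · rw [storeNat_nat_of_ne _ (by decide), hstep, if_neg hc]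
      simp [hinv]
  · rintro τ - hτ
    rw [hτ, edgeRank, rank]
    congr 1
    exact Finset.filter_true_of_mem fun x _ => x.2

/-- A bound on the running time of `removeNext`. -/
def Instance.removeTime (I : Instance K) : ℕ :=
  I.E.card * (I.testTime + 72) + I.E.card * (I.E.card * 112 + 92) + 18

/-- The deletability flags are fixed before the first removal, and ranks are computed from these
flags and the weights alone. They therefore refer to A throughout, although the alive flags change
during the loop. -/
theorem removeNext_spec (h : Holds I en σ) {A : Finset (Fin I.E.card)} (hA : AliveIs A σ) {r c : ℕ}
    (hr : σ.nat vStep 0 = r) (hc : σ.nat aDigit r = c) :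
    Halts removeNext σ I.removeTime
      (AliveIs (next (edgeRel I en) I.lam (edgeWeight I en) A c)) := by
  refine (Halts.seq (findDeletable_spec h hA) (T₂ := I.E.card * ((I.E.card * 112 + 80) + 12) + 9)
    (Q' := AliveIs (next (edgeRel I en) I.lam (edgeWeight I en) A c)) ?_).mono
    (by simp only [Instance.removeTime, Nat.add_assoc, Nat.reduceAdd]; omega) fun _ _ h => h
  rintro σ₁ hF₁ ⟨hA₁, hD₁⟩
  have h₁ : Holds I en σ₁ := h.frame hF₁ (by decide) (by decide)
  have hr₁ : σ₁.nat vStep 0 = r := (congrFun (hF₁.nat _ (by decide)) 0).trans hr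
  have hc₁ : σ₁.nat aDigit r = c := (congrFun (hF₁.nat _ (by decide)) r).trans hc
  refine (Halts.forLoop (fun j σ' => AliveIs (A.filter fun f => ¬ ((f : ℕ) < j ∧
    f ∈ deletableEdges I en A ∧ edgeRank I en A f = c)) σ') h₁.edges (by decide) (by decide)
    (by decide) ?_ ?_).mono le_rfl ?_
  · refine AliveIs.congr (σ := σ₁) ?_ (agree_storeNat _ (by decide) _ _)
    simpa using hA₁
  · intro j hj τ hF hinv hjτ
    have hτ : Holds I en τ := h₁.frame hF (by decide) (by decide)
    have hDτ : DelIs (deletableEdges I en A) τ := hD₁.congr (hF.agree (by decide))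
    have hrτ : τ.nat vStep 0 = r := (congrFun (hF.nat _ (by decide)) 0).trans hr₁
    have hcτ : τ.nat aDigit r = c := (congrFun (hF.nat _ (by decide)) r).trans hc₁
    have hDj := hDτ ⟨j, hj⟩
    simp only at hDj
    have hkeep : ¬ ((⟨j, hj⟩ : Fin I.E.card) ∈ deletableEdges I en A ∧
        edgeRank I en A ⟨j, hj⟩ = c) →
        (A.filter fun f : Fin I.E.card => ¬ ((f : ℕ) < j + 1 ∧ f ∈ deletableEdges I en A ∧
          edgeRank I en A f = c)) = A.filter fun f : Fin I.E.card => ¬ ((f : ℕ) < j ∧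
          f ∈ deletableEdges I en A ∧ edgeRank I en A f = c) := by
      intro hno
      refine Finset.filter_congr fun f _ => not_congr ⟨fun h1 => ⟨?_, h1.2⟩,
        fun h1 => ⟨by omega, h1.2⟩⟩
      refine lt_of_le_of_ne (by omega) fun h3 => hno ?_
      obtain rfl : f = ⟨j, hj⟩ := Fin.ext h3
      exact h1.2
    refine (Halts.ite (T := I.E.card * 112 + 20 + 40) (Q := AliveIs (A.filter
      fun f : Fin I.E.card => ¬ ((f : ℕ) < j + 1 ∧ f ∈ deletableEdges I en A ∧
        edgeRank I en A f = c))) (fun hd => ?_) fun hd => ?_).mono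
      (by simp [Test.cost, NatExpr.cost]; omega) fun ρ _ hρ =>
        hρ.congr (agree_storeNat _ (by decide) _ _)
    · simp only [Test.Holds, NatExpr.eval, hjτ] at hd
      have hjD : (⟨j, hj⟩ : Fin I.E.card) ∈ deletableEdges I en A := hDj.1 (by omega)
      refine Halts.seq (computeRank_spec hτ hDτ (i := ⟨j, hj⟩) hjτ) ?_
      intro ρ hFρ hrank
      have hrρ : ρ.nat vStep 0 = r := (congrFun (hFρ.nat _ (by decide)) 0).trans hrτ
      have hcρ : ρ.nat aDigit r = c := (congrFun (hFρ.nat _ (by decide)) r).trans hcτ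
      have hAρ := hinv.congr (σ' := ρ) (hFρ.agree (by decide))
      refine (Halts.ite (T := 12) (fun heq => ?_) fun heq => ?_).mono
        (by simp [Test.cost, NatExpr.cost]) fun _ _ h => h
      · simp only [Test.Holds, NatExpr.eval, hrank, hrρ, hcρ] at heq
        refine (setAlive_spec hAρ (m := I.E.card) ?_ ⟨j, hj⟩ ?_ 0).mono le_rfl fun π _ hπ => ?_
        · rw [hFρ.nat _ (by decide)]; exact hτ.edges
        · rw [hFρ.nat _ (by decide)]; exact hjτ
        · rw [if_pos rfl] at hπ
          convert hπ using 1
          ext f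
          simp only [Finset.mem_filter, Finset.mem_sdiff, Finset.mem_singleton]
          by_cases hf : f = ⟨j, hj⟩
          · subst hf
            refine iff_of_false (fun h => h.2 ⟨by simp, hjD, by omega⟩) fun h => h.2 rfl
          · have : (f : ℕ) ≠ j := fun h => hf (Fin.ext h)
            simp only [hf, not_false_eq_true, and_true]
            refine and_congr_right fun _ => not_congr (and_congr_left fun _ => ?_)
            omega
      · simp only [Test.Holds, NatExpr.eval, hrank, hrρ, hcρ] at heq
        refine Halts.skip (by omega) ?_
        rw [hkeep fun h => heq (by omega)]
        exact hAρ
    · simp only [Test.Holds, NatExpr.eval, hjτ] at hd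
      refine Halts.skip (by omega) ?_
      rw [hkeep fun h => hd (by have := hDj.2 h.1; omega)]
      exact hinv
  · intro τ _ hτ
    convert hτ using 1
    exact Finset.filter_congr fun f _ => by simp

/-- The edges that remain if the digits `c` are chosen. -/
noncomputable abbrev runEdges (I : Instance K) (en : Fin I.E.card ≃ I.E) (c : ℕ → ℕ) (r : ℕ) :
    Finset (Fin I.E.card) := run (edgeRel I en) I.lam (edgeWeight I en) Finset.univ c r

theorem simulate_spec (h : Holds I en σ) :
    Halts simulate σ ((I.E.card + I.E.card) * 17 + I.k * (I.removeTime + 12) + 18)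
      (AliveIs (runEdges I en (σ.nat aDigit) I.k)) := by
  have hclear : Halts (forLoop vArc vArcs (.setNat aAlive (rd vArc) (.lit 1))) σ
      ((I.E.card + I.E.card) * (5 + 12) + 9) (AliveIs (Finset.univ : Finset (Fin I.E.card))) := by
    refine (Halts.forLoop (fun j σ' => ∀ i < j, σ'.nat aAlive i ≠ 0) h.arcs.arcs_eq (by decide)
      (by decide) (by decide) (by simp) ?_).mono le_rfl ?_
    · intro j hj τ hF hinv hjτ
      refine Halts.of_wp ?_ (by decide)
      simp only [Program.wp, NatExpr.eval, hjτ]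
      intro v hv
      rcases Nat.lt_succ_iff_lt_or_eq.1 hv with hv | rfl
      · simpa [storeNat_nat_of_ne, hv.ne] using hinv v hv
      · simp [storeNat_nat_of_ne]
    · intro τ _ hτ i
      have := i.2
      simp only [Finset.mem_univ, iff_true]
      exact ⟨hτ i (by omega), hτ _ (by omega)⟩
  refine (Halts.seq hclear (T₂ := I.k * (I.removeTime + 12) + 9) ?_).mono (by omega)
    fun _ _ h => h
  intro σ₁ hF₁ hA₁
  have h₁ : Holds I en σ₁ := h.frame hF₁ (by decide) (by decide)
  refine (Halts.forLoop (fun r σ' => AliveIs (runEdges I en (σ.nat aDigit) r) σ') h₁.budget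
    (by decide) (by decide) (by decide) ?_ ?_).mono le_rfl fun _ _ h => h
  · exact hA₁.congr (agree_storeNat _ (by decide) _ _)
  · intro r hr τ hF hinv hrτ
    refine (removeNext_spec (h₁.frame hF (by decide) (by decide)) hinv hrτ
      (c := σ.nat aDigit r) ?_).mono le_rfl fun ρ _ hρ => ?_
    · rw [hF.nat _ (by decide), hF₁.nat _ (by decide)]
    · exact AliveIs.congr (σ := ρ) hρ (agree_storeNat _ (by decide) _ _)

theorem computeWeight_spec (h : Holds I en σ) {A : Finset (Fin I.E.card)} (hA : AliveIs A σ) :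
    Halts computeWeight σ (I.E.card * 30 + 20) fun σ' => AliveIs A σ' ∧
      σ'.real 2 0 = ∑ i ∈ Finset.univ \ A, edgeWeight I en i := by
  refine (Halts.seq (Q := fun τ => τ = σ.storeReal 2 0 0) (Halts.of_wp (T := 3)
      (by simp only [Program.wp, NatExpr.eval, RealExpr.eval]) (by decide))
    (T₂ := I.E.card * (18 + 12) + 9) ?_).mono (by omega) fun _ _ h => h
  rintro σ₁ - rfl
  have h₁ : Holds I en (σ.storeReal 2 0 0) := h.congr (fun _ _ => rfl)
    (storeReal_real_of_ne _ (by decide) _ _) (storeReal_real_of_ne _ (by decide) _ _)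
  refine (Halts.forLoop (fun j σ' => AliveIs A σ' ∧ σ'.real 2 0 =
    ∑ i ∈ (Finset.univ \ A).filter (fun x : Fin I.E.card => (x : ℕ) < j),
        edgeWeight I en i) h₁.edges (by decide)
    (by decide) (by decide) ⟨?_, by simp⟩ ?_).mono le_rfl ?_
  · exact hA.congr (Agree.trans (σ₁ := σ.storeReal 2 0 0) (fun _ _ => rfl)
      (agree_storeNat _ (by decide) _ _))
  · rintro j hj τ hF ⟨hAτ, hinv⟩ hjτ
    have hτ : Holds I en τ := h₁.frame hF (by decide) (by decide)
    have hw := hτ.weight ⟨j, hj⟩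
    have hal := (hAτ ⟨j, hj⟩).1
    simp only at hw hal
    have hsplit : (Finset.univ \ A).filter (fun x : Fin I.E.card => (x : ℕ) < j + 1) =
        if (⟨j, hj⟩ : Fin I.E.card) ∈ A then (Finset.univ \ A).filter (fun x : Fin I.E.card => (x :
            ℕ) < j)
        else insert ⟨j, hj⟩ ((Finset.univ \ A).filter (fun x : Fin I.E.card => (x : ℕ) < j)) := by
      ext x
      by_cases hx : x = ⟨j, hj⟩
      · subst hx; split_ifs with hxA <;> simp [hxA]
      · have hxj : (x : ℕ) ≠ j := fun h => hx (Fin.ext h)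
        have : (x : ℕ) < j + 1 ↔ (x : ℕ) < j := by omega
        split_ifs with hxA <;>
          simp only [Finset.mem_filter, Finset.mem_insert, this, hx, false_or]
    refine Halts.of_wp ?_ (by decide)
    simp only [Program.wp, Test.Holds, NatExpr.eval, RealExpr.eval, hjτ, hw, hinv]
    refine ⟨fun hf => ⟨hAτ.congr (agree_storeNat _ (by decide) _ _), ?_⟩,
      fun hf => ⟨AliveIs.congr (σ := τ) hAτ (Agree.trans (σ₁ := τ.storeReal 2 0 _)
        (fun _ _ => rfl) (agree_storeNat _ (by decide) _ _)), ?_⟩⟩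
    · rw [hsplit, if_pos (hal.1 (by omega))]
      exact hinv
    · rw [hsplit, if_neg fun h => hf (by have := hal.2 h; omega), Finset.sum_insert (by simp)]
      simp [add_comm]
  · rintro τ - ⟨h1, h2⟩
    refine ⟨h1, h2.trans (Finset.sum_congr (Finset.filter_true_of_mem fun x : Fin I.E.card =>
        fun _ => x.2)
      fun _ _ => rfl)⟩

theorem report_spec (h : Holds I en σ) {A : Finset (Fin I.E.card)} (hA : AliveIs A σ)
    (hblank : ∀ i : Fin I.E.card, σ.nat 4 i = 0) :
    Halts report σ (I.E.card * 30 + 20) fun σ' => σ'.nat 3 0 = 1 ∧ σ'.nat vDone 0 = 1 ∧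
      ∀ i : Fin I.E.card, σ'.nat 4 i = 1 ↔ i ∉ A := by
  refine (Halts.setNat_seq (T := (I.E.card * (11 + 12) + 9) + 3) ?_).mono
    (by simp only [NatExpr.cost]; omega) fun _ _ h => h
  simp only [NatExpr.eval]
  set σ₁ := σ.storeNat 3 0 1 with hσ₁
  have h₁ : Holds I en σ₁ := h.congr (agree_storeNat _ (by decide) _ _) rfl rfl
  have hA₁ : AliveIs A σ₁ := hA.congr (agree_storeNat _ (by decide) _ _)
  have hblank₁ : ∀ i : Fin I.E.card, σ₁.nat 4 i = 0 := by
    rw [hσ₁, storeNat_nat_of_ne _ (by decide)]; exact hblank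
  have hone : σ₁.nat 3 0 = 1 := by simp [hσ₁]
  clear_value σ₁
  refine Halts.seq (Q := fun σ' => ∀ i : Fin I.E.card, σ'.nat 4 i = 1 ↔ i ∉ A)
    ((Halts.forLoop (fun j σ' => ∀ i : Fin I.E.card,
        σ'.nat 4 i = 1 ↔ ((i : ℕ) < j ∧ i ∉ A)) h₁.edges
    (by decide) (by decide) (by decide) ?_ ?_).mono le_rfl ?_) ?_
  · intro i
    rw [storeNat_nat_of_ne _ (by decide), hblank₁]
    simp
  · intro j hj τ hF hinv hjτ
    have hal := (hA₁.congr (σ' := τ) (hF.agree (by decide)) ⟨j, hj⟩).1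
    simp only at hal
    refine Halts.of_wp ?_ (by decide)
    simp only [Program.wp, Test.Holds, NatExpr.eval, hjτ]
    refine ⟨fun hf i => ?_, fun hf i => ?_⟩
    · rw [storeNat_nat_of_ne _ (by decide), hinv i]
      refine and_congr_left fun hiA => ⟨fun h => by omega, fun h => ?_⟩
      refine lt_of_le_of_ne (by omega) fun h3 => hiA ?_
      obtain rfl : i = ⟨j, hj⟩ := Fin.ext h3
      exact hal.1 (by omega)
    · rw [storeNat_nat_of_ne _ (by decide), storeNat_nat_self]
      by_cases hi : (i : ℕ) = j
      · obtain rfl : i = ⟨j, hj⟩ := Fin.ext hi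
        simp only [Function.update_self, true_iff]
        exact ⟨by omega, fun h => hf (by have := hal.2 h; omega)⟩
      · rw [Function.update_of_ne hi, hinv i]
        refine and_congr_left fun _ => ?_
        omega
  · intro τ _ hτ i
    rw [hτ i]
    simp
  · intro τ hF hτ
    refine Halts.of_wp ?_ (by decide)
    simp only [Program.wp, NatExpr.eval]
    refine ⟨?_, by simp, ?_⟩
    · rw [storeNat_nat_of_ne _ (by decide), hF.nat _ (by decide)]; exact hone
    · rw [storeNat_nat_of_ne _ (by decide)]; exact hτ

/-! ### Counting in base b -/

/-- The digit number `r` of `x` in base `b`. -/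
def digit (b x r : ℕ) : ℕ := x / b ^ r % b

/-- The carry reaches position r exactly if all lower digits of x are maximal, that is, if b ^ r
divides x + 1. -/
theorem digit_succ {b x r : ℕ} (hb : 0 < b) : digit b (x + 1) r =
    if b ^ r ∣ x + 1 then (if b ≤ digit b x r + 1 then 0 else digit b x r + 1) else digit b x r :=
        by
  unfold digit
  rw [Nat.succ_div]
  split_ifs with h1 h2
  · rw [Nat.add_mod]
    have := Nat.mod_lt (x / b ^ r) hb
    rcases Nat.lt_or_ge 1 b with hb1 | hb1
    · rw [Nat.mod_eq_of_lt hb1]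
      have h3 : x / b ^ r % b + 1 = b := by omega
      rw [h3, Nat.mod_self]
    · obtain rfl : b = 1 := by omega
      exact Nat.mod_one _
  · rw [Nat.add_mod]
    have := Nat.mod_lt (x / b ^ r) hb
    rw [Nat.mod_eq_of_lt (show 1 < b by omega), Nat.mod_eq_of_lt (by omega)]
  · rfl

/-- The carry leaves position r exactly if it arrives there and finds the maximal digit. -/
theorem pow_succ_dvd_succ {b x r : ℕ} (hb : 0 < b) :
    b ^ (r + 1) ∣ x + 1 ↔ b ^ r ∣ x + 1 ∧ b ≤ digit b x r + 1 := by
  constructor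
  · intro h
    have h1 : b ^ r ∣ x + 1 := (pow_dvd_pow b (Nat.le_succ r)).trans h
    refine ⟨h1, ?_⟩
    by_contra hlt
    have h2 := digit_succ (x := x) (r := r) hb
    rw [if_pos h1, if_neg hlt] at h2
    obtain ⟨q, hq⟩ := h
    unfold digit at h2
    rw [hq, pow_succ, mul_assoc, Nat.mul_div_cancel_left _ (by positivity),
      Nat.mul_mod_right] at h2
    omega
  · rintro ⟨⟨q, hq⟩, h⟩
    have h2 := digit_succ (x := x) (r := r) hb
    rw [if_pos ⟨q, hq⟩, if_pos h] at h2
    unfold digit at h2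
    rw [hq, Nat.mul_div_cancel_left _ (by positivity)] at h2
    obtain ⟨q', rfl⟩ := Nat.dvd_of_mod_eq_zero h2
    exact ⟨q', by rw [hq, pow_succ, mul_assoc]⟩

/-- Horner's scheme with the lowest digit first; it shows that the counter visits every sequence of
choices. -/
theorem exists_digits (b : ℕ) : ∀ (k : ℕ) (c : ℕ → ℕ), (∀ r < k, c r < b) →
    ∃ x < b ^ k, ∀ r < k, digit b x r = c r
  | 0, _, _ => ⟨0, by simp, by simp⟩
  | k + 1, c, hc => by
    obtain ⟨x, hx, hxc⟩ := exists_digits b k (fun r => c (r + 1)) fun r hr => hc _ (by omega)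
    have hc0 := hc 0 (by omega)
    refine ⟨c 0 + b * x, ?_, ?_⟩
    · calc c 0 + b * x < b + b * x := by omega
        _ = b * (x + 1) := by ring
        _ ≤ b * b ^ k := Nat.mul_le_mul_left _ hx
        _ = b ^ (k + 1) := by ring
    · rintro (_ | r) hr
      · simp [digit, Nat.mod_eq_of_lt hc0]
      · rw [digit, pow_succ', ← Nat.div_div_eq_div_mul, Nat.add_mul_div_left _ _ (by omega),
          Nat.div_eq_of_lt hc0, zero_add]
        exact hxc r (by omega)

/-- The digits in the memory are those of `x`. -/
def DigitsAre (b k x : ℕ) (σ : Memory) : Prop := ∀ r < k, σ.nat aDigit r = digit b x r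

theorem increment_spec (h : Holds I en σ) {x : ℕ} (hx : x < I.base ^ I.k)
    (hd : DigitsAre I.base I.k x σ) (hdone : σ.nat vDone 0 = 0) :
    Halts increment σ (I.k * 52 + 30) fun σ' =>
      (x + 1 = I.base ^ I.k ∧ σ'.nat vDone 0 = 1) ∨
      (x + 1 < I.base ^ I.k ∧ σ'.nat vDone 0 = 0 ∧ DigitsAre I.base I.k (x + 1) σ') := by
  refine (Halts.setNat_seq (T := (I.k * (40 + 12) + 9) + 10) ?_).mono
    (by simp only [NatExpr.cost]; omega) fun _ _ h => h
  simp only [NatExpr.eval]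
  set σ₁ := σ.storeNat vCarry 0 1 with hσ₁
  have h₁ : Holds I en σ₁ := h.congr (agree_storeNat _ (by decide) _ _) rfl rfl
  have hd₁ : DigitsAre I.base I.k x σ₁ := by
    rw [DigitsAre, hσ₁, storeNat_nat_of_ne _ (by decide)]; exact hd
  have hdone₁ : σ₁.nat vDone 0 = 0 := by rw [hσ₁, storeNat_nat_of_ne _ (by decide)]; exact hdone
  have hcarry₁ : σ₁.nat vCarry 0 = 1 := by simp [hσ₁]
  clear_value σ₁
  -- Before position r is treated, the lower digits are those of x + 1 and the others still those of
  -- x. The carry flag records whether base ^ r divides x + 1, so a carry left at the end means that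
  -- x was the last number.
  refine Halts.seq (Halts.forLoop (fun r σ' => (∀ i < I.k, σ'.nat aDigit i =
    if i < r then digit I.base (x + 1) i else digit I.base x i) ∧
    (σ'.nat vCarry 0 ≠ 0 ↔ I.base ^ r ∣ x + 1)) h₁.budget (by decide) (by decide) (by decide)
    ⟨?_, ?_⟩ ?_) ?_
  · rw [storeNat_nat_of_ne _ (by decide)]
    exact fun i hi => by simpa using hd₁ i hi
  · rw [storeNat_nat_of_ne _ (by decide), hcarry₁]
    simp
  · rintro r hr τ hF ⟨hdig, hcarry⟩ hrτ
    have hbase : 0 < I.base := by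
      rcases Nat.eq_zero_or_pos I.base with h0 | h0
      · rw [h0, zero_pow (by omega)] at hx
        omega
      · exact h0
    have hbτ : τ.nat vBase 0 = I.base := (h₁.frame hF (by decide) (by decide)).base
    have hdr : τ.nat aDigit r = digit I.base x r := by rw [hdig r hr, if_neg (lt_irrefl _)]
    have hsucc := digit_succ (x := x) (r := r) hbase
    have hdvd := pow_succ_dvd_succ (x := x) (r := r) hbase
    have hupd : ∀ (y : ℕ), y = digit I.base (x + 1) r → ∀ i < I.k,
        Function.update (τ.nat aDigit) r y i =
          if i < r + 1 then digit I.base (x + 1) i else digit I.base x i := by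
      intro y hy i hi
      by_cases hir : i = r
      · subst hir; simp [hy]
      · rw [Function.update_of_ne hir, hdig i hi]
        have : i < r + 1 ↔ i < r := by omega
        simp only [this]
    refine Halts.of_wp ?_ (by decide)
    simp only [incrementDigit, Program.wp, Test.Holds, NatExpr.eval, hrτ, hbτ, hdr]
    refine ⟨fun hc => ⟨fun hb => ?_, fun hb => ?_⟩, fun hc => ?_⟩
    · have hpow := hcarry.1 (by omega)
      rw [if_pos hpow, if_pos hb] at hsucc
      refine ⟨?_, ?_⟩
      · simpa [storeNat_nat_of_ne] using hupd 0 hsucc.symm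
      · rw [hdvd]
        simp only [storeNat_nat_of_ne _ (show vCarry ≠ vStep by decide),
          storeNat_nat_of_ne _ (show vCarry ≠ aDigit by decide)]
        exact iff_of_true (by omega) ⟨hpow, hb⟩
    · have hpow := hcarry.1 (by omega)
      rw [if_pos hpow, if_neg hb] at hsucc
      refine ⟨?_, ?_⟩
      · simpa [storeNat_nat_of_ne] using hupd _ hsucc.symm
      · rw [hdvd]
        simp only [storeNat_nat_of_ne _ (show vCarry ≠ vStep by decide), storeNat_nat_self,
          Function.update_self]
        exact iff_of_false (by omega) fun h => hb h.2
    · have hpow : ¬ I.base ^ r ∣ x + 1 := fun h => hc (by have := hcarry.2 h; omega)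
      rw [if_neg hpow] at hsucc
      refine ⟨?_, ?_⟩
      · rw [storeNat_nat_of_ne _ (by decide)]
        intro i hi
        rw [hdig i hi]
        by_cases hir : i = r
        · subst hir; simp [hsucc]
        · have : i < r + 1 ↔ i < r := by omega
          simp only [this]
      · rw [hdvd, storeNat_nat_of_ne _ (by decide)]
        exact iff_of_false (by omega) fun h => hpow h.1
  · rintro τ hF ⟨hdig, hcarry⟩
    have hdoneτ : τ.nat vDone 0 = 0 := (congrFun (hF.nat _ (by decide)) 0).trans hdone₁
    refine Halts.of_wp ?_ (by decide)
    simp only [Program.wp, Test.Holds, NatExpr.eval]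
    refine ⟨fun hc => Or.inl ⟨?_, by simp⟩, fun hc => Or.inr ⟨?_, hdoneτ, fun r hr => ?_⟩⟩
    · have := Nat.le_of_dvd (by omega) (hcarry.1 (by omega))
      omega
    · refine lt_of_le_of_ne hx fun h => hc ?_
      have := hcarry.2 (by rw [h])
      omega
    · rw [hdig r hr, if_pos hr]

end Steps

/-- Loops whose state is described by a decreasing counter. -/
theorem Halts.loop_counter {b : Test} {P : Program} {T : ℕ} (Inv : ℕ → Memory → Prop) {σ : Memory}
    {m : ℕ} (h0 : Inv m σ)
    (hstep : ∀ x σ', Inv x σ' → b.Holds σ' → Halts P σ' T fun σ'' => ∃ y < x, Inv y σ'') :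
    Halts (.loop b P) σ (m * (T + b.cost) + b.cost) fun σ' => (∃ x, Inv x σ') ∧ ¬ b.Holds σ' := by
  -- The invariant need not determine the counter, so the least possible value serves as the
  -- measure.
  refine (Halts.loop (T := T) (fun σ' => ∃ x, Inv x σ') (fun σ' => sInf {x | Inv x σ'}) ⟨m, h0⟩
    fun σ' _ hI hb => ?_).mono ?_ fun _ _ h => h
  · refine (hstep _ σ' (Nat.sInf_mem hI) hb).mono le_rfl ?_
    rintro σ'' - ⟨y, hy, hI'⟩
    exact ⟨⟨y, hI'⟩, (Nat.sInf_le hI').trans_lt hy⟩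
  · gcongr
    exact Nat.sInf_le h0

/-! ### Setting up the working memory -/

section Preparation

variable {K : Kind} {I : Instance K} {en : Fin I.E.card ≃ I.E} {σ σ' : Memory}

/-- The machine has no multiplication, so two nested loops add 4 * lam to the base k² times. -/
theorem computeBase_spec {k lam : ℕ} (hk : σ.nat vBudget 0 = k) (hlam : σ.nat vLam 0 = lam)
    (h0 : σ.nat vBase 0 = 0) :
    Halts computeBase σ (k * (k * 30 + 21) + 9) fun σ' => σ'.nat vBase 0 = k * (k * (4 * lam)) := by
  refine (Halts.forLoop (T := k * (18 + 12) + 9) (fun j σ' => σ'.nat vBase 0 = j * (k * (4 * lam)))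
    hk (by decide) (by decide) (by decide) ?_ ?_).mono (by apply le_of_eq; ring)
    fun _ _ h => h
  · rw [storeNat_nat_of_ne _ (by decide), h0, zero_mul]
  · intro j hj τ hF hinv _
    have hkτ : τ.nat vBudget 0 = k := (congrFun (hF.nat _ (by decide)) 0).trans hk
    have hlτ : τ.nat vLam 0 = lam := (congrFun (hF.nat _ (by decide)) 0).trans hlam
    refine (Halts.forLoop (fun i σ' => σ'.nat vBase 0 = j * (k * (4 * lam)) + i * (4 * lam)) hkτ
      (by decide) (by decide) (by decide) ?_ ?_).mono le_rfl ?_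
    · rw [storeNat_nat_of_ne _ (by decide), hinv, zero_mul, add_zero]
    · intro i hi ρ hFρ hinvρ _
      have hlρ : ρ.nat vLam 0 = lam := (congrFun (hFρ.nat _ (by decide)) 0).trans hlτ
      refine Halts.of_wp ?_ (by decide)
      simp only [Program.wp, NatExpr.eval, hinvρ, hlρ]
      rw [storeNat_nat_of_ne _ (by decide), storeNat_nat_self, Function.update_self]
      ring
    · intro ρ _ hρ
      rw [storeNat_nat_of_ne _ (by decide), hρ]
      ring

/-- The arcs of the edges with numbers below `j` have been copied. -/
def ArcsCopied (K : Kind) (m j : ℕ) (σ σ' : Memory) : Prop := ∀ i < j,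
  σ'.nat aTail i = σ.nat 1 i ∧ σ'.nat aHead i = σ.nat 2 i ∧ σ'.nat aHead (m + i) = σ.nat 1 i ∧
    σ'.nat aTail (m + i) = σ.nat K.secondTail i

theorem writesNat_copyEdges (K : Kind) :
    (forLoop vEdge vEdges (copyEdge K)).writesNat = [vEdge, aTail, aHead, aHead, aTail,
        vEdge] := rfl

theorem Kind.secondTail_mem (K : Kind) : K.secondTail ∈ [1, 2] := by cases K <;> decide

theorem copyEdges_spec {m : ℕ} (hm : σ.nat vEdges 0 = m) :
    Halts (forLoop vEdge vEdges (copyEdge K)) σ (m * 42 + 9) (ArcsCopied K m m σ) := by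
  refine (Halts.forLoop (T := 30) (fun j σ' => ArcsCopied K m j σ σ') hm (by decide)
    (by simp [copyEdge, Program.writesNat]) (by simp [copyEdge, Program.writesNat]) ?_ ?_).mono
    le_rfl fun _ _ h => h
  · intro i hi
    omega
  · intro j hj τ hF hinv hjτ
    have h1 : τ.nat 1 = σ.nat 1 := hF.nat _ (by rw [writesNat_copyEdges]; decide)
    have h2 : τ.nat 2 = σ.nat 2 := hF.nat _ (by rw [writesNat_copyEdges]; decide)
    have hK : τ.nat K.secondTail = σ.nat K.secondTail := by
      have := K.secondTail_mem
      simp only [List.mem_cons, List.not_mem_nil, or_false] at this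
      rcases this with h | h <;> rw [h] <;> assumption
    have hK' : K.secondTail ≠ aTail ∧ K.secondTail ≠ aHead := by cases K <;> decide
    have hmτ : τ.nat vEdges 0 = m := by
      rw [hF.nat _ (by rw [writesNat_copyEdges]; decide), hm]
    refine Halts.of_wp ?_ (by simp [copyEdge, Program.bound, NatExpr.cost])
    intro i hi
    have hij : m + i ≠ j := by omega
    have hij' : i ≠ m + j := by omega
    rcases Nat.lt_succ_iff_lt_or_eq.1 hi with hi | rfl
    · simpa [storeNat_nat_of_ne, NatExpr.eval, hjτ, hmτ, h1, h2, hK, hK', hij, hij', hi.ne] using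
        hinv i hi
    · have : i ≠ m + i := hij'
      simp [storeNat_nat_of_ne, NatExpr.eval, hjτ, hmτ, h1, h2, hK, hK', Function.update_of_ne this]

/-- A bound on the running time of the preparation. -/
def Instance.prepareTime (I : Instance K) : ℕ := I.E.card * 42 + I.k * (I.k * 30 + 21) + 50

theorem prepare_spec (h : IsInput I en σ) :
    Halts (prepare K) σ I.prepareTime fun σ' => Holds I en σ' ∧ σ'.nat vDone 0 = 0 ∧
      σ'.nat 3 0 = 0 ∧ (∀ i : Fin I.E.card, σ'.nat 4 i = 0) ∧ ∀ r, σ'.nat aDigit r = 0 := by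
  refine (Halts.seq (T₁ := 32) (Q := fun σ₁ => σ₁.nat vN 0 = I.n ∧ σ₁.nat vEdges 0 = I.E.card ∧
    σ₁.nat vLam 0 = I.lam ∧ σ₁.nat vBudget 0 = I.k ∧ σ₁.nat vArcs 0 = I.E.card + I.E.card)
    (Halts.of_wp ?_ (by decide)) (T₂ := I.E.card * 42 + 9 + (I.k * (I.k * 30 + 21) + 9)) ?_).mono
    (by simp only [Instance.prepareTime]; omega) fun _ _ h => h
  · simp [Program.wp, NatExpr.eval, storeNat_nat_of_ne, h.num_vertices, h.num_edges,
      h.connectivity, h.budget]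
  · rintro σ₁ hF₁ ⟨hn, hm, hlam, hk, hM⟩
    refine Halts.seq (copyEdges_spec hm) fun σ₂ hF₂ hcopy => ?_
    have hnat₂ : ∀ a, a ∉ [vEdge, aTail, aHead] → σ₂.nat a = σ₁.nat a := fun a ha =>
      hF₂.nat a (by rw [writesNat_copyEdges]; simp at ha ⊢; tauto)
    have hblank₂ : ∀ a j, 3 ≤ a → a ∉ [vN, vEdges, vLam, vBudget, vArcs, vEdge, aTail, aHead] →
        σ₂.nat a j = 0 := by
      intro a j ha hal
      simp only [List.mem_cons, List.not_mem_nil, or_false, not_or] at hal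
      rw [hnat₂ a (by simp [hal]), hF₁.nat a (by simp [Program.writesNat, hal]),
        h.blank_nat a j ha]
    refine (computeBase_spec (k := I.k) (lam := I.lam) (by rw [hnat₂ _ (by decide), hk])
      (by rw [hnat₂ _ (by decide), hlam]) (hblank₂ _ _ (by decide) (by decide))).mono le_rfl ?_
    intro σ₃ hF₃ hbase
    have hnat₃ : ∀ a, a ∉ [vEdge, aTail, aHead, vOther, vBase] → σ₃.nat a = σ₁.nat a := by
      intro a ha
      simp only [List.mem_cons, List.not_mem_nil, or_false, not_or] at ha
      rw [hF₃.nat a (by simp [computeBase, forLoop, Program.writesNat, ha]),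
        hnat₂ a (by simp [ha])]
    have hblank₃ : ∀ a j, 3 ≤ a → a ∉ [vN, vEdges, vLam, vBudget, vArcs, vEdge, aTail, aHead,
        vOther, vBase] → σ₃.nat a j = 0 := by
      intro a j ha hal
      simp only [List.mem_cons, List.not_mem_nil, or_false, not_or] at hal
      rw [hF₃.nat a (by simp [computeBase, forLoop, Program.writesNat, hal]),
        hblank₂ a j ha (by simp [hal])]
    have htail : σ₃.nat aTail = σ₂.nat aTail := hF₃.nat _ (by decide)
    have hhead : σ₃.nat aHead = σ₂.nat aHead := hF₃.nat _ (by decide)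
    have hreal : σ₃.real = σ.real := by
      funext a
      rw [hF₃.real a (by simp [computeBase, forLoop, Program.writesReal]),
        hF₂.real a (by simp [copyEdge, forLoop, Program.writesReal]),
        hF₁.real a (by simp [Program.writesReal])]
    have hends : ∀ i : Fin I.E.card, ∃ u v : Fin I.n, K.Joins (en i : K.Edge (Fin I.n)) u v ∧
        σ₃.nat aTail i = u ∧ σ₃.nat aHead i = v ∧ σ₃.nat aHead (I.E.card + i) = u ∧
        σ₃.nat aTail (I.E.card + i) = if K.secondTail = 1 then (u : ℕ) else v := by
      intro i
      obtain ⟨u, v, huv, hu, hv⟩ := h.ends i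
      obtain ⟨h1, h2, h3, h4⟩ := hcopy i i.2
      have e1 : σ₁.nat 1 = σ.nat 1 := hF₁.nat _ (by decide)
      have e2 : σ₁.nat 2 = σ.nat 2 := hF₁.nat _ (by decide)
      rw [e1, hu] at h1 h3
      rw [e2, hv] at h2
      refine ⟨u, v, huv, by rw [htail, h1], by rw [hhead, h2], by rw [hhead, h3], ?_⟩
      rw [htail, h4]
      have := K.secondTail_mem
      simp only [List.mem_cons, List.not_mem_nil, or_false] at this
      rcases this with h' | h' <;> rw [h']
      · rw [e1, hu, if_pos rfl]
      · rw [e2, hv, if_neg (by decide)]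
    have hlt : ∀ j < I.E.card + I.E.card, σ₃.nat aTail j < I.n ∧ σ₃.nat aHead j < I.n := by
      intro j hj
      by_cases hjm : j < I.E.card
      · obtain ⟨u, v, -, h1, h2, -, -⟩ := hends ⟨j, hjm⟩
        simp only at h1 h2
        rw [h1, h2]
        exact ⟨u.2, v.2⟩
      · obtain ⟨u, v, -, -, -, h1, h2⟩ := hends ⟨j - I.E.card, by omega⟩
        simp only [show I.E.card + (j - I.E.card) = j by omega] at h1 h2
        rw [h1, h2]
        refine ⟨?_, u.2⟩
        split_ifs
        exacts [u.2, v.2]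
    refine ⟨⟨⟨?_, ?_, ?_, fun j hj => (hlt j hj).1, fun j hj => (hlt j hj).2⟩, ?_, ?_, hbase, hends,
      ?_, fun i => ?_⟩, hblank₃ _ _ (by decide) (by decide), hblank₃ _ _ (by decide) (by decide),
      fun i => hblank₃ _ _ (by decide) (by decide), fun r => hblank₃ _ _ (by decide) (by decide)⟩
    · rw [hnat₃ _ (by decide), hn]
    · rw [hnat₃ _ (by decide), hM]
    · rw [hnat₃ _ (by decide), hlam]
    · rw [hnat₃ _ (by decide), hm]
    · rw [hnat₃ _ (by decide), hk]
    · rw [hreal, h.target]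
    · rw [hreal, h.weight]; rfl

end Preparation

/-! ### Soundness and completeness of the whole search -/

section Main

variable {K : Kind} {I : Instance K} {en : Fin I.E.card ≃ I.E} {σ σ' : Memory}

/-- The edges, given by their numbers. -/
def edgeEmbedding (en : Fin I.E.card ≃ I.E) : Fin I.E.card ↪ K.Edge (Fin I.n) :=
  en.toEmbedding.trans (Function.Embedding.subtype _)

theorem cutConnected_map (lam : ℕ) (S : Finset (Fin I.E.card)) :
    CutConnected K.Joins lam (S.map (edgeEmbedding en)) ↔ CutConnected (edgeRel I en) lam S := by
  have hcut : ∀ X : Set (Fin I.n), (cut K.Joins (S.map (edgeEmbedding en)) X).card =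
      (cut (edgeRel I en) S X).card := by
    intro X
    unfold cut
    rw [Finset.filter_map, Finset.card_map]
    rfl
  simp only [CutConnected, hcut]

theorem map_edgeEmbedding_univ : Finset.univ.map (edgeEmbedding en) = I.E := by
  ext e
  simp only [Finset.mem_map, Finset.mem_univ, true_and]
  exact ⟨fun ⟨i, hi⟩ => hi ▸ (en i).2, fun he => ⟨en.symm ⟨e, he⟩, by simp [edgeEmbedding]⟩⟩

/-- A run keeps track of the surviving edges A, whereas solutions are sets of deleted edges; hence
the complement. -/
theorem isSolution_map {A : Finset (Fin I.E.card)} :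
    I.IsSolution ((Finset.univ \ A).map (edgeEmbedding en)) ↔ (Finset.univ \ A).card ≤ I.k ∧
      CutConnected (edgeRel I en) I.lam A ∧ I.α ≤ ∑ i ∈ Finset.univ \ A, edgeWeight I en i := by
  have hsub : (Finset.univ \ A).map (edgeEmbedding en) ⊆ I.E :=
    (Finset.map_subset_map.2 (Finset.subset_univ _)).trans map_edgeEmbedding_univ.subset
  have hrest : ((I.E : Set (K.Edge (Fin I.n))) \
      (((Finset.univ \ A).map (edgeEmbedding en) : Finset _) : Set (K.Edge (Fin I.n)))) =
      ((A.map (edgeEmbedding en) : Finset _) : Set (K.Edge (Fin I.n))) := by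
    refine (congrArg (fun S : Finset (K.Edge (Fin I.n)) => (S : Set (K.Edge (Fin I.n))) \
      (((Finset.univ \ A).map (edgeEmbedding en) : Finset _) : Set (K.Edge (Fin I.n))))
      (map_edgeEmbedding_univ (en := en)).symm).trans ?_
    rw [← Finset.coe_sdiff, ← Finset.map_sdiff]
    simp
  rw [Instance.IsSolution, and_iff_right hsub, Finset.card_map, hrest,
    edgeConnected_iff K I.lam_pos, cutConnected_map, Finset.sum_map]
  rfl

theorem exists_map_eq {F : Finset (K.Edge (Fin I.n))} (hF : F ⊆ I.E) :
    ∃ A, (Finset.univ \ A).map (edgeEmbedding en) = F := by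
  refine ⟨Finset.univ.filter fun i => edgeEmbedding en i ∉ F, ?_⟩
  ext e
  simp only [Finset.mem_map, Finset.mem_sdiff, Finset.mem_filter, Finset.mem_univ, true_and,
    not_not]
  refine ⟨fun ⟨i, hi, hie⟩ => hie ▸ hi, fun he => ⟨en.symm ⟨e, hF he⟩, ?_, ?_⟩⟩ <;>
    simp [edgeEmbedding, he]

theorem cutConnected_univ : CutConnected (edgeRel I en) I.lam Finset.univ := by
  rw [← cutConnected_map, map_edgeEmbedding_univ, ← edgeConnected_iff K I.lam_pos]
  exact I.edgeConnected

/-- The weight of the edges that are removed according to the digits of `x`. -/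
noncomputable def removedWeight (I : Instance K) (en : Fin I.E.card ≃ I.E) (x : ℕ) : ℝ :=
  ∑ i ∈ Finset.univ \ runEdges I en (digit I.base x) I.k, edgeWeight I en i

/-- Soundness: size and connectivity are guaranteed for every run, so only the weight has to be
compared with the target. -/
theorem isOutput_of_le {x : ℕ} (h3 : σ.nat 3 0 = 1) (hx : I.α ≤ removedWeight I en x)
    (h4 : ∀ i : Fin I.E.card, σ.nat 4 i = 1 ↔ i ∉ runEdges I en (digit I.base x) I.k) :
    IsOutput I en σ := by
  refine Or.inl ⟨h3, _, isSolution_map.2 ⟨card_sdiff_run _ _ _,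
    cutConnected_run (w := edgeWeight I en) cutConnected_univ (digit I.base x) I.k, hx⟩,
    fun i => ?_⟩
  rw [h4]
  change _ ↔ edgeEmbedding en i ∈ _
  rw [Finset.mem_map']
  simp

/-- Completeness: by `exists_run_weight` a solution would be matched in weight by some sequence of
digits, and by `exists_digits` that sequence belongs to a number that has been examined. -/
theorem isOutput_of_forall_lt (h3 : σ.nat 3 0 = 0)
    (hx : ∀ x < I.base ^ I.k, removedWeight I en x < I.α) : IsOutput I en σ := by
  refine Or.inr ⟨h3, ?_⟩
  rintro ⟨F, hF⟩
  obtain ⟨A, rfl⟩ := exists_map_eq (en := en) hF.1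
  obtain ⟨h1, h2, h3⟩ := isSolution_map.1 hF
  obtain ⟨c, hc, hcw⟩ := exists_run_weight (N := I.base) isEdgeSystem_edgeRel I.lam_pos
    (w := edgeWeight I en) (fun i => (I.w _).2) cutConnected_univ (Finset.sdiff_subset) h1
    (by unfold Instance.base; apply le_of_eq; ring) (by simpa using h2)
  obtain ⟨x, hxN, hxc⟩ := exists_digits I.base I.k c hc
  refine absurd (hx x hxN) (not_lt.2 (h3.trans (hcw.trans (le_of_eq ?_))))
  rw [removedWeight, runEdges, run_congr _ hxc]

/-- A bound on the running time of `examine`. -/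
def Instance.examineTime (I : Instance K) : ℕ :=
  I.E.card * 94 + I.k * (I.removeTime + 64) + 100

/-- The state of the search before the digits of `x` are examined. -/
structure Searching (I : Instance K) (en : Fin I.E.card ≃ I.E) (x : ℕ) (σ : Memory) : Prop where
  running : σ.nat vDone 0 = 0
  lt : x < I.base ^ I.k
  digits : DigitsAre I.base I.k x σ
  answer : σ.nat 3 0 = 0
  blank : ∀ i : Fin I.E.card, σ.nat 4 i = 0
  failed : ∀ y < x, removedWeight I en y < I.α

theorem examine_spec (h : Holds I en σ) {x : ℕ} (hx : Searching I en x σ) :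
    Halts examine σ I.examineTime fun σ' => Holds I en σ' ∧
      (σ'.nat vDone 0 = 1 ∧ IsOutput I en σ' ∨ Searching I en (x + 1) σ') := by
  refine Halts.mono (Q := fun σ' => σ'.nat vDone 0 = 1 ∧ IsOutput I en σ' ∨
    Searching I en (x + 1) σ') ?_ le_rfl
    fun σ' hF hσ' => ⟨h.frame hF (by decide) (by decide), hσ'⟩
  refine ((simulate_spec h).seq (T₂ := I.E.card * 30 + 20 + (5 + (I.E.card * 30 + I.k * 52 + 30)))
    fun σ₁ hF₁ hA₁ => ?_).mono ?_ fun _ _ h => h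
  swap
  · have h1 : I.k * (I.removeTime + 64) = I.k * (I.removeTime + 12) + I.k * 52 := by ring
    simp only [Instance.examineTime]
    omega
  have hrun : runEdges I en (σ.nat aDigit) I.k = runEdges I en (digit I.base x) I.k :=
    run_congr _ hx.digits
  rw [hrun] at hA₁
  have h₁ : Holds I en σ₁ := h.frame hF₁ (by decide) (by decide)
  refine (computeWeight_spec h₁ hA₁).seq ?_
  rintro σ₂ hF₂ ⟨hA₂, hw⟩
  have h₂ : Holds I en σ₂ := h₁.frame hF₂ (by decide) (by decide)
  change σ₂.real 2 0 = removedWeight I en x at hw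
  have hnat : ∀ a ∈ [3, 4, aDigit, vDone], σ₂.nat a = σ.nat a := by
    intro a ha
    simp only [List.mem_cons, List.not_mem_nil, or_false] at ha
    rcases ha with rfl | rfl | rfl | rfl <;>
      rw [hF₂.nat _ (by decide), hF₁.nat _ (by decide)]
  have hanswer₂ : σ₂.nat 3 0 = 0 := by rw [hnat _ (by decide)]; exact hx.answer
  have hblank₂ : ∀ i : Fin I.E.card, σ₂.nat 4 i = 0 := by
    rw [hnat _ (by decide)]; exact hx.blank
  refine Halts.ite (fun hle => ?_) fun hlt => ?_
  · simp only [Test.Holds, RealExpr.eval, NatExpr.eval, h₂.target, hw] at hle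
    refine (report_spec h₂ hA₂ hblank₂).mono (by omega) ?_
    rintro σ₃ - ⟨h3, hdone, h4⟩
    exact Or.inl ⟨hdone, isOutput_of_le h3 hle h4⟩
  · simp only [Test.Holds, RealExpr.eval, NatExpr.eval, h₂.target, hw, not_le] at hlt
    have hfail : ∀ y < x + 1, removedWeight I en y < I.α := by
      intro y hy
      rcases Nat.lt_succ_iff_lt_or_eq.1 hy with hy | rfl
      exacts [hx.failed y hy, hlt]
    refine (increment_spec h₂ hx.lt (by rw [DigitsAre, hnat _ (by decide)]; exact hx.digits)
      (by rw [hnat _ (by decide)]; exact hx.running)).mono (by omega) ?_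
    intro σ₃ hF₃ hσ₃
    have hanswer₃ : σ₃.nat 3 0 = 0 := by rw [hF₃.nat _ (by decide)]; exact hanswer₂
    rcases hσ₃ with ⟨hlast, hdone⟩ | ⟨hlt, hdone, hdig⟩
    · exact Or.inl ⟨hdone, isOutput_of_forall_lt hanswer₃ (by rwa [← hlast])⟩
    · exact Or.inr ⟨hdone, hlt, hdig, hanswer₃, by rw [hF₃.nat _ (by decide)]; exact hblank₂, hfail⟩

/-- For k = 0 the base is 0, but 0 ^ 0 = 1: the empty sequence of digits is still examined. -/
theorem Instance.base_pow_pos (I : Instance K) : 0 < I.base ^ I.k := by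
  rcases Nat.eq_zero_or_pos I.k with h | h
  · simp [h]
  · have := I.lam_pos
    unfold Instance.base
    positivity

/-- A bound on the running time of the algorithm. -/
def Instance.solveTime (I : Instance K) : ℕ :=
  I.prepareTime + (I.base ^ I.k * (I.examineTime + 4) + 4)

theorem solve_spec (h : IsInput I en σ) : Halts (solve K) σ I.solveTime (IsOutput I en) := by
  refine (prepare_spec h).seq ?_
  rintro σ₁ - ⟨h₁, hdone, h3, h4, hdig⟩
  -- The counter y is the number of digit sequences not yet examined, and it is set to 0 as soon as
  -- the answer is known.
  refine (Halts.loop_counter (T := I.examineTime) (m := I.base ^ I.k) (fun y σ' => Holds I en σ' ∧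
    (σ'.nat vDone 0 = 1 ∧ IsOutput I en σ' ∨ ∃ x, x + y = I.base ^ I.k ∧ Searching I en x σ'))
    ⟨h₁, Or.inr ⟨0, zero_add _, hdone, I.base_pow_pos, fun r _ => ?_, h3, h4, by simp⟩⟩ ?_).mono
    le_rfl ?_
  · rw [hdig]; simp [digit]
  · rintro y σ' ⟨hσ', hcase⟩ hb
    simp only [Test.Holds, NatExpr.eval] at hb
    rcases hcase with ⟨hd, -⟩ | ⟨x, hxy, hx⟩
    · omega
    refine (examine_spec hσ' hx).mono le_rfl ?_
    have hlt := hx.lt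
    rintro σ'' - ⟨hσ'', hcase | hx'⟩
    · exact ⟨0, by omega, hσ'', Or.inl hcase⟩
    · exact ⟨y - 1, by omega, hσ'', Or.inr ⟨x + 1, by omega, hx'⟩⟩
  · rintro σ' - ⟨⟨y, -, hcase | ⟨x, -, hx⟩⟩, hb⟩
    · exact hcase.2
    · refine absurd ?_ hb
      simp only [Test.Holds, NatExpr.eval, hx.running, le_refl]

end Main

/-! ## The running time -/

theorem Instance.card_edges_le {K : Kind} (I : Instance K) : I.E.card ≤ I.n ^ 2 := by
  rw [sq]
  cases K with
  | directed => simpa using Finset.card_le_univ I.E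
  | undirected =>
    refine (Finset.card_le_univ I.E).trans ?_
    refine (Fintype.card_le_of_surjective (fun p : Fin I.n × Fin I.n => s(p.1, p.2)) ?_).trans
      (by simp)
    exact fun e => Sym2.ind (fun x y => ⟨(x, y), rfl⟩) e

/-- For k ≥ 2 the bases are compared directly; the factor 2 is needed for k = 1. -/
theorem two_pow_le_two_mul_pow_self (k : ℕ) : 2 ^ k ≤ 2 * k ^ k := by
  rcases Nat.lt_or_ge k 2 with hk | hk
  · interval_cases k <;> simp
  · have := Nat.pow_le_pow_left hk k
    omega

theorem pow_self_pos (k : ℕ) : 0 < k ^ k := by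
  rcases Nat.eq_zero_or_pos k with rfl | h
  · simp
  · positivity

/-- The factor 4 ^ k is the square of 2 ^ k and is absorbed by k ^ k up to a constant, so no term 2
^ k without a logarithm remains. -/
theorem Instance.base_pow_le {K : Kind} (I : Instance K) :
    I.base ^ I.k ≤ 4 * (I.k ^ I.k * I.lam ^ I.k) ^ 4 := by
  have h2 := two_pow_le_two_mul_pow_self I.k
  have hL : 1 ≤ I.lam ^ I.k := Nat.one_le_pow _ _ I.lam_pos
  calc I.base ^ I.k = (I.k ^ I.k) ^ 2 * (2 ^ I.k) ^ 2 * I.lam ^ I.k := by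
        unfold Instance.base
        rw [mul_pow, mul_pow, mul_pow, show (4 : ℕ) = 2 * 2 by rfl, mul_pow]
        ring
    _ ≤ (I.k ^ I.k) ^ 2 * (2 * I.k ^ I.k) ^ 2 * (I.lam ^ I.k) ^ 4 := by
        refine Nat.mul_le_mul ?_ (le_self_pow hL (by decide))
        gcongr
    _ = 4 * (I.k ^ I.k * I.lam ^ I.k) ^ 4 := by ring

theorem testPairTime_le {n m L : ℕ} (hn : 0 < n) (hL : 0 < L) (hm : m ≤ n ^ 2) :
    testPairTime n (m + m) L ≤ 1000 * (L * n ^ 3) := by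
  have h1 : n + 1 ≤ 2 * n := by omega
  calc testPairTime n (m + m) L
      ≤ L * ((2 * n) * (112 * (n ^ 2 + n ^ 2) + 172) + 112) + 17 * (n ^ 2 + n ^ 2) + 60 := by
        unfold testPairTime
        gcongr
    _ = 448 * (L * n ^ 3) + 344 * (L * n) + 112 * (L * 1) + 34 * (1 * n ^ 2) + 60 * (1 * 1) := by
        ring
    _ ≤ 448 * (L * n ^ 3) + 344 * (L * n ^ 3) + 112 * (L * n ^ 3) + 34 * (L * n ^ 3) +
        60 * (L * n ^ 3) := by
        gcongr
        · exact le_self_pow hn (by decide)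
        · exact Nat.one_le_pow _ _ hn
        · exact hL
        · decide
        · exact hL
        · exact Nat.one_le_pow _ _ hn
    _ ≤ 1000 * (L * n ^ 3) := by omega

theorem testTime_le {n m L : ℕ} (hn : 0 < n) (hL : 0 < L) (hm : m ≤ n ^ 2) :
    testTime n (m + m) L ≤ 1100 * (L * n ^ 5) := by
  have h := testPairTime_le hn hL hm
  calc testTime n (m + m) L ≤ n * (n * (1000 * (L * n ^ 3) + 12) + 21) + 13 := by
        unfold testTime
        gcongr
    _ = 1000 * (L * n ^ 5) + 12 * (1 * n ^ 2) + 21 * (1 * n ^ 1) + 13 * (1 * n ^ 0) := by ring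
    _ ≤ 1000 * (L * n ^ 5) + 12 * (L * n ^ 5) + 21 * (L * n ^ 5) + 13 * (L * n ^ 5) := by
        gcongr <;> omega
    _ ≤ 1100 * (L * n ^ 5) := by omega

theorem Instance.removeTime_le {K : Kind} (I : Instance K) :
    I.removeTime ≤ 1400 * (I.lam * I.n ^ 7) := by
  have hn := I.n_pos
  have hL := I.lam_pos
  have hm := I.card_edges_le
  have h := testTime_le hn hL hm
  calc I.removeTime ≤ I.n ^ 2 * (1100 * (I.lam * I.n ^ 5) + 72) +
        I.n ^ 2 * (I.n ^ 2 * 112 + 92) + 18 := by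
        unfold Instance.removeTime Instance.testTime
        gcongr
    _ = 1100 * (I.lam * I.n ^ 7) + 72 * (1 * I.n ^ 2) + 112 * (1 * I.n ^ 4) + 92 * (1 * I.n ^ 2) +
        18 * (1 * I.n ^ 0) := by ring
    _ ≤ 1100 * (I.lam * I.n ^ 7) + 72 * (I.lam * I.n ^ 7) + 112 * (I.lam * I.n ^ 7) +
        92 * (I.lam * I.n ^ 7) + 18 * (I.lam * I.n ^ 7) := by
        gcongr <;> omega
    _ ≤ 1400 * (I.lam * I.n ^ 7) := by omega

/-- Everything is measured by q = k ^ k * lam ^ k, which dominates k and k * lam; for k = 0 no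
connectivity test is run, so lam does not enter. The exponent 6 combines q ^ 4 for the number of
digit sequences with a generous q ^ 2 for examining one. -/
theorem Instance.solveTime_le {K : Kind} (I : Instance K) :
    I.solveTime ≤ 7000 * ((I.k ^ I.k * I.lam ^ I.k) ^ 6 * I.n ^ 7) := by
  have hn := I.n_pos
  have hL := I.lam_pos
  have hm := I.card_edges_le
  have hr := I.removeTime_le
  have hb := I.base_pow_le
  have hkk := pow_self_pos I.k
  set q := I.k ^ I.k * I.lam ^ I.k with hq
  have hq1 : 0 < q := by positivity
  have hkL : I.k ≤ q ∧ I.k * I.lam ≤ q := by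
    rcases Nat.eq_zero_or_pos I.k with h0 | h0
    · simp [h0]
    · have h1 : I.k * I.lam ≤ q := Nat.mul_le_mul (Nat.le_self_pow h0.ne' _)
        (Nat.le_self_pow h0.ne' _)
      exact ⟨(Nat.le_mul_of_pos_right _ hL).trans h1, h1⟩
  have hexamine : I.examineTime ≤ 1700 * (q ^ 2 * I.n ^ 7) := by
    calc I.examineTime ≤ I.n ^ 2 * 94 + I.k * (1400 * (I.lam * I.n ^ 7) + 64) + 100 := by
          unfold Instance.examineTime
          gcongr
      _ = 94 * (1 * I.n ^ 2) + 1400 * (I.k * I.lam * I.n ^ 7) + 64 * (I.k * I.n ^ 0) +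
          100 * (1 * I.n ^ 0) := by ring
      _ ≤ 94 * (q ^ 2 * I.n ^ 7) + 1400 * (q ^ 2 * I.n ^ 7) + 64 * (q ^ 2 * I.n ^ 7) +
          100 * (q ^ 2 * I.n ^ 7) := by
          have h1 : q ≤ q ^ 2 := le_self_pow hq1 (by decide)
          have h2 : 1 ≤ q ^ 2 := Nat.one_le_pow _ _ hq1
          have h3 := hkL.1.trans h1
          have h4 := hkL.2.trans h1
          gcongr <;> omega
      _ ≤ 1700 * (q ^ 2 * I.n ^ 7) := by omega
  calc I.solveTime ≤ I.n ^ 2 * 42 + q * (q * 30 + 21) + 50 +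
        (4 * q ^ 4 * (1700 * (q ^ 2 * I.n ^ 7) + 4) + 4) := by
        unfold Instance.solveTime Instance.prepareTime
        have := hkL.1
        gcongr
    _ = 42 * (q ^ 0 * I.n ^ 2) + 30 * (q ^ 2 * I.n ^ 0) + 21 * (q ^ 1 * I.n ^ 0) +
        54 * (q ^ 0 * I.n ^ 0) + 6800 * (q ^ 6 * I.n ^ 7) + 16 * (q ^ 4 * I.n ^ 0) := by ring
    _ ≤ 42 * (q ^ 6 * I.n ^ 7) + 30 * (q ^ 6 * I.n ^ 7) + 21 * (q ^ 6 * I.n ^ 7) +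
        54 * (q ^ 6 * I.n ^ 7) + 6800 * (q ^ 6 * I.n ^ 7) + 16 * (q ^ 6 * I.n ^ 7) := by
        gcongr <;> omega
    _ ≤ 7000 * (q ^ 6 * I.n ^ 7) := by omega

/-- This turns the exponential bound into powers of natural numbers. For k = 0 both sides are 1, in
accordance with the convention 0 log 0 = 0. -/
theorem two_rpow_mul_logb (c k : ℕ) {L : ℕ} (hL : 0 < L) :
    (2 : ℝ) ^ ((c : ℝ) * ((k : ℝ) * (Real.logb 2 k + Real.logb 2 L))) =
      (((k ^ k * L ^ k) ^ c : ℕ) : ℝ) := by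
  rcases Nat.eq_zero_or_pos k with rfl | hk
  · simp
  · have hk' : (0 : ℝ) < k := by exact_mod_cast hk
    have hL' : (0 : ℝ) < L := by exact_mod_cast hL
    rw [← Real.logb_mul hk'.ne' hL'.ne', mul_comm (c : ℝ), Real.rpow_mul_natCast (by norm_num),
      mul_comm (k : ℝ), Real.rpow_mul_natCast (by norm_num),
      Real.rpow_logb (by norm_num) (by norm_num) (by positivity)]
    push_cast
    rw [mul_pow]

/-- For k ≥ 2 the reason is L ≤ 2 ^ L ≤ k ^ L. The additional factor L is needed for k = 1, where k
^ k = 1. -/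
theorem pow_le_mul_pow_self_pow {L : ℕ} (hL : 0 < L) (k : ℕ) : L ^ k ≤ L * (k ^ k) ^ L := by
  rcases Nat.lt_or_ge k 2 with hk | hk
  · interval_cases k
    · simpa using Nat.succ_le_of_lt hL
    · simp
  · calc L ^ k ≤ (k ^ L) ^ k := Nat.pow_le_pow_left
          (Nat.lt_two_pow_self.le.trans (Nat.pow_le_pow_left hk L)) k
      _ = (k ^ k) ^ L := by rw [← pow_mul, ← pow_mul, mul_comm]
      _ ≤ L * (k ^ k) ^ L := Nat.le_mul_of_pos_left _ hL

theorem solvesWithin_solve {K : Kind} {T : Instance K → ℝ} (h : ∀ I, (I.solveTime : ℝ) ≤ T I) :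
    SolvesWithin K (solve K) T := by
  intro I en σ hσ
  obtain ⟨t, σ', hrun, ht, hout⟩ := solve_spec hσ
  exact ⟨t, σ', hrun, (Nat.cast_le.2 ht).trans (h I), hout⟩

end WeightedECS

theorem theorem3 (K : WeightedECS.Kind) :
    ∃ (P : WeightedECS.Program) (c : ℕ),
      WeightedECS.SolvesWithin K P (fun I =>
        (c : ℝ) * (2 : ℝ) ^ ((c : ℝ) * ((I.k : ℝ) * (Real.logb 2 I.k + Real.logb 2 I.lam)))
          * (I.n : ℝ) ^ c) ∧
      ∃ d : ℕ → ℕ,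
        WeightedECS.SolvesWithin K P (fun I =>
          (d I.lam : ℝ) * (2 : ℝ) ^ ((d I.lam : ℝ) * ((I.k : ℝ) * Real.logb 2 I.k))
            * (I.n : ℝ) ^ c) := by
  -- The constant 7000 is the factor in `solveTime_le` and also serves as a generous exponent. In
  -- the second bound, 7000 * L ^ 6 is the factor that remains when lam ^ k is replaced by lam * (k
  -- ^ k) ^ lam inside a sixth power, and 6 * L + 6 is the resulting exponent of k ^ k.
  refine ⟨WeightedECS.solve K, 7000, WeightedECS.solvesWithin_solve fun I => ?_,
    fun L => 7000 * L ^ 6 + 6 * L + 6, WeightedECS.solvesWithin_solve fun I => ?_⟩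
  · have hL := I.lam_pos
    have hn := I.n_pos
    have hkk := WeightedECS.pow_self_pos I.k
    have hq : 0 < I.k ^ I.k * I.lam ^ I.k := by positivity
    rw [WeightedECS.two_rpow_mul_logb _ _ hL, mul_assoc]
    refine (Nat.cast_le.2 (I.solveTime_le.trans (b := _) (c := 7000 *
      ((I.k ^ I.k * I.lam ^ I.k) ^ 7000 * I.n ^ 7000)) ?_)).trans (le_of_eq (by push_cast; rfl))
    gcongr <;> omega
  · have hL := I.lam_pos
    have hn := I.n_pos
    have hkk := WeightedECS.pow_self_pos I.k
    have hlog := WeightedECS.two_rpow_mul_logb (7000 * I.lam ^ 6 + 6 * I.lam + 6) I.k one_pos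
    rw [Nat.cast_one, Real.logb_one, add_zero, one_pow, mul_one] at hlog
    rw [hlog, mul_assoc]
    refine (Nat.cast_le.2 (I.solveTime_le.trans (b := _) (c := (7000 * I.lam ^ 6 + 6 * I.lam + 6) *
      ((I.k ^ I.k) ^ (7000 * I.lam ^ 6 + 6 * I.lam + 6) * I.n ^ 7000)) ?_)).trans
      (le_of_eq (by push_cast; rfl))
    calc 7000 * ((I.k ^ I.k * I.lam ^ I.k) ^ 6 * I.n ^ 7)
        ≤ 7000 * ((I.k ^ I.k * (I.lam * (I.k ^ I.k) ^ I.lam)) ^ 6 * I.n ^ 7) := by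
          gcongr
          exact WeightedECS.pow_le_mul_pow_self_pow hL _
      _ = 7000 * I.lam ^ 6 * ((I.k ^ I.k) ^ (6 * I.lam + 6) * I.n ^ 7) := by
          generalize I.k ^ I.k = q
          ring
      _ ≤ _ := by gcongr <;> omega
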